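/- Let $\mathrm{pr}:[0,1]^3\to S^3\subset\mathbb R^4=\mathbb C^2$, $\mathrm{pr}(x,y,z)=\bigl(\sin(\tfrac{\pi x}{2})\,e^{2\pi i y},\ \cos(\tfrac{\pi x}{2})\,e^{-2\pi i z}\bigr)$; it glues the faces $y=0,1$ of the cube and the faces $z=0,1$, contracts the $y$-direction on the front face $x=0$ and the $z$-direction on the back face $x=1$. Orient $S^3$ as the boundary of the unit ball, so that $(\partial_y,\partial_z,-\partial_x)$ (right, up, towards a viewer in front of the front face) is a positive frame. Let $c_f,c_b\subset S^3$ be the images of the front and back faces (two circles), and let $\pi:S^3\setminus(c_f\cup c_b)\to T^2=(\mathbb R/\mathbb Z)^2$, $\pi(\mathrm{pr}(x,y,z))=(y,z)$. Let $K_1,K_2$ be disjoint oriented knots (embedded circles) in $S^3\setminus(c_f\cup c_b)$ such that wherever a strand of $K_1$ and a strand of $K_2$ have the same projection to $T^2$, the diagrams $\pi(K_1)$ and $\pi(K_2)$ are differentiable and cross transversally. Let the closed curve $\pi(K_i)$ in $T^2$ have the homotopy type $(\alpha_i,\beta_i)\in\pi_1(T^2)=\mathbb Z^2$, where $(1,0)$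 is the horizontal loop in the direction of increasing $y$ (left to right) and $(0,1)$ the vertical loop in the direction of increasing $z$ (upwards). At a crossing the strand with the smaller coordinate $x$ is the overcrossing one, and the crossing is positive if (velocity of the overcrossing strand, velocity of the undercrossing strand) is a positive basis of the oriented $(y,z)$-plane, and negative otherwise. Let $\mathrm{cross}_+$ and $\mathrm{cross}_-$ be the numbers of positive and of negative crossings with one strand from $K_1$ and the other from $K_2$, counted as pairs of strands. Then the linking number of $K_1$ and $K_2$ in $S^3$ is $$\mathrm{lk}(K_1,K_2)=\tfrac12\bigl(\mathrm{cross}_+-\mathrm{cross}_--\alpha_1\beta_2-\alpha_2\beta_1\bigr).$$ Here $\mathrm{lk}$ is the integer given, for $C^1$ loops, by the Gauss linking integral of their images under the orientation-preserving stereographic projection from any point of $S^3$ off the loops, and, for continuous closed curves, by its common value on all sufficiently close $C^1$ loops. -/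

import Mathlib

open scoped Real Topology

noncomputable section

namespace TorusDiagram

/-- Ambient Euclidean four-space, with its standard orientation. -/
abbrev E4 : Type := EuclideanSpace ℝ (Fin 4)

/-- The three-sphere, the unit sphere of `E4`, oriented as the boundary of the unit ball: a basis
`u, v, w` of the tangent space at `q` is positive when `det (q, u, v, w) > 0`. -/
abbrev S3 : Type := Metric.sphere (0 : E4) 1

/-- The torus. The first factor is the horizontal coordinate `y`, the second one the vertical
coordinate `z`. -/
abbrev Torus : Type := UnitAddCircle × UnitAddCircle

/-- The projection of the cube `[0,1]³` onto the three-sphere. It identifies the left and right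
faces (`y = 0` and `y = 1`), identifies the bottom and top faces (`z = 0` and `z = 1`), contracts
the horizontal lines (direction `y`) of the front face `x = 0`, and contracts the vertical lines
(direction `z`) of the back face `x = 1`. The sign in the last coordinate makes the frame
"right, up, towards a viewer in front of the front face", that is `∂y, ∂z, -∂x`, positive for the
orientation of `S3`. -/
def cubeMap (x y z : ℝ) : E4 :=
  !₂[Real.sin (π * x / 2) * Real.cos (2 * π * y), Real.sin (π * x / 2) * Real.sin (2 * π * y),
    Real.cos (π * x / 2) * Real.cos (2 * π * z), -(Real.cos (π * x / 2) * Real.sin (2 * π * z))]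

/-- The core circle `c_f`: the image of the front face. -/
def coreFront : Set S3 := {p | ∃ y z : ℝ, (p : E4) = cubeMap 0 y z}

/-- The core circle `c_b`: the image of the back face. -/
def coreBack : Set S3 := {p | ∃ y z : ℝ, (p : E4) = cubeMap 1 y z}

/-- The complex number `sin (π x / 2) * exp (2 π i y)` of the point with cube coordinates
`(x, y, z)`. -/
def horizontalPart (p : S3) : ℂ := ⟨(p : E4) 0, (p : E4) 1⟩

/-- The complex number `cos (π x / 2) * exp (2 π i z)` of the point with cube coordinates
`(x, y, z)`. -/
def verticalPart (p : S3) : ℂ := ⟨(p : E4) 2, -(p : E4) 3⟩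

/-- The cube coordinate `x` (distance from the front face) of a point of the sphere. -/
def depth (p : S3) : ℝ := 2 / π * Real.arcsin ‖horizontalPart p‖

/-- The projection of a point of the sphere to the torus: its cube coordinates `(y, z)` modulo `1`.
It is meaningful (and continuous) off the two core circles. -/
def torusProj (p : S3) : Torus :=
  (((Complex.arg (horizontalPart p) / (2 * π) : ℝ) : UnitAddCircle),
    ((Complex.arg (verticalPart p) / (2 * π) : ℝ) : UnitAddCircle))

theorem norm_sq_parts (p : S3) : ‖horizontalPart p‖ ^ 2 + ‖verticalPart p‖ ^ 2 = 1 := by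
  have h : ‖(p : E4)‖ ^ 2 = 1 := by simp
  rw [EuclideanSpace.norm_sq_eq, Fin.sum_univ_four] at h
  simp only [Real.norm_eq_abs, sq_abs] at h
  rw [← Complex.normSq_eq_norm_sq, ← Complex.normSq_eq_norm_sq, Complex.normSq_apply,
    Complex.normSq_apply]
  simp only [horizontalPart, verticalPart]
  linarith

/-- Every point of the sphere is the image under `cubeMap` of the point of the cube with the
coordinates that `depth` and `torusProj` assign to it. -/
theorem cubeMap_coordinates (p : S3) :
    cubeMap (depth p) (Complex.arg (horizontalPart p) / (2 * π))
      (Complex.arg (verticalPart p) / (2 * π)) = p := by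
  have h := norm_sq_parts p
  have hh := norm_nonneg (horizontalPart p)
  have hv := norm_nonneg (verticalPart p)
  have e (a : ℝ) : 2 * π * (a / (2 * π)) = a := by field_simp
  have ed : π * depth p / 2 = Real.arcsin ‖horizontalPart p‖ := by
    unfold depth; field_simp
  have hs : Real.sin (π * depth p / 2) = ‖horizontalPart p‖ := by
    rw [ed, Real.sin_arcsin (by linarith) (by nlinarith)]
  have hc : Real.cos (π * depth p / 2) = ‖verticalPart p‖ := by
    rw [ed, Real.cos_arcsin, ← h, add_sub_cancel_left, Real.sqrt_sq hv]
  unfold cubeMap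
  simp only [e, hs, hc, Complex.norm_mul_cos_arg, Complex.norm_mul_sin_arg]
  ext i
  fin_cases i <;> simp [horizontalPart, verticalPart]

/-- The loop in the torus which runs `a` times in the horizontal direction (left to right) and `b`
times in the vertical direction (upwards). -/
def torusLoop (a b : ℤ) : C(UnitAddCircle, Torus) where
  toFun s := (a • s, b • s)
  continuous_toFun := by fun_prop

/-- The diagram of the closed curve `K` on the torus, as a closed curve in the torus, has the
homotopy type `(a, b)`. -/
def HasHomotopyType (K : C(UnitAddCircle, S3)) (a b : ℤ) : Prop :=
  ∃ D : C(UnitAddCircle, Torus), (∀ s, D s = torusProj (K s)) ∧ D.Homotopic (torusLoop a b)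

/-- The diagram of `K` on the torus is differentiable at the parameter `s`, with velocity `v`
(components in the directions `y` and `z`): a lift of it to the plane has derivative `v`. -/
def HasVelocity (K : C(UnitAddCircle, S3)) (s : UnitAddCircle) (v : ℝ × ℝ) : Prop :=
  ∃ γ : ℝ → ℝ × ℝ,
    (∀ᶠ h : ℝ in 𝓝 0, torusProj (K (s + (h : UnitAddCircle))) =
      (((γ h).1 : UnitAddCircle), ((γ h).2 : UnitAddCircle))) ∧
    HasDerivAt γ v 0

/-- The strand of `K₁` at the parameter `s` and the strand of `K₂` at the parameter `t` project to
the same point of the torus. -/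
def IsCrossing (K₁ K₂ : C(UnitAddCircle, S3)) (s t : UnitAddCircle) : Prop :=
  torusProj (K₁ s) = torusProj (K₂ t)

/-- The two diagrams are in general position with respect to each other: at each crossing of a
strand of `K₁` with a strand of `K₂` both diagrams are differentiable and they cross
transversally. -/
def InGeneralPosition (K₁ K₂ : C(UnitAddCircle, S3)) : Prop :=
  ∀ s t, IsCrossing K₁ K₂ s t →
    ∃ u v : ℝ × ℝ, HasVelocity K₁ s u ∧ HasVelocity K₂ t v ∧ u.1 * v.2 - u.2 * v.1 ≠ 0

/-- A positive crossing: the pair (velocity of the overcrossing strand, velocity of the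
undercrossing strand) is a positive basis of the plane seen from the front. The strand with the
smaller depth crosses over the other one. -/
def IsPositiveCrossing (K₁ K₂ : C(UnitAddCircle, S3)) (s t : UnitAddCircle) : Prop :=
  IsCrossing K₁ K₂ s t ∧ ∃ u v : ℝ × ℝ, HasVelocity K₁ s u ∧ HasVelocity K₂ t v ∧
    0 < (depth (K₂ t) - depth (K₁ s)) * (u.1 * v.2 - u.2 * v.1)

/-- A negative crossing. -/
def IsNegativeCrossing (K₁ K₂ : C(UnitAddCircle, S3)) (s t : UnitAddCircle) : Prop :=
  IsCrossing K₁ K₂ s t ∧ ∃ u v : ℝ × ℝ, HasVelocity K₁ s u ∧ HasVelocity K₂ t v ∧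
    (depth (K₂ t) - depth (K₁ s)) * (u.1 * v.2 - u.2 * v.1) < 0

/-- The number of positive crossings with one strand from `K₁` and the other from `K₂`. (For
curves in general position this set is finite.) -/
def crossPos (K₁ K₂ : C(UnitAddCircle, S3)) : ℕ :=
  {st : UnitAddCircle × UnitAddCircle | IsPositiveCrossing K₁ K₂ st.1 st.2}.ncard

/-- The number of negative crossings with one strand from `K₁` and the other from `K₂`. -/
def crossNeg (K₁ K₂ : C(UnitAddCircle, S3)) : ℕ :=
  {st : UnitAddCircle × UnitAddCircle | IsNegativeCrossing K₁ K₂ st.1 st.2}.ncard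

/-- A continuously differentiable loop in the three-sphere, as a `1`-periodic function. -/
structure IsC1Loop (L : ℝ → E4) : Prop where
  contDiff : ContDiff ℝ 1 L
  periodic : Function.Periodic L 1
  norm_eq_one : ∀ s, ‖L s‖ = 1

/-- The Gauss linking integral
`(1 / 4π) ∫∫ det (A - B, A', B') / ‖A - B‖ ^ 3 ds dt`
of two loops `A, B` in the three-dimensional space orthogonal to the unit vector `p`, which is
oriented so that `u, v, w` is a positive basis when `det (-p, u, v, w) > 0`. With this orientation
the stereographic projection from the pole `p` preserves the orientation. -/
def gaussIntegral (p : E4) (A B : ℝ → E4) : ℝ :=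
  1 / (4 * π) * ∫ s in (0 : ℝ)..1, ∫ t in (0 : ℝ)..1,
    (Matrix.of ![(-p).ofLp, (A s - B t).ofLp, (deriv A s).ofLp, (deriv B t).ofLp]).det /
      ‖A s - B t‖ ^ 3

/-- The integer `n` is the linking number of the disjoint closed curves `K₁` and `K₂` in the
three-sphere. Removing a point `p` from the sphere by stereographic projection, the linking number
of continuously differentiable loops is given by the Gauss integral of their images, whichever
point `p` off the loops is taken; the linking number of continuous closed curves is that of all
sufficiently close continuously differentiable loops. -/
def HasLinkingNumber (K₁ K₂ : C(UnitAddCircle, S3)) (n : ℤ) : Prop :=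
  ∃ ε : ℝ, 0 < ε ∧ ∀ L₁ L₂ : ℝ → E4, IsC1Loop L₁ → IsC1Loop L₂ →
    (∀ s : ℝ, dist (L₁ s) (K₁ (s : UnitAddCircle)) < ε) →
    (∀ s : ℝ, dist (L₂ s) (K₂ (s : UnitAddCircle)) < ε) →
    ∀ p : E4, ‖p‖ = 1 → (∀ s, L₁ s ≠ p) → (∀ s, L₂ s ≠ p) →
      gaussIntegral p (fun s => (stereoToFun p (L₁ s) : E4)) (fun t => (stereoToFun p (L₂ t) : E4))
        = n

end TorusDiagram

end

/-! The Gauss integral of two loops is the degree of their difference map (s, t) ↦ A(s) − B(t) from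
the torus to ℝ³ ∖ {0}, measured as a normalized solid angle. The solid angle form is closed, so the
degree is invariant under homotopies that avoid the origin (`mapDegree_eq_of_segment`,
`mapDegree_eq_of_family`). Moving the pole of the stereographic projection is such a homotopy, and a
generic path of poles misses both loops, so every pole off the loops gives the same value
(`linkDegree_eq`).

Take the pole on the front core circle. The rest of that circle becomes an axis, and its complement
is a circle (the angle y) times a half-plane. The Cayley transform identifies the half-plane with
the unit disc, in which a point has the coordinate ω = r exp(2πiz), with r decreasing in the depth.
After a rotation about the axis by the angle of the second strand, the third coordinate of the
difference map is a positive multiple of sin 2π(y₁ − y₂). Only the places where the horizontal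
angles agree or are opposite matter for homotopies. Where they agree, the other two coordinates may
be replaced by ω₁ − ω₂; where they are opposite, by the constant −1. Exchanging this constant for
−ω₂ changes the degree by a winding term that depends only on homotopy types and equals α₁β₂
(`mapDegree_cayley`, `windingDegree_eq`).

With −ω₂ in place, a rotation by minus the vertical angle of the second strand produces a map whose
first two coordinates are the sines of the angle differences. Its third coordinate, at their common
zeros, is positive exactly at the crossings where the first strand is over (`mapDegree_blend_disc`,
`crossingHeight_cases`). Its degree is the number of these zeros counted with the signs of the
Jacobians (`mapDegree_eq_sum_sign`), that is, the signed number n₁₂ of crossings with K₁ over K₂.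
Hence lk = n₁₂ − α₁β₂.

The linking number is symmetric (`linkDegree_comm`), so also lk = n₂₁ − α₂β₁, and half the sum of
the two formulas is the claim. The knots are only continuous, whereas degrees are computed for
nearby C¹ loops. What the count needs from the knots is a finite list of strict inequalities on a
compact square, and these persist under small perturbations (`exists_forall_mapDegree_eq_sum_sign`).
-/

noncomputable section

namespace TorusDiagram

/-! ### Calculus of functions of two variables with a mixed second derivative -/

/-- The partial derivative in the first variable. -/
def derivFst (f : ℝ → ℝ → ℝ) (s t : ℝ) : ℝ := deriv (fun x => f x t) s

/-- The partial derivative in the second variable. -/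
def derivSnd (f : ℝ → ℝ → ℝ) (s t : ℝ) : ℝ := deriv (fun x => f s x) t

/-- Functions of two variables with continuous partial derivatives and a continuous mixed second
derivative, such as polynomials in continuously differentiable functions of one variable. -/
structure MixedC1 (f : ℝ → ℝ → ℝ) : Prop where
  cont : Continuous fun x : ℝ × ℝ => f x.1 x.2
  contFst : Continuous fun x : ℝ × ℝ => derivFst f x.1 x.2
  contSnd : Continuous fun x : ℝ × ℝ => derivSnd f x.1 x.2
  contMixed : Continuous fun x : ℝ × ℝ => derivSnd (derivFst f) x.1 x.2
  hasDerivFst : ∀ s t, HasDerivAt (fun x => f x t) (derivFst f s t) s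
  hasDerivSnd : ∀ s t, HasDerivAt (fun x => f s x) (derivSnd f s t) t
  hasDerivFstSnd : ∀ s t, HasDerivAt (fun x => derivFst f s x) (derivSnd (derivFst f) s t) t
  hasDerivSndFst : ∀ s t, HasDerivAt (fun x => derivSnd f x t) (derivSnd (derivFst f) s t) s

theorem MixedC1.of_hasDerivAt {f fs ft fst : ℝ → ℝ → ℝ}
    (c : Continuous fun x : ℝ × ℝ => f x.1 x.2) (cs : Continuous fun x : ℝ × ℝ => fs x.1 x.2)
    (ct : Continuous fun x : ℝ × ℝ => ft x.1 x.2) (cst : Continuous fun x : ℝ × ℝ => fst x.1 x.2)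
    (hs : ∀ s t, HasDerivAt (fun x => f x t) (fs s t) s)
    (ht : ∀ s t, HasDerivAt (fun x => f s x) (ft s t) t)
    (hst : ∀ s t, HasDerivAt (fun x => fs s x) (fst s t) t)
    (hts : ∀ s t, HasDerivAt (fun x => ft x t) (fst s t) s) : MixedC1 f := by
  have e1 : derivFst f = fs := by ext s t; exact (hs s t).deriv
  have e2 : derivSnd f = ft := by ext s t; exact (ht s t).deriv
  have e3 : derivSnd fs = fst := by ext s t; exact (hst s t).deriv
  exact ⟨c, e1 ▸ cs, e2 ▸ ct, by rwa [e1, e3], by rwa [e1], by rwa [e2], by rwa [e1, e3],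
    by rwa [e1, e2, e3]⟩

namespace MixedC1

variable {f g : ℝ → ℝ → ℝ}

theorem ofFst {u : ℝ → ℝ} (hu : ContDiff ℝ 1 u) : MixedC1 fun s _ => u s := by
  refine of_hasDerivAt (fs := fun s _ => deriv u s) (ft := fun _ _ => 0) (fst := fun _ _ => 0)
    (hu.continuous.comp continuous_fst) ((hu.continuous_deriv le_rfl).comp continuous_fst)
    continuous_const continuous_const
    (fun s _ => (hu.differentiable one_ne_zero s).hasDerivAt)
    (fun s t => hasDerivAt_const t _) (fun s t => hasDerivAt_const t _)
    (fun s t => hasDerivAt_const s _)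

theorem ofSnd {u : ℝ → ℝ} (hu : ContDiff ℝ 1 u) : MixedC1 fun _ t => u t := by
  refine of_hasDerivAt (ft := fun _ t => deriv u t) (fs := fun _ _ => 0) (fst := fun _ _ => 0)
    (hu.continuous.comp continuous_snd) continuous_const
    ((hu.continuous_deriv le_rfl).comp continuous_snd) continuous_const
    (fun s t => hasDerivAt_const s _)
    (fun _ t => (hu.differentiable one_ne_zero t).hasDerivAt)
    (fun s t => hasDerivAt_const t _) (fun s t => hasDerivAt_const s _)

theorem const (c : ℝ) : MixedC1 fun _ _ => c := ofFst contDiff_const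

theorem add (hf : MixedC1 f) (hg : MixedC1 g) : MixedC1 fun s t => f s t + g s t :=
  of_hasDerivAt (hf.cont.add hg.cont) (hf.contFst.add hg.contFst) (hf.contSnd.add hg.contSnd)
    (hf.contMixed.add hg.contMixed) (fun s t => (hf.hasDerivFst s t).add (hg.hasDerivFst s t))
    (fun s t => (hf.hasDerivSnd s t).add (hg.hasDerivSnd s t))
    (fun s t => (hf.hasDerivFstSnd s t).add (hg.hasDerivFstSnd s t))
    (fun s t => (hf.hasDerivSndFst s t).add (hg.hasDerivSndFst s t))

theorem neg (hf : MixedC1 f) : MixedC1 fun s t => - f s t :=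
  of_hasDerivAt hf.cont.neg hf.contFst.neg hf.contSnd.neg hf.contMixed.neg
    (fun s t => (hf.hasDerivFst s t).neg) (fun s t => (hf.hasDerivSnd s t).neg)
    (fun s t => (hf.hasDerivFstSnd s t).neg) (fun s t => (hf.hasDerivSndFst s t).neg)

theorem sub (hf : MixedC1 f) (hg : MixedC1 g) : MixedC1 fun s t => f s t - g s t := by
  simpa only [sub_eq_add_neg] using hf.add hg.neg

theorem mul (hf : MixedC1 f) (hg : MixedC1 g) : MixedC1 fun s t => f s t * g s t := by
  refine of_hasDerivAt (hf.cont.mul hg.cont)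
    ((hf.contFst.mul hg.cont).add (hf.cont.mul hg.contFst))
    ((hf.contSnd.mul hg.cont).add (hf.cont.mul hg.contSnd))
    (((hf.contMixed.mul hg.cont).add (hf.contFst.mul hg.contSnd)).add
      ((hf.contSnd.mul hg.contFst).add (hf.cont.mul hg.contMixed)))
    (fun s t => (hf.hasDerivFst s t).mul (hg.hasDerivFst s t))
    (fun s t => (hf.hasDerivSnd s t).mul (hg.hasDerivSnd s t))
    (fun s t => ((hf.hasDerivFstSnd s t).mul (hg.hasDerivSnd s t)).add
      ((hf.hasDerivSnd s t).mul (hg.hasDerivFstSnd s t)))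
    (fun s t => ?_)
  exact (((hf.hasDerivSndFst s t).mul (hg.hasDerivFst s t)).add
      ((hf.hasDerivFst s t).mul (hg.hasDerivSndFst s t))).congr_deriv (by ring)

theorem comp {φ : ℝ → ℝ} (hf : MixedC1 f) (hφ : ∀ s t, ContDiffAt ℝ 2 φ (f s t)) :
    MixedC1 fun s t => φ (f s t) := by
  have hd : ∀ s t, ContDiffAt ℝ 1 (deriv φ) (f s t) := fun s t =>
    (hφ s t).derivWithin (by norm_num)
  have hdd : ∀ s t, ContDiffAt ℝ 0 (deriv (deriv φ)) (f s t) := fun s t =>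
    (hd s t).derivWithin (by norm_num)
  have h1 : ∀ s t, HasDerivAt φ (deriv φ (f s t)) (f s t) := fun s t =>
    ((hφ s t).differentiableAt two_ne_zero).hasDerivAt
  have h2 : ∀ s t, HasDerivAt (deriv φ) (deriv (deriv φ) (f s t)) (f s t) := fun s t =>
    ((hd s t).differentiableAt one_ne_zero).hasDerivAt
  have c0 : Continuous fun x : ℝ × ℝ => φ (f x.1 x.2) := continuous_iff_continuousAt.2 fun x =>
    (hφ x.1 x.2).continuousAt.comp' (f := fun x : ℝ × ℝ => f x.1 x.2) hf.cont.continuousAt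
  have c1 : Continuous fun x : ℝ × ℝ => deriv φ (f x.1 x.2) := continuous_iff_continuousAt.2 fun x =>
    (hd x.1 x.2).continuousAt.comp' (f := fun x : ℝ × ℝ => f x.1 x.2) hf.cont.continuousAt
  have c2 : Continuous fun x : ℝ × ℝ => deriv (deriv φ) (f x.1 x.2) :=
    continuous_iff_continuousAt.2 fun x =>
    (hdd x.1 x.2).continuousAt.comp' (f := fun x : ℝ × ℝ => f x.1 x.2) hf.cont.continuousAt
  refine of_hasDerivAt c0 (c1.mul hf.contFst) (c1.mul hf.contSnd)
    (((c2.mul hf.contSnd).mul hf.contFst).add (c1.mul hf.contMixed))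
    (fun s t => (h1 s t).comp s (hf.hasDerivFst s t))
    (fun s t => (h1 s t).comp t (hf.hasDerivSnd s t))
    (fun s t => ((h2 s t).comp t (hf.hasDerivSnd s t)).mul (hf.hasDerivFstSnd s t))
    (fun s t => ?_)
  have h3 : HasDerivAt (fun x => deriv φ (f x t)) (deriv (deriv φ) (f s t) * derivFst f s t) s :=
    HasDerivAt.comp (h := fun x => f x t) (h₂ := deriv φ) s (h2 s t) (hf.hasDerivFst s t)
  exact (h3.mul (hf.hasDerivSndFst s t)).congr_deriv (by simp only [Function.comp_apply]; ring)

end MixedC1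

/-! ### The solid angle form on punctured three-space -/

/-- The determinant with rows `(x, y, z)`, `(a, b, c)`, `(d, e, f)`. -/
def tripleDet (x y z a b c d e f : ℝ) : ℝ :=
  x * (b * f - c * e) - y * (a * f - c * d) + z * (a * e - b * d)

/-- The area form of the unit sphere, pulled back by the radial projection of `ℝ³`, at the point
`(x, y, z)`, evaluated at the vectors `(a, b, c)` and `(d, e, f)`. -/
def solidForm (x y z a b c d e f : ℝ) : ℝ :=
  tripleDet x y z a b c d e f / √(x ^ 2 + y ^ 2 + z ^ 2) ^ 3

/-- The derivative of `solidForm` along a curve whose velocity is given by the last nine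
arguments. -/
def solidFormDeriv (x y z a b c d e f x' y' z' a' b' c' d' e' f' : ℝ) : ℝ :=
  (tripleDet x' y' z' a b c d e f + tripleDet x y z a' b' c' d e f +
    tripleDet x y z a b c d' e' f') / √(x ^ 2 + y ^ 2 + z ^ 2) ^ 3 -
  3 * (x * x' + y * y' + z * z') * tripleDet x y z a b c d e f / √(x ^ 2 + y ^ 2 + z ^ 2) ^ 5

theorem hasDerivAt_solidForm {x y z a b c d e f : ℝ → ℝ} {x' y' z' a' b' c' d' e' f' r : ℝ}
    (hx : HasDerivAt x x' r) (hy : HasDerivAt y y' r) (hz : HasDerivAt z z' r)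
    (ha : HasDerivAt a a' r) (hb : HasDerivAt b b' r) (hc : HasDerivAt c c' r)
    (hd : HasDerivAt d d' r) (he : HasDerivAt e e' r) (hf : HasDerivAt f f' r)
    (h : 0 < x r ^ 2 + y r ^ 2 + z r ^ 2) :
    HasDerivAt (fun r => solidForm (x r) (y r) (z r) (a r) (b r) (c r) (d r) (e r) (f r))
      (solidFormDeriv (x r) (y r) (z r) (a r) (b r) (c r) (d r) (e r) (f r)
        x' y' z' a' b' c' d' e' f') r := by
  have hN := (((hx.pow 2).add (hy.pow 2)).add (hz.pow 2)).sqrt h.ne'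
  have hT := ((hx.mul ((hb.mul hf).sub (hc.mul he))).sub
    (hy.mul ((ha.mul hf).sub (hc.mul hd)))).add (hz.mul ((ha.mul he).sub (hb.mul hd)))
  have hρ : √(x r ^ 2 + y r ^ 2 + z r ^ 2) ≠ 0 := (Real.sqrt_pos.2 h).ne'
  refine (hT.div (hN.pow 3) (pow_ne_zero 3 hρ)).congr_deriv ?_
  simp only [solidFormDeriv, tripleDet, Pi.add_apply, Pi.mul_apply, Pi.sub_apply, Pi.pow_apply]
  generalize √(x r ^ 2 + y r ^ 2 + z r ^ 2) = ρ at hρ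
  field_simp
  ring

/-- Closedness of the form in coordinates: for a family P(x, s, t), ∂ₓ ω(Pₛ, Pₜ) = ∂ₛ ω(Pₓ, Pₜ) + ∂ₜ
ω(Pₛ, Pₓ). The triples with primes stand for the mixed derivatives Pₓₛ, Pₓₜ, Pₛₜ, and the terms with
Pₛₜ cancel by antisymmetry. No pure second derivative occurs, which is why C¹ loops suffice. -/
theorem solidFormDeriv_closed {x y z : ℝ} (h : 0 < x ^ 2 + y ^ 2 + z ^ 2)
    (a b c d e f u v w a' b' c' d' e' f' u' v' w' : ℝ) :
    solidFormDeriv x y z a b c d e f u v w a' b' c' d' e' f' =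
      solidFormDeriv x y z u v w d e f a b c a' b' c' u' v' w' +
      solidFormDeriv x y z a b c u v w d e f u' v' w' d' e' f' := by
  have hρ : √(x ^ 2 + y ^ 2 + z ^ 2) ≠ 0 := (Real.sqrt_pos.2 h).ne'
  have hsq : √(x ^ 2 + y ^ 2 + z ^ 2) ^ 2 = x ^ 2 + y ^ 2 + z ^ 2 := Real.sq_sqrt h.le
  simp only [solidFormDeriv, tripleDet]
  generalize √(x ^ 2 + y ^ 2 + z ^ 2) = ρ at hρ hsq
  field_simp
  rw [hsq]
  ring

theorem continuous_solidForm {α : Type*} [TopologicalSpace α] {x y z a b c d e f : α → ℝ}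
    (hx : Continuous x) (hy : Continuous y) (hz : Continuous z) (ha : Continuous a)
    (hb : Continuous b) (hc : Continuous c) (hd : Continuous d) (he : Continuous e)
    (hf : Continuous f) (h : ∀ r, 0 < x r ^ 2 + y r ^ 2 + z r ^ 2) :
    Continuous fun r => solidForm (x r) (y r) (z r) (a r) (b r) (c r) (d r) (e r) (f r) := by
  unfold solidForm tripleDet
  refine Continuous.div (by fun_prop) (by fun_prop) fun r => ?_
  exact pow_ne_zero 3 (Real.sqrt_pos.2 (h r)).ne'

theorem continuous_solidFormDeriv {α : Type*} [TopologicalSpace α]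
    {x y z a b c d e f x' y' z' a' b' c' d' e' f' : α → ℝ}
    (hx : Continuous x) (hy : Continuous y) (hz : Continuous z) (ha : Continuous a)
    (hb : Continuous b) (hc : Continuous c) (hd : Continuous d) (he : Continuous e)
    (hf : Continuous f) (hx' : Continuous x') (hy' : Continuous y') (hz' : Continuous z')
    (ha' : Continuous a') (hb' : Continuous b') (hc' : Continuous c') (hd' : Continuous d')
    (he' : Continuous e') (hf' : Continuous f') (h : ∀ r, 0 < x r ^ 2 + y r ^ 2 + z r ^ 2) :
    Continuous fun r => solidFormDeriv (x r) (y r) (z r) (a r) (b r) (c r) (d r) (e r) (f r)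
      (x' r) (y' r) (z' r) (a' r) (b' r) (c' r) (d' r) (e' r) (f' r) := by
  have hρ : ∀ r, √(x r ^ 2 + y r ^ 2 + z r ^ 2) ≠ 0 := fun r => (Real.sqrt_pos.2 (h r)).ne'
  unfold solidFormDeriv tripleDet
  exact Continuous.sub (Continuous.div (by fun_prop) (by fun_prop) fun r => pow_ne_zero 3 (hρ r))
    (Continuous.div (by fun_prop) (by fun_prop) fun r => pow_ne_zero 5 (hρ r))

theorem intervalIntegral_swap_of_continuous {f : ℝ → ℝ → ℝ}
    (hf : Continuous fun x : ℝ × ℝ => f x.1 x.2) :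
    ∫ s in (0 : ℝ)..1, ∫ t in (0 : ℝ)..1, f s t = ∫ t in (0 : ℝ)..1, ∫ s in (0 : ℝ)..1, f s t := by
  simp only [intervalIntegral.integral_of_le zero_le_one]
  refine MeasureTheory.integral_integral_swap ?_
  rw [MeasureTheory.Measure.prod_restrict]
  change MeasureTheory.IntegrableOn _ _ _
  exact (hf.continuousOn.integrableOn_compact (isCompact_Icc.prod isCompact_Icc)).mono_set
    (Set.prod_mono Set.Ioc_subset_Icc_self Set.Ioc_subset_Icc_self)

/-! ### The degree of a map from the torus and its homotopy invariance -/

/-- A function on the plane that descends to the torus. -/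
structure Biperiodic (f : ℝ → ℝ → ℝ) : Prop where
  fst : ∀ s t, f (s + 1) t = f s t
  snd : ∀ s t, f s (t + 1) = f s t

theorem Biperiodic.derivFst {f : ℝ → ℝ → ℝ} (h : Biperiodic f) : Biperiodic (derivFst f) := by
  refine ⟨fun s t => ?_, fun s t => ?_⟩
  · have := deriv_comp_add_const (fun x => f x t) 1 s
    simp only [h.fst] at this
    exact this.symm
  · simp only [TorusDiagram.derivFst, h.snd]

theorem Biperiodic.derivSnd {f : ℝ → ℝ → ℝ} (h : Biperiodic f) : Biperiodic (derivSnd f) := by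
  refine ⟨fun s t => ?_, fun s t => ?_⟩
  · simp only [TorusDiagram.derivSnd, h.fst]
  · have := deriv_comp_add_const (fun x => f s x) 1 t
    simp only [h.snd] at this
    exact this.symm

/-- The integrand of `mapDegree`. -/
def degreeDensity (X Y Z : ℝ → ℝ → ℝ) (s t : ℝ) : ℝ :=
  solidForm (X s t) (Y s t) (Z s t) (derivFst X s t) (derivFst Y s t) (derivFst Z s t)
    (derivSnd X s t) (derivSnd Y s t) (derivSnd Z s t)

/-- The degree of the map `(X, Y, Z)` from the torus to the punctured space `ℝ³ \ {0}`, as the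
normalized area swept out on the unit sphere. -/
def mapDegree (X Y Z : ℝ → ℝ → ℝ) : ℝ :=
  1 / (4 * π) * ∫ s in (0 : ℝ)..1, ∫ t in (0 : ℝ)..1, degreeDensity X Y Z s t

/-- A map from the torus to `ℝ³ \ {0}` with components of class `MixedC1`. -/
structure TorusMap (X Y Z : ℝ → ℝ → ℝ) : Prop where
  mixedX : MixedC1 X
  mixedY : MixedC1 Y
  mixedZ : MixedC1 Z
  perX : Biperiodic X
  perY : Biperiodic Y
  perZ : Biperiodic Z
  pos : ∀ s t, 0 < X s t ^ 2 + Y s t ^ 2 + Z s t ^ 2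

/-- A one-parameter family of functions on the torus (the parameter comes first), with its partial
derivatives. -/
structure TorusFamily (P Px Ps Pt Pxs Pxt Pst : ℝ → ℝ → ℝ → ℝ) : Prop where
  c : Continuous fun v : ℝ × ℝ × ℝ => P v.1 v.2.1 v.2.2
  cx : Continuous fun v : ℝ × ℝ × ℝ => Px v.1 v.2.1 v.2.2
  cs : Continuous fun v : ℝ × ℝ × ℝ => Ps v.1 v.2.1 v.2.2
  ct : Continuous fun v : ℝ × ℝ × ℝ => Pt v.1 v.2.1 v.2.2
  cxs : Continuous fun v : ℝ × ℝ × ℝ => Pxs v.1 v.2.1 v.2.2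
  cxt : Continuous fun v : ℝ × ℝ × ℝ => Pxt v.1 v.2.1 v.2.2
  cst : Continuous fun v : ℝ × ℝ × ℝ => Pst v.1 v.2.1 v.2.2
  hx : ∀ x s t, HasDerivAt (fun y => P y s t) (Px x s t) x
  hs : ∀ x s t, HasDerivAt (fun y => P x y t) (Ps x s t) s
  ht : ∀ x s t, HasDerivAt (fun y => P x s y) (Pt x s t) t
  hsx : ∀ x s t, HasDerivAt (fun y => Ps y s t) (Pxs x s t) x
  htx : ∀ x s t, HasDerivAt (fun y => Pt y s t) (Pxt x s t) x
  hxs : ∀ x s t, HasDerivAt (fun y => Px x y t) (Pxs x s t) s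
  hxt : ∀ x s t, HasDerivAt (fun y => Px x s y) (Pxt x s t) t
  hst : ∀ x s t, HasDerivAt (fun y => Ps x s y) (Pst x s t) t
  hts : ∀ x s t, HasDerivAt (fun y => Pt x y t) (Pst x s t) s
  per : ∀ x, Biperiodic (P x)
  perx : ∀ x, Biperiodic (Px x)
  pers : ∀ x, Biperiodic (Ps x)
  pert : ∀ x, Biperiodic (Pt x)

theorem integral_deriv_eq_zero_of_periodic {f f' : ℝ → ℝ} (hf : ∀ s, HasDerivAt f (f' s) s)
    (hc : Continuous f') (hp : ∀ s, f (s + 1) = f s) : ∫ s in (0 : ℝ)..1, f' s = 0 := by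
  rw [intervalIntegral.integral_eq_sub_of_hasDerivAt (fun s _ => hf s)
    (hc.intervalIntegrable 0 1)]
  have := hp 0
  rw [zero_add] at this
  rw [this, sub_self]

/-- Stokes' theorem on [0, 1] × T²: by closedness the x-derivative of the density is a sum of an
s-derivative and a t-derivative of periodic functions, and each of these integrates to zero over a
period. -/
theorem integral_solidForm_family
    {X Xx Xs Xt Xxs Xxt Xst Y Yx Ys Yt Yxs Yxt Yst Z Zx Zs Zt Zxs Zxt Zst : ℝ → ℝ → ℝ → ℝ}
    (hX : TorusFamily X Xx Xs Xt Xxs Xxt Xst) (hY : TorusFamily Y Yx Ys Yt Yxs Yxt Yst)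
    (hZ : TorusFamily Z Zx Zs Zt Zxs Zxt Zst)
    (h : ∀ x s t, 0 < X x s t ^ 2 + Y x s t ^ 2 + Z x s t ^ 2) :
    (∫ s in (0 : ℝ)..1, ∫ t in (0 : ℝ)..1, solidForm (X 1 s t) (Y 1 s t) (Z 1 s t)
      (Xs 1 s t) (Ys 1 s t) (Zs 1 s t) (Xt 1 s t) (Yt 1 s t) (Zt 1 s t)) =
    ∫ s in (0 : ℝ)..1, ∫ t in (0 : ℝ)..1, solidForm (X 0 s t) (Y 0 s t) (Z 0 s t)
      (Xs 0 s t) (Ys 0 s t) (Zs 0 s t) (Xt 0 s t) (Yt 0 s t) (Zt 0 s t) := by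
  set F : ℝ → ℝ → ℝ → ℝ := fun x s t => solidForm (X x s t) (Y x s t) (Z x s t)
      (Xs x s t) (Ys x s t) (Zs x s t) (Xt x s t) (Yt x s t) (Zt x s t) with hF
  set S : ℝ → ℝ → ℝ → ℝ := fun x s t => solidFormDeriv (X x s t) (Y x s t) (Z x s t)
      (Xx x s t) (Yx x s t) (Zx x s t) (Xt x s t) (Yt x s t) (Zt x s t)
      (Xs x s t) (Ys x s t) (Zs x s t) (Xxs x s t) (Yxs x s t) (Zxs x s t)
      (Xst x s t) (Yst x s t) (Zst x s t) with hS
  set T : ℝ → ℝ → ℝ → ℝ := fun x s t => solidFormDeriv (X x s t) (Y x s t) (Z x s t)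
      (Xs x s t) (Ys x s t) (Zs x s t) (Xx x s t) (Yx x s t) (Zx x s t)
      (Xt x s t) (Yt x s t) (Zt x s t) (Xst x s t) (Yst x s t) (Zst x s t)
      (Xxt x s t) (Yxt x s t) (Zxt x s t) with hT
  have cF : Continuous fun v : ℝ × ℝ × ℝ => F v.1 v.2.1 v.2.2 :=
    continuous_solidForm hX.c hY.c hZ.c hX.cs hY.cs hZ.cs hX.ct hY.ct hZ.ct (fun v => h _ _ _)
  have cS : Continuous fun v : ℝ × ℝ × ℝ => S v.1 v.2.1 v.2.2 :=
    continuous_solidFormDeriv hX.c hY.c hZ.c hX.cx hY.cx hZ.cx hX.ct hY.ct hZ.ct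
      hX.cs hY.cs hZ.cs hX.cxs hY.cxs hZ.cxs hX.cst hY.cst hZ.cst (fun v => h _ _ _)
  have cT : Continuous fun v : ℝ × ℝ × ℝ => T v.1 v.2.1 v.2.2 :=
    continuous_solidFormDeriv hX.c hY.c hZ.c hX.cs hY.cs hZ.cs hX.cx hY.cx hZ.cx
      hX.ct hY.ct hZ.ct hX.cst hY.cst hZ.cst hX.cxt hY.cxt hZ.cxt (fun v => h _ _ _)
  have hdx : ∀ x s t, HasDerivAt (fun y => F y s t) (S x s t + T x s t) x := fun x s t =>
    (hasDerivAt_solidForm (hX.hx x s t) (hY.hx x s t) (hZ.hx x s t) (hX.hsx x s t) (hY.hsx x s t)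
      (hZ.hsx x s t) (hX.htx x s t) (hY.htx x s t) (hZ.htx x s t) (h x s t)).congr_deriv
      (solidFormDeriv_closed (h x s t) ..)
  have iS : ∀ x t, ∫ s in (0 : ℝ)..1, S x s t = 0 := fun x t => by
    refine integral_deriv_eq_zero_of_periodic (f := fun s => solidForm (X x s t) (Y x s t) (Z x s t)
      (Xx x s t) (Yx x s t) (Zx x s t) (Xt x s t) (Yt x s t) (Zt x s t)) (fun s =>
      hasDerivAt_solidForm (hX.hs x s t) (hY.hs x s t) (hZ.hs x s t) (hX.hxs x s t) (hY.hxs x s t)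
      (hZ.hxs x s t) (hX.hts x s t) (hY.hts x s t) (hZ.hts x s t) (h x s t)) ?_ fun s => ?_
    · exact cS.comp (f := fun s : ℝ => (x, s, t)) (by fun_prop)
    · simp only [(hX.per x).fst, (hY.per x).fst, (hZ.per x).fst, (hX.perx x).fst, (hY.perx x).fst,
        (hZ.perx x).fst, (hX.pert x).fst, (hY.pert x).fst, (hZ.pert x).fst]
  have iT : ∀ x s, ∫ t in (0 : ℝ)..1, T x s t = 0 := fun x s => by
    refine integral_deriv_eq_zero_of_periodic (f := fun t => solidForm (X x s t) (Y x s t) (Z x s t)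
      (Xs x s t) (Ys x s t) (Zs x s t) (Xx x s t) (Yx x s t) (Zx x s t)) (fun t =>
      hasDerivAt_solidForm (hX.ht x s t) (hY.ht x s t) (hZ.ht x s t) (hX.hst x s t) (hY.hst x s t)
      (hZ.hst x s t) (hX.hxt x s t) (hY.hxt x s t) (hZ.hxt x s t) (h x s t)) ?_ fun t => ?_
    · exact cT.comp (f := fun t : ℝ => (x, s, t)) (by fun_prop)
    · simp only [(hX.per x).snd, (hY.per x).snd, (hZ.per x).snd, (hX.perx x).snd, (hY.perx x).snd,
        (hZ.perx x).snd, (hX.pers x).snd, (hY.pers x).snd, (hZ.pers x).snd]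
  have ii : ∀ x : ℝ, Continuous fun s => ∫ t in (0 : ℝ)..1, F x s t := fun x =>
    intervalIntegral.continuous_parametric_intervalIntegral_of_continuous' (f := fun s t => F x s t)
      (cF.comp (f := fun v : ℝ × ℝ => (x, v.1, v.2)) (by fun_prop)) 0 1
  rw [← sub_eq_zero, ← intervalIntegral.integral_sub ((ii 1).intervalIntegrable 0 1)
    ((ii 0).intervalIntegrable 0 1)]
  have e1 : ∀ s, ((∫ t in (0 : ℝ)..1, F 1 s t) - ∫ t in (0 : ℝ)..1, F 0 s t) =
      (∫ x in (0 : ℝ)..1, ∫ t in (0 : ℝ)..1, S x s t) := fun s => by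
    have cF1 : ∀ x : ℝ, Continuous fun t => F x s t := fun x =>
      cF.comp (f := fun t : ℝ => (x, s, t)) (by fun_prop)
    have cS1 : ∀ t : ℝ, Continuous fun x => S x s t := fun t =>
      cS.comp (f := fun x : ℝ => (x, s, t)) (by fun_prop)
    have cT1 : ∀ t : ℝ, Continuous fun x => T x s t := fun t =>
      cT.comp (f := fun x : ℝ => (x, s, t)) (by fun_prop)
    have cS2 : Continuous fun v : ℝ × ℝ => S v.1 s v.2 :=
      cS.comp (f := fun v : ℝ × ℝ => (v.1, s, v.2)) (by fun_prop)
    have cT2 : Continuous fun v : ℝ × ℝ => T v.1 s v.2 :=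
      cT.comp (f := fun v : ℝ × ℝ => (v.1, s, v.2)) (by fun_prop)
    rw [← intervalIntegral.integral_sub ((cF1 1).intervalIntegrable 0 1)
      ((cF1 0).intervalIntegrable 0 1)]
    have e2 : ∀ t, F 1 s t - F 0 s t = ∫ x in (0 : ℝ)..1, (S x s t + T x s t) := fun t =>
      (intervalIntegral.integral_eq_sub_of_hasDerivAt (fun x _ => hdx x s t)
        (((cS1 t).add (cT1 t)).intervalIntegrable 0 1)).symm
    simp only [e2]
    rw [← intervalIntegral_swap_of_continuous (f := fun x t => S x s t + T x s t) (cS2.add cT2)]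
    refine intervalIntegral.integral_congr fun x _ => ?_
    have cS3 : Continuous fun t => S x s t := cS.comp (f := fun t : ℝ => (x, s, t)) (by fun_prop)
    have cT3 : Continuous fun t => T x s t := cT.comp (f := fun t : ℝ => (x, s, t)) (by fun_prop)
    rw [intervalIntegral.integral_add (cS3.intervalIntegrable 0 1) (cT3.intervalIntegrable 0 1),
      iT, add_zero]
  simp only [e1]
  have cS4 : Continuous fun v : ℝ × ℝ => ∫ t in (0 : ℝ)..1, S v.2 v.1 t :=
    intervalIntegral.continuous_parametric_intervalIntegral_of_continuous'
      (f := fun (v : ℝ × ℝ) t => S v.2 v.1 t)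
      (cS.comp (f := fun w : (ℝ × ℝ) × ℝ => (w.1.2, w.1.1, w.2)) (by fun_prop)) 0 1
  rw [intervalIntegral_swap_of_continuous (f := fun s x => ∫ t in (0 : ℝ)..1, S x s t) cS4]
  have e3 : ∀ x : ℝ, ∫ s in (0 : ℝ)..1, ∫ t in (0 : ℝ)..1, S x s t = 0 := fun x => by
    rw [intervalIntegral_swap_of_continuous (f := fun s t => S x s t)
      (cS.comp (f := fun v : ℝ × ℝ => (x, v.1, v.2)) (by fun_prop))]
    simp only [iS, intervalIntegral.integral_zero]
  simp only [e3, intervalIntegral.integral_zero]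

theorem TorusFamily.segment {f g : ℝ → ℝ → ℝ} (hf : MixedC1 f) (hg : MixedC1 g)
    (pf : Biperiodic f) (pg : Biperiodic g) {k k' : ℝ → ℝ} (hk : ∀ x, HasDerivAt k (k' x) x)
    (ck' : Continuous k') :
    TorusFamily (fun x s t => f s t + k x * (g s t - f s t)) (fun x s t => k' x * (g s t - f s t))
      (fun x s t => derivFst f s t + k x * (derivFst g s t - derivFst f s t))
      (fun x s t => derivSnd f s t + k x * (derivSnd g s t - derivSnd f s t))
      (fun x s t => k' x * (derivFst g s t - derivFst f s t))
      (fun x s t => k' x * (derivSnd g s t - derivSnd f s t))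
      (fun x s t => derivSnd (derivFst f) s t +
        k x * (derivSnd (derivFst g) s t - derivSnd (derivFst f) s t)) := by
  have ck : Continuous k := continuous_iff_continuousAt.2 fun x => (hk x).continuousAt
  have k1 : Continuous fun v : ℝ × ℝ × ℝ => k v.1 := ck.comp continuous_fst
  have k2 : Continuous fun v : ℝ × ℝ × ℝ => k' v.1 := ck'.comp continuous_fst
  have f1 : Continuous fun v : ℝ × ℝ × ℝ => f v.2.1 v.2.2 := hf.cont.comp continuous_snd
  have f2 : Continuous fun v : ℝ × ℝ × ℝ => derivFst f v.2.1 v.2.2 := hf.contFst.comp continuous_snd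
  have f3 : Continuous fun v : ℝ × ℝ × ℝ => derivSnd f v.2.1 v.2.2 := hf.contSnd.comp continuous_snd
  have f4 : Continuous fun v : ℝ × ℝ × ℝ => derivSnd (derivFst f) v.2.1 v.2.2 :=
    hf.contMixed.comp continuous_snd
  have g1 : Continuous fun v : ℝ × ℝ × ℝ => g v.2.1 v.2.2 := hg.cont.comp continuous_snd
  have g2 : Continuous fun v : ℝ × ℝ × ℝ => derivFst g v.2.1 v.2.2 := hg.contFst.comp continuous_snd
  have g3 : Continuous fun v : ℝ × ℝ × ℝ => derivSnd g v.2.1 v.2.2 := hg.contSnd.comp continuous_snd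
  have g4 : Continuous fun v : ℝ × ℝ × ℝ => derivSnd (derivFst g) v.2.1 v.2.2 :=
    hg.contMixed.comp continuous_snd
  refine ⟨f1.add (k1.mul (g1.sub f1)), k2.mul (g1.sub f1), f2.add (k1.mul (g2.sub f2)),
    f3.add (k1.mul (g3.sub f3)), k2.mul (g2.sub f2), k2.mul (g3.sub f3),
    f4.add (k1.mul (g4.sub f4)), ?_, ?_, ?_, ?_, ?_, ?_, ?_, ?_, ?_, ?_, ?_, ?_, ?_⟩
  · exact fun x s t => ((hk x).mul_const _).const_add _
  · exact fun x s t => (hf.hasDerivFst s t).add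
      (((hg.hasDerivFst s t).sub (hf.hasDerivFst s t)).const_mul _)
  · exact fun x s t => (hf.hasDerivSnd s t).add
      (((hg.hasDerivSnd s t).sub (hf.hasDerivSnd s t)).const_mul _)
  · exact fun x s t => ((hk x).mul_const _).const_add _
  · exact fun x s t => ((hk x).mul_const _).const_add _
  · exact fun x s t => ((hg.hasDerivFst s t).sub (hf.hasDerivFst s t)).const_mul _
  · exact fun x s t => ((hg.hasDerivSnd s t).sub (hf.hasDerivSnd s t)).const_mul _
  · exact fun x s t => (hf.hasDerivFstSnd s t).add
      (((hg.hasDerivFstSnd s t).sub (hf.hasDerivFstSnd s t)).const_mul _)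
  · exact fun x s t => (hf.hasDerivSndFst s t).add
      (((hg.hasDerivSndFst s t).sub (hf.hasDerivSndFst s t)).const_mul _)
  · exact fun x => ⟨fun s t => by simp only [pf.fst, pg.fst], fun s t => by simp only [pf.snd, pg.snd]⟩
  · exact fun x => ⟨fun s t => by simp only [pf.fst, pg.fst], fun s t => by simp only [pf.snd, pg.snd]⟩
  · exact fun x => ⟨fun s t => by simp only [pf.derivFst.fst, pg.derivFst.fst],
      fun s t => by simp only [pf.derivFst.snd, pg.derivFst.snd]⟩
  · exact fun x => ⟨fun s t => by simp only [pf.derivSnd.fst, pg.derivSnd.fst],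
      fun s t => by simp only [pf.derivSnd.snd, pg.derivSnd.snd]⟩

/-- Maps from the torus to `ℝ³ \ {0}` that are joined by a straight homotopy have the same
degree. -/
theorem mapDegree_eq_of_segment {X Y Z X' Y' Z' : ℝ → ℝ → ℝ} (h : TorusMap X Y Z)
    (h' : TorusMap X' Y' Z')
    (hne : ∀ k, 0 < k → k < 1 → ∀ s t, X s t + k * (X' s t - X s t) = 0 →
      Y s t + k * (Y' s t - Y s t) = 0 → Z s t + k * (Z' s t - Z s t) = 0 → False) :
    mapDegree X Y Z = mapDegree X' Y' Z' := by
  -- A smooth reparametrization of the segment with values in [0, 1] for every real x, because the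
  -- family has to avoid the origin for all real parameters and not only for those in [0, 1].
  set k : ℝ → ℝ := fun x => (1 - Real.cos (π * x)) / 2 with hk
  have hk' : ∀ x, HasDerivAt k (π * Real.sin (π * x) / 2) x := fun x => by
    have := (((Real.hasDerivAt_cos (π * x)).comp x ((hasDerivAt_id x).const_mul π)).const_sub
      1).div_const 2
    exact this.congr_deriv (by ring)
  have k0 : k 0 = 0 := by simp [hk]
  have k1 : k 1 = 1 := by simp [hk]
  have h3 : ∀ x s t, 0 < (X s t + k x * (X' s t - X s t)) ^ 2 +
      (Y s t + k x * (Y' s t - Y s t)) ^ 2 + (Z s t + k x * (Z' s t - Z s t)) ^ 2 := by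
    intro x s t
    have a0 : 0 ≤ k x := by simp only [hk]; linarith [Real.cos_le_one (π * x)]
    have a1 : k x ≤ 1 := by simp only [hk]; linarith [Real.neg_one_le_cos (π * x)]
    rcases a0.eq_or_lt with a | a
    · rw [← a]; simpa using h.pos s t
    rcases a1.eq_or_lt with b | b
    · rw [b]; simpa using h'.pos s t
    by_contra hc
    have := hne _ a b s t
    refine this ?_ ?_ ?_ <;> nlinarith
  have ck : Continuous fun x => π * Real.sin (π * x) / 2 := by fun_prop
  have := integral_solidForm_family
    (TorusFamily.segment h.mixedX h'.mixedX h.perX h'.perX hk' ck)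
    (TorusFamily.segment h.mixedY h'.mixedY h.perY h'.perY hk' ck)
    (TorusFamily.segment h.mixedZ h'.mixedZ h.perZ h'.perZ hk' ck) h3
  simp only [k0, k1, zero_mul, add_zero, one_mul, add_sub_cancel] at this
  simp only [mapDegree, degreeDensity]
  rw [this]

theorem Biperiodic.apply_fract {f : ℝ → ℝ → ℝ} (h : Biperiodic f) (s t : ℝ) :
    f (Int.fract s) (Int.fract t) = f s t := by
  have h1 : Function.Periodic (fun x => f x (Int.fract t)) 1 := fun x => h.fst x _
  have h2 : Function.Periodic (fun x => f s x) 1 := fun x => h.snd s x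
  have e1 := h1.sub_int_mul_eq ⌊s⌋ (x := s)
  have e2 := h2.sub_int_mul_eq ⌊t⌋ (x := t)
  simp only [mul_one] at e1 e2
  rw [← Int.self_sub_floor s, e1, ← Int.self_sub_floor t, e2]

/-- Homotopy invariance of the degree. -/
theorem mapDegree_eq_of_family {T : Type*} [TopologicalSpace T] [PreconnectedSpace T]
    {X Y Z : T → ℝ → ℝ → ℝ} (h : ∀ τ, TorusMap (X τ) (Y τ) (Z τ))
    (cX : Continuous fun v : T × ℝ × ℝ => X v.1 v.2.1 v.2.2)
    (cY : Continuous fun v : T × ℝ × ℝ => Y v.1 v.2.1 v.2.2)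
    (cZ : Continuous fun v : T × ℝ × ℝ => Z v.1 v.2.1 v.2.2) (a b : T) :
    mapDegree (X a) (Y a) (Z a) = mapDegree (X b) (Y b) (Z b) := by
  -- The family is only continuous in its parameter. Maps with nearby parameters are joined by
  -- straight segments off the origin, so the degree is locally constant on a connected space.
  suffices hl : IsLocallyConstant fun τ => mapDegree (X τ) (Y τ) (Z τ) from
    hl.apply_eq_of_preconnectedSpace a b
  rw [IsLocallyConstant.iff_eventually_eq]
  intro τ₀
  -- The first factor is the parameter of the segment, the other two form a period square of the
  -- torus; compactness makes the estimate uniform.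
  set K : Set (ℝ × ℝ × ℝ) := Set.Icc 0 1 ×ˢ Set.Icc 0 1 ×ˢ Set.Icc 0 1
  have hK : IsCompact K := isCompact_Icc.prod (isCompact_Icc.prod isCompact_Icc)
  have seg : ∀ {X : T → ℝ → ℝ → ℝ}, (Continuous fun v : T × ℝ × ℝ => X v.1 v.2.1 v.2.2) →
      Continuous fun w : T × ℝ × ℝ × ℝ => X w.1 w.2.2.1 w.2.2.2 +
        w.2.1 * (X τ₀ w.2.2.1 w.2.2.2 - X w.1 w.2.2.1 w.2.2.2) := by
    intro X cX
    have c1 : Continuous fun w : T × ℝ × ℝ × ℝ => X w.1 w.2.2.1 w.2.2.2 :=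
      cX.comp (f := fun w : T × ℝ × ℝ × ℝ => (w.1, w.2.2.1, w.2.2.2)) (by fun_prop)
    have c2 : Continuous fun w : T × ℝ × ℝ × ℝ => X τ₀ w.2.2.1 w.2.2.2 :=
      cX.comp (f := fun w : T × ℝ × ℝ × ℝ => (τ₀, w.2.2.1, w.2.2.2)) (by fun_prop)
    fun_prop
  have key : ∀ᶠ τ in 𝓝 τ₀, ∀ y ∈ K,
      0 < (X τ y.2.1 y.2.2 + y.1 * (X τ₀ y.2.1 y.2.2 - X τ y.2.1 y.2.2)) ^ 2 +
        (Y τ y.2.1 y.2.2 + y.1 * (Y τ₀ y.2.1 y.2.2 - Y τ y.2.1 y.2.2)) ^ 2 +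
        (Z τ y.2.1 y.2.2 + y.1 * (Z τ₀ y.2.1 y.2.2 - Z τ y.2.1 y.2.2)) ^ 2 := by
    refine hK.eventually_forall_of_forall_eventually fun y _ => ?_
    have hc := (((seg cX).pow 2).add ((seg cY).pow 2)).add ((seg cZ).pow 2)
    refine hc.continuousAt.eventually (lt_mem_nhds ?_)
    simpa using (h τ₀).pos y.2.1 y.2.2
  filter_upwards [key] with τ hτ
  refine mapDegree_eq_of_segment (h τ) (h τ₀) fun k k0 k1 s t e1 e2 e3 => ?_
  have := hτ (k, Int.fract s, Int.fract t) ⟨⟨k0.le, k1.le⟩,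
    ⟨Int.fract_nonneg s, (Int.fract_lt_one s).le⟩, ⟨Int.fract_nonneg t, (Int.fract_lt_one t).le⟩⟩
  simp only [(h τ).perX.apply_fract, (h τ).perY.apply_fract, (h τ).perZ.apply_fract,
    (h τ₀).perX.apply_fract, (h τ₀).perY.apply_fract, (h τ₀).perZ.apply_fract, e1, e2, e3] at this
  simp at this

theorem TorusMap.continuous_degreeDensity {X Y Z : ℝ → ℝ → ℝ} (h : TorusMap X Y Z) :
    Continuous fun v : ℝ × ℝ => degreeDensity X Y Z v.1 v.2 :=
  continuous_solidForm h.mixedX.cont h.mixedY.cont h.mixedZ.cont h.mixedX.contFst h.mixedY.contFst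
    h.mixedZ.contFst h.mixedX.contSnd h.mixedY.contSnd h.mixedZ.contSnd fun _ => h.pos _ _

/-! ### Symmetries of the degree -/

theorem solidForm_cycle (x y z a b c d e f : ℝ) :
    solidForm y z x b c a e f d = solidForm x y z a b c d e f := by
  simp only [solidForm, tripleDet]
  rw [show y ^ 2 + z ^ 2 + x ^ 2 = x ^ 2 + y ^ 2 + z ^ 2 by ring]
  ring

theorem solidForm_swap (x y z a b c d e f : ℝ) :
    solidForm y x z b a c e d f = - solidForm x y z a b c d e f := by
  simp only [solidForm, tripleDet]
  rw [add_comm (y ^ 2)]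
  ring

theorem solidForm_neg_last (x y z a b c d e f : ℝ) :
    solidForm x y (-z) a b (-c) d e (-f) = - solidForm x y z a b c d e f := by
  simp only [solidForm, tripleDet, neg_sq]
  ring

theorem mapDegree_cycle (X Y Z : ℝ → ℝ → ℝ) : mapDegree Y Z X = mapDegree X Y Z := by
  simp only [mapDegree, degreeDensity, solidForm_cycle (X _ _)]

theorem derivFst_neg (f : ℝ → ℝ → ℝ) (s t : ℝ) :
    derivFst (fun s t => -f s t) s t = -derivFst f s t := deriv.fun_neg

theorem derivSnd_neg (f : ℝ → ℝ → ℝ) (s t : ℝ) :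
    derivSnd (fun s t => -f s t) s t = -derivSnd f s t := deriv.fun_neg

theorem mapDegree_neg (X Y Z : ℝ → ℝ → ℝ) :
    mapDegree X Y (fun s t => - Z s t) = - mapDegree X Y Z := by
  simp only [mapDegree, degreeDensity, derivFst_neg, derivSnd_neg, solidForm_neg_last,
    intervalIntegral.integral_neg, mul_neg]

theorem mapDegree_swap (X Y Z : ℝ → ℝ → ℝ) : mapDegree Y X Z = - mapDegree X Y Z := by
  simp only [mapDegree, degreeDensity, solidForm_swap (X _ _), intervalIntegral.integral_neg,
    mul_neg]

theorem Biperiodic.add {f g : ℝ → ℝ → ℝ} (hf : Biperiodic f) (hg : Biperiodic g) :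
    Biperiodic fun s t => f s t + g s t :=
  ⟨fun s t => by rw [hf.fst, hg.fst], fun s t => by rw [hf.snd, hg.snd]⟩

theorem Biperiodic.neg {f : ℝ → ℝ → ℝ} (hf : Biperiodic f) : Biperiodic fun s t => - f s t :=
  ⟨fun s t => by rw [hf.fst], fun s t => by rw [hf.snd]⟩

theorem Biperiodic.sub {f g : ℝ → ℝ → ℝ} (hf : Biperiodic f) (hg : Biperiodic g) :
    Biperiodic fun s t => f s t - g s t :=
  ⟨fun s t => by rw [hf.fst, hg.fst], fun s t => by rw [hf.snd, hg.snd]⟩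

theorem Biperiodic.mul {f g : ℝ → ℝ → ℝ} (hf : Biperiodic f) (hg : Biperiodic g) :
    Biperiodic fun s t => f s t * g s t :=
  ⟨fun s t => by rw [hf.fst, hg.fst], fun s t => by rw [hf.snd, hg.snd]⟩

theorem Biperiodic.comp {f : ℝ → ℝ → ℝ} (hf : Biperiodic f) (φ : ℝ → ℝ) :
    Biperiodic fun s t => φ (f s t) :=
  ⟨fun s t => by rw [hf.fst], fun s t => by rw [hf.snd]⟩

theorem Biperiodic.const (c : ℝ) : Biperiodic fun _ _ => c := ⟨fun _ _ => rfl, fun _ _ => rfl⟩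

theorem Biperiodic.ofFst {u : ℝ → ℝ} (hu : ∀ s, u (s + 1) = u s) : Biperiodic fun s _ => u s :=
  ⟨fun s _ => hu s, fun _ _ => rfl⟩

theorem Biperiodic.ofSnd {u : ℝ → ℝ} (hu : ∀ s, u (s + 1) = u s) : Biperiodic fun _ t => u t :=
  ⟨fun _ _ => rfl, fun _ t => hu t⟩

/-- Turning the map `(X, Y, Z)` about the last axis by an angle that depends on the second variable
only does not change the degree. -/
theorem mapDegree_rotate {X Y Z : ℝ → ℝ → ℝ} (h : TorusMap X Y Z) {c d : ℝ → ℝ}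
    (hc : ContDiff ℝ 1 c) (hd : ContDiff ℝ 1 d) (pc : ∀ t, c (t + 1) = c t)
    (pd : ∀ t, d (t + 1) = d t) (hcd : ∀ t, c t ^ 2 + d t ^ 2 = 1) :
    TorusMap (fun s t => c t * X s t - d t * Y s t) (fun s t => d t * X s t + c t * Y s t) Z ∧
    mapDegree (fun s t => c t * X s t - d t * Y s t) (fun s t => d t * X s t + c t * Y s t) Z =
      mapDegree X Y Z := by
  have mc := MixedC1.ofSnd hc
  have md := MixedC1.ofSnd hd
  have bc := Biperiodic.ofSnd pc
  have bd := Biperiodic.ofSnd pd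
  have hN : ∀ s t, (c t * X s t - d t * Y s t) ^ 2 + (d t * X s t + c t * Y s t) ^ 2 + Z s t ^ 2 =
      X s t ^ 2 + Y s t ^ 2 + Z s t ^ 2 := fun s t => by
    linear_combination (X s t ^ 2 + Y s t ^ 2) * hcd t
  have h' : TorusMap (fun s t => c t * X s t - d t * Y s t)
      (fun s t => d t * X s t + c t * Y s t) Z :=
    ⟨(mc.mul h.mixedX).sub (md.mul h.mixedY), (md.mul h.mixedX).add (mc.mul h.mixedY), h.mixedZ,
      (bc.mul h.perX).sub (bd.mul h.perY), (bd.mul h.perX).add (bc.mul h.perY), h.perZ,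
      fun s t => by rw [hN]; exact h.pos s t⟩
  refine ⟨h', ?_⟩
  -- Here ω is the angular speed of the rotation and q is the s-derivative of the height Z / ‖(X, Y,
  -- Z)‖ on the unit sphere. By Archimedes' formula (area is height times angle) the rotation
  -- changes the density by −ω(t) q.
  set ω : ℝ → ℝ := fun t => c t * deriv d t - d t * deriv c t with hω
  set q : ℝ → ℝ → ℝ := fun s t => derivFst Z s t / √(X s t ^ 2 + Y s t ^ 2 + Z s t ^ 2) -
    Z s t * (X s t * derivFst X s t + Y s t * derivFst Y s t + Z s t * derivFst Z s t) /
      √(X s t ^ 2 + Y s t ^ 2 + Z s t ^ 2) ^ 3 with hq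
  have hρ : ∀ s t, √(X s t ^ 2 + Y s t ^ 2 + Z s t ^ 2) ≠ 0 :=
    fun s t => (Real.sqrt_pos.2 (h.pos s t)).ne'
  have hq' : ∀ s t, HasDerivAt (fun s => Z s t / √(X s t ^ 2 + Y s t ^ 2 + Z s t ^ 2)) (q s t) s := by
    intro s t
    have hX := h.mixedX.hasDerivFst s t
    have hY := h.mixedY.hasDerivFst s t
    have hZ := h.mixedZ.hasDerivFst s t
    refine (hZ.div ((((hX.pow 2).add (hY.pow 2)).add (hZ.pow 2)).sqrt (h.pos s t).ne')
      (hρ s t)).congr_deriv ?_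
    simp only [hq, Pi.add_apply, Pi.pow_apply]
    have := hρ s t
    generalize √(X s t ^ 2 + Y s t ^ 2 + Z s t ^ 2) = ρ at this
    field_simp
    ring
  have hdens : ∀ s t, degreeDensity (fun s t => c t * X s t - d t * Y s t)
      (fun s t => d t * X s t + c t * Y s t) Z s t = degreeDensity X Y Z s t - ω t * q s t := by
    intro s t
    have hc1 := (hc.differentiable one_ne_zero t).hasDerivAt
    have hd1 := (hd.differentiable one_ne_zero t).hasDerivAt
    have hX := h.mixedX.hasDerivFst s t
    have hY := h.mixedY.hasDerivFst s t
    have hX2 := h.mixedX.hasDerivSnd s t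
    have hY2 := h.mixedY.hasDerivSnd s t
    have e1 : derivFst (fun s t => c t * X s t - d t * Y s t) s t = c t * derivFst X s t -
        d t * derivFst Y s t := ((hX.const_mul (c t)).sub (hY.const_mul (d t))).deriv
    have e2 : derivFst (fun s t => d t * X s t + c t * Y s t) s t = d t * derivFst X s t +
        c t * derivFst Y s t := ((hX.const_mul (d t)).add (hY.const_mul (c t))).deriv
    have e3 : derivSnd (fun s t => c t * X s t - d t * Y s t) s t = deriv c t * X s t +
        c t * derivSnd X s t - (deriv d t * Y s t + d t * derivSnd Y s t) :=
      ((hc1.mul hX2).sub (hd1.mul hY2)).deriv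
    have e4 : derivSnd (fun s t => d t * X s t + c t * Y s t) s t = deriv d t * X s t +
        d t * derivSnd X s t + (deriv c t * Y s t + c t * derivSnd Y s t) :=
      ((hd1.mul hX2).add (hc1.mul hY2)).deriv
    have h0 : c t * deriv c t + d t * deriv d t = 0 := by
      have h1 := ((hc1.pow 2).add (hd1.pow 2)).congr_of_eventuallyEq
        (f₁ := fun _ => (1 : ℝ)) (Filter.Eventually.of_forall fun t => (hcd t).symm)
      have := h1.unique (hasDerivAt_const t (1 : ℝ))
      simp at this
      linarith
    have hc2 : deriv c t = - ω t * d t := by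
      simp only [hω]; linear_combination (-deriv c t) * hcd t + c t * h0
    have hd2 : deriv d t = ω t * c t := by
      simp only [hω]; linear_combination (-deriv d t) * hcd t + d t * h0
    simp only [degreeDensity, solidForm, e1, e2, e3, e4, hN, hc2, hd2, hq]
    have hsq := Real.sq_sqrt (h.pos s t).le
    have := hρ s t
    generalize √(X s t ^ 2 + Y s t ^ 2 + Z s t ^ 2) = ρ at this hsq
    field_simp
    rw [hsq]
    simp only [tripleDet]
    generalize ω t = w
    linear_combination (X s t * (derivFst Y s t * derivSnd Z s t -
        derivFst Z s t * (derivSnd Y s t + w * X s t)) -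
      Y s t * (derivFst X s t * derivSnd Z s t - derivFst Z s t * (derivSnd X s t - w * Y s t)) +
      Z s t * (derivFst X s t * (derivSnd Y s t + w * X s t) -
        derivFst Y s t * (derivSnd X s t - w * Y s t))) * hcd t
  have cω : Continuous ω := by
    have := hc.continuous; have := hd.continuous
    have := hc.continuous_deriv le_rfl; have := hd.continuous_deriv le_rfl
    fun_prop
  have cq : Continuous fun v : ℝ × ℝ => q v.1 v.2 := by
    have := h.mixedX.cont; have := h.mixedY.cont; have := h.mixedZ.cont
    have := h.mixedX.contFst; have := h.mixedY.contFst; have := h.mixedZ.contFst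
    exact Continuous.sub (Continuous.div (by fun_prop) (by fun_prop) fun v => hρ _ _)
      (Continuous.div (by fun_prop) (by fun_prop) fun v => pow_ne_zero 3 (hρ _ _))
  have cD := h.continuous_degreeDensity
  simp only [mapDegree]
  congr 1
  -- Integration in s comes first: ω depends on t alone, and q is the s-derivative of a periodic
  -- function.
  rw [intervalIntegral_swap_of_continuous h'.continuous_degreeDensity,
    intervalIntegral_swap_of_continuous cD]
  refine intervalIntegral.integral_congr fun t _ => ?_
  have c1 : Continuous fun s => degreeDensity X Y Z s t :=
    cD.comp (f := fun s : ℝ => (s, t)) (by fun_prop)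
  have c2 : Continuous fun s => q s t := cq.comp (f := fun s : ℝ => (s, t)) (by fun_prop)
  simp only [hdens]
  rw [intervalIntegral.integral_sub (c1.intervalIntegrable 0 1)
    ((c2.const_mul (ω t)).intervalIntegrable 0 1), intervalIntegral.integral_const_mul,
    integral_deriv_eq_zero_of_periodic (fun s => hq' s t) c2, mul_zero, sub_zero]
  intro s
  simp only [h.perX.fst, h.perY.fst, h.perZ.fst]

/-! ### Quaternion frames, stereographic coordinates and the Gauss integral -/

/-- The product of `p` with the first imaginary unit, for the quaternion structure on `E4`. -/
def frameI (p : E4) : E4 := !₂[-p 1, p 0, -p 3, p 2]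

/-- The product of `p` with the second imaginary unit. -/
def frameJ (p : E4) : E4 := !₂[-p 2, p 3, p 0, -p 1]

/-- The product of `p` with the third imaginary unit. -/
def frameK (p : E4) : E4 := !₂[-p 3, -p 2, p 1, p 0]

theorem inner_eq_sum (x y : E4) :
    inner ℝ x y = x 0 * y 0 + x 1 * y 1 + x 2 * y 2 + x 3 * y 3 := by
  simp [PiLp.inner_apply, Fin.sum_univ_four]
  ring

theorem norm_sq_eq_sum (x : E4) : ‖x‖ ^ 2 = x 0 ^ 2 + x 1 ^ 2 + x 2 ^ 2 + x 3 ^ 2 := by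
  rw [EuclideanSpace.norm_sq_eq, Fin.sum_univ_four]
  simp

theorem inner_frameI (p x : E4) :
    inner ℝ (frameI p) x = -p 1 * x 0 + p 0 * x 1 - p 3 * x 2 + p 2 * x 3 := by
  rw [inner_eq_sum]; simp [frameI]; ring

theorem inner_frameJ (p x : E4) :
    inner ℝ (frameJ p) x = -p 2 * x 0 + p 3 * x 1 + p 0 * x 2 - p 1 * x 3 := by
  rw [inner_eq_sum]; simp [frameJ]; ring

theorem inner_frameK (p x : E4) :
    inner ℝ (frameK p) x = -p 3 * x 0 - p 2 * x 1 + p 1 * x 2 + p 0 * x 3 := by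
  rw [inner_eq_sum]; simp [frameK]; ring

/-- The vectors p, ip, jp, kp are orthogonal and all of norm ‖p‖. They trivialize the orthogonal
complements of all p ≠ 0 continuously, so that difference maps for different poles take values in
one fixed ℝ³. -/
theorem frame_norm_sq (p x : E4) :
    inner ℝ (frameI p) x ^ 2 + inner ℝ (frameJ p) x ^ 2 + inner ℝ (frameK p) x ^ 2 +
      inner ℝ p x ^ 2 = ‖p‖ ^ 2 * ‖x‖ ^ 2 := by
  rw [inner_frameI, inner_frameJ, inner_frameK, inner_eq_sum, norm_sq_eq_sum, norm_sq_eq_sum]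
  ring

/-- The frame p, ip, jp, kp is positively oriented with determinant ‖p‖⁴. Multiplication by it turns
the first row p into (‖p‖², 0, 0, 0) and leaves the three-dimensional determinant of the frame
coordinates. -/
theorem det_frame (p r a b : E4) :
    (Matrix.of ![p.ofLp, r.ofLp, a.ofLp, b.ofLp]).det * ‖p‖ ^ 2 =
      tripleDet (inner ℝ (frameI p) r) (inner ℝ (frameJ p) r) (inner ℝ (frameK p) r)
        (inner ℝ (frameI p) a) (inner ℝ (frameJ p) a) (inner ℝ (frameK p) a)
        (inner ℝ (frameI p) b) (inner ℝ (frameJ p) b) (inner ℝ (frameK p) b) := by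
  simp only [inner_frameI, inner_frameJ, inner_frameK, norm_sq_eq_sum, tripleDet]
  simp [Matrix.det_succ_row_zero, Fin.sum_univ_succ, Fin.succAbove]
  ring

/-- The coordinate of the stereographic projection of `x` from the pole `p / ‖p‖` in the direction
of the frame vector `e`. -/
def stereoCoord (e : E4 → E4) (p x : E4) : ℝ := 2 * inner ℝ (e p) x / (‖p‖ - inner ℝ p x)

theorem stereoToFun_coe {p : E4} (hp : ‖p‖ = 1) (x : E4) :
    ((stereoToFun p x : (ℝ ∙ p)ᗮ) : E4) =
      (2 / (1 - inner ℝ p x)) • (x - inner ℝ p x • p) := by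
  rw [stereoToFun_apply, Submodule.coe_smul, innerSL_apply_apply]
  congr 1
  have := (ℝ ∙ p).starProjection_add_starProjection_orthogonal x
  rw [Submodule.starProjection_unit_singleton ℝ hp x] at this
  exact eq_sub_of_add_eq' this

theorem inner_stereoToFun {p : E4} (hp : ‖p‖ = 1) (x : E4) {e : E4 → E4}
    (he : inner ℝ (e p) p = (0 : ℝ)) :
    inner ℝ (e p) ((stereoToFun p x : (ℝ ∙ p)ᗮ) : E4) = stereoCoord e p x := by
  rw [stereoToFun_coe hp, inner_smul_right, inner_sub_right, inner_smul_right, he, stereoCoord, hp]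
  ring

theorem inner_frameI_self (p : E4) : inner ℝ (frameI p) p = (0 : ℝ) := by rw [inner_frameI]; ring
theorem inner_frameJ_self (p : E4) : inner ℝ (frameJ p) p = (0 : ℝ) := by rw [inner_frameJ]; ring
theorem inner_frameK_self (p : E4) : inner ℝ (frameK p) p = (0 : ℝ) := by rw [inner_frameK]; ring

/-- The difference of two stereographic coordinates. -/
def stereoDiff (e : E4 → E4) (p : E4) (L₁ L₂ : ℝ → E4) (s t : ℝ) : ℝ :=
  stereoCoord e p (L₁ s) - stereoCoord e p (L₂ t)

/-- The degree of the difference map of two loops, seen from the pole `p / ‖p‖`. -/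
def linkDegree (p : E4) (L₁ L₂ : ℝ → E4) : ℝ :=
  mapDegree (stereoDiff frameI p L₁ L₂) (stereoDiff frameJ p L₁ L₂) (stereoDiff frameK p L₁ L₂)

theorem IsC1Loop.contDiff_inner {L : ℝ → E4} (hL : IsC1Loop L) (p : E4) :
    ContDiff ℝ 1 fun s => (inner ℝ p (L s) : ℝ) := contDiff_const.inner ℝ hL.contDiff

theorem IsC1Loop.contDiff_stereoCoord {L : ℝ → E4} (hL : IsC1Loop L) {p : E4}
    (hp : ∀ s, inner ℝ p (L s) < ‖p‖) (e : E4 → E4) :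
    ContDiff ℝ 1 fun s => stereoCoord e p (L s) :=
  (contDiff_const.mul (hL.contDiff_inner (e p))).div (contDiff_const.sub (hL.contDiff_inner p))
    fun s => (sub_pos.2 (hp s)).ne'

theorem inner_lt_norm {p x : E4} (hp : ‖p‖ = 1) (hx : ‖x‖ = 1) (h : x ≠ p) :
    inner ℝ p x < ‖p‖ := by
  rw [hp]
  refine lt_of_le_of_ne ?_ fun h1 => h ((inner_eq_one_iff_of_norm_eq_one hp hx).1 h1).symm
  simpa [hp, hx] using real_inner_le_norm p x

theorem IsC1Loop.differentiableAt_stereoToFun {L : ℝ → E4} (hL : IsC1Loop L) {p : E4}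
    (hp : ‖p‖ = 1) (h : ∀ s, inner ℝ p (L s) < ‖p‖) (s : ℝ) :
    DifferentiableAt ℝ (fun s => ((stereoToFun p (L s) : (ℝ ∙ p)ᗮ) : E4)) s := by
  simp only [stereoToFun_coe hp]
  have h1 := ((hL.contDiff_inner p).differentiable one_ne_zero) s
  have h2 := (hL.contDiff.differentiable one_ne_zero) s
  have h3 : 1 - inner ℝ p (L s) ≠ 0 := by have := h s; rw [hp] at this; linarith
  exact ((differentiableAt_const _).div ((differentiableAt_const _).sub h1) h3).smul
    (h2.sub (h1.smul_const p))

theorem deriv_stereoCoord {L : ℝ → E4} (hL : IsC1Loop L) {p : E4} (hp : ‖p‖ = 1)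
    (h : ∀ s, inner ℝ p (L s) < ‖p‖) {e : E4 → E4} (he : inner ℝ (e p) p = (0 : ℝ)) (s : ℝ) :
    inner ℝ (e p) (deriv (fun s => ((stereoToFun p (L s) : (ℝ ∙ p)ᗮ) : E4)) s) =
      deriv (fun s => stereoCoord e p (L s)) s := by
  have h1 := (hL.differentiableAt_stereoToFun hp h s).hasDerivAt
  have h2 := (innerSL ℝ (e p)).hasFDerivAt.comp_hasDerivAt s h1
  have h3 : (fun s => stereoCoord e p (L s)) = (innerSL ℝ (e p)) ∘
      fun s => ((stereoToFun p (L s) : (ℝ ∙ p)ᗮ) : E4) := by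
    ext s
    simp only [Function.comp_apply, innerSL_apply_apply]
    exact (inner_stereoToFun hp _ he).symm
  rw [h3, h2.deriv, innerSL_apply_apply]

theorem derivFst_stereoDiff (e : E4 → E4) (p : E4) (L₁ L₂ : ℝ → E4) (s t : ℝ) :
    derivFst (stereoDiff e p L₁ L₂) s t = deriv (fun s => stereoCoord e p (L₁ s)) s :=
  deriv_sub_const _

theorem derivSnd_stereoDiff (e : E4 → E4) (p : E4) (L₁ L₂ : ℝ → E4) (s t : ℝ) :
    derivSnd (stereoDiff e p L₁ L₂) s t = - deriv (fun s => stereoCoord e p (L₂ s)) t :=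
  deriv_const_sub _

/-- Both projected loops lie in the complement of p, so distances and determinants can be read off
in the frame. Two signs cancel: the orientation of the complement uses −p, and the t-derivative of
A(s) − B(t) is −B'(t). -/
theorem gaussIntegral_eq_linkDegree {L₁ L₂ : ℝ → E4} (h₁ : IsC1Loop L₁) (h₂ : IsC1Loop L₂) {p : E4}
    (hp : ‖p‖ = 1) (hp₁ : ∀ s, L₁ s ≠ p) (hp₂ : ∀ s, L₂ s ≠ p) :
    gaussIntegral p (fun s => (stereoToFun p (L₁ s) : E4)) (fun t => (stereoToFun p (L₂ t) : E4)) =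
      linkDegree p L₁ L₂ := by
  have q₁ : ∀ s, inner ℝ p (L₁ s) < ‖p‖ := fun s => inner_lt_norm hp (h₁.norm_eq_one s) (hp₁ s)
  have q₂ : ∀ s, inner ℝ p (L₂ s) < ‖p‖ := fun s => inner_lt_norm hp (h₂.norm_eq_one s) (hp₂ s)
  rw [gaussIntegral, linkDegree, mapDegree]
  congr 1
  refine intervalIntegral.integral_congr fun s _ => intervalIntegral.integral_congr fun t _ => ?_
  beta_reduce
  set A := fun s => ((stereoToFun p (L₁ s) : (ℝ ∙ p)ᗮ) : E4) with hA
  set B := fun s => ((stereoToFun p (L₂ s) : (ℝ ∙ p)ᗮ) : E4) with hB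
  have hd := det_frame p (A s - B t) (deriv A s) (deriv B t)
  have hn := frame_norm_sq p (A s - B t)
  have hz : inner ℝ p (A s - B t) = (0 : ℝ) := by
    rw [inner_sub_right, Submodule.mem_orthogonal_singleton_iff_inner_right.1 (Subtype.mem _),
      Submodule.mem_orthogonal_singleton_iff_inner_right.1 (Subtype.mem _), sub_zero]
  rw [hp, one_pow, mul_one] at hd
  rw [hp, hz, one_pow, one_mul, zero_pow two_ne_zero, add_zero] at hn
  have hneg : (Matrix.of ![(-p).ofLp, (A s - B t).ofLp, (deriv A s).ofLp, (deriv B t).ofLp]).det =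
      - (Matrix.of ![p.ofLp, (A s - B t).ofLp, (deriv A s).ofLp, (deriv B t).ofLp]).det := by
    have := Matrix.det_updateRow_smul
      (Matrix.of ![p.ofLp, (A s - B t).ofLp, (deriv A s).ofLp, (deriv B t).ofLp]) 0 (-1) p.ofLp
    have e1 : (Matrix.of ![p.ofLp, (A s - B t).ofLp, (deriv A s).ofLp,
        (deriv B t).ofLp]).updateRow 0 ((-1 : ℝ) • p.ofLp) =
        Matrix.of ![(-p).ofLp, (A s - B t).ofLp, (deriv A s).ofLp, (deriv B t).ofLp] := by
      ext i j; fin_cases i <;> simp [Matrix.updateRow_apply]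
    have e2 : (Matrix.of ![p.ofLp, (A s - B t).ofLp, (deriv A s).ofLp,
        (deriv B t).ofLp]).updateRow 0 p.ofLp =
        Matrix.of ![p.ofLp, (A s - B t).ofLp, (deriv A s).ofLp, (deriv B t).ofLp] := by
      ext i j; fin_cases i <;> simp [Matrix.updateRow_apply]
    rw [e1, e2] at this
    rw [this]; simp
  have hr : ‖A s - B t‖ = √(inner ℝ (frameI p) (A s - B t) ^ 2 +
      inner ℝ (frameJ p) (A s - B t) ^ 2 + inner ℝ (frameK p) (A s - B t) ^ 2) := by
    rw [hn, Real.sqrt_sq (norm_nonneg _)]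
  rw [hneg, hd, hr]
  have f0 : ∀ e : E4 → E4, inner ℝ (e p) p = (0 : ℝ) →
      inner ℝ (e p) (A s - B t) = stereoDiff e p L₁ L₂ s t := fun e he => by
    rw [inner_sub_right, inner_stereoToFun hp _ he, inner_stereoToFun hp _ he, stereoDiff]
  simp only [degreeDensity, solidForm, derivFst_stereoDiff, derivSnd_stereoDiff]
  rw [f0 _ (inner_frameI_self p), f0 _ (inner_frameJ_self p), f0 _ (inner_frameK_self p),
    deriv_stereoCoord h₁ hp q₁ (inner_frameI_self p),
    deriv_stereoCoord h₁ hp q₁ (inner_frameJ_self p),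
    deriv_stereoCoord h₁ hp q₁ (inner_frameK_self p),
    deriv_stereoCoord h₂ hp q₂ (inner_frameI_self p),
    deriv_stereoCoord h₂ hp q₂ (inner_frameJ_self p),
    deriv_stereoCoord h₂ hp q₂ (inner_frameK_self p)]
  simp only [tripleDet]
  ring

/-- The squares of the frame coordinates of x add up to ‖p‖² − ⟨p, x⟩², so the squared length of the
projection is 4 (‖p‖ + ⟨p, x⟩) / (‖p‖ − ⟨p, x⟩). This determines ⟨p, x⟩, and then the frame
coordinates determine x. -/
theorem eq_of_stereoCoord_eq {p a b : E4} (ha : ‖a‖ = 1) (hb : ‖b‖ = 1) (pa : inner ℝ p a < ‖p‖)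
    (pb : inner ℝ p b < ‖p‖) (hI : stereoCoord frameI p a = stereoCoord frameI p b)
    (hJ : stereoCoord frameJ p a = stereoCoord frameJ p b)
    (hK : stereoCoord frameK p a = stereoCoord frameK p b) : a = b := by
  have ua : ‖p‖ - inner ℝ p a ≠ 0 := (sub_pos.2 pa).ne'
  have ub : ‖p‖ - inner ℝ p b ≠ 0 := (sub_pos.2 pb).ne'
  have fa := frame_norm_sq p a
  have fb := frame_norm_sq p b
  have hp0 : 0 < ‖p‖ := by
    rcases (norm_nonneg p).eq_or_lt with h | h
    · have := norm_eq_zero.1 h.symm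
      simp [this] at pa
    · exact h
  rw [ha, one_pow, mul_one] at fa
  rw [hb, one_pow, mul_one] at fb
  simp only [stereoCoord, div_eq_div_iff ua ub] at hI hJ hK
  have hu : inner ℝ p a = (inner ℝ p b : ℝ) := by
    have : (‖p‖ ^ 2 - inner ℝ p a ^ 2) * (‖p‖ - inner ℝ p b) ^ 2 =
        (‖p‖ ^ 2 - inner ℝ p b ^ 2) * (‖p‖ - inner ℝ p a) ^ 2 := by
      linear_combination (-(‖p‖ - inner ℝ p b) ^ 2) * fa + (‖p‖ - inner ℝ p a) ^ 2 * fb + (1 / 4) * ((2 * inner ℝ (frameI p) a * (‖p‖ - inner ℝ p b) +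
        2 * inner ℝ (frameI p) b * (‖p‖ - inner ℝ p a)) * hI +
        (2 * inner ℝ (frameJ p) a * (‖p‖ - inner ℝ p b) +
        2 * inner ℝ (frameJ p) b * (‖p‖ - inner ℝ p a)) * hJ +
        (2 * inner ℝ (frameK p) a * (‖p‖ - inner ℝ p b) +
        2 * inner ℝ (frameK p) b * (‖p‖ - inner ℝ p a)) * hK)
    have h2 : (‖p‖ - inner ℝ p a) * (‖p‖ - inner ℝ p b) * (2 * ‖p‖) *
        (inner ℝ p a - inner ℝ p b) = 0 := by linear_combination this
    have h3 := (mul_eq_zero.1 h2).resolve_left (mul_ne_zero (mul_ne_zero ua ub) (by positivity))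
    linarith
  have key : ∀ {x y u : ℝ}, 2 * x * u = 2 * y * u → u ≠ 0 → x = y := fun h hu => by
    have := mul_right_cancel₀ hu h; linarith
  rw [hu] at hI hJ hK
  have eI := key hI ub
  have eJ := key hJ ub
  have eK := key hK ub
  have e0 := frame_norm_sq p (a - b)
  simp only [inner_sub_right, eI, eJ, eK, hu, sub_self] at e0
  have : ‖a - b‖ ^ 2 = 0 := by
    have h1 : ‖p‖ ^ 2 * ‖a - b‖ ^ 2 = 0 := by rw [← e0]; ring
    exact (mul_eq_zero.1 h1).resolve_left (by positivity)
  exact sub_eq_zero.1 (norm_eq_zero.1 (pow_eq_zero_iff two_ne_zero |>.1 this))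

theorem torusMap_stereoDiff {L₁ L₂ : ℝ → E4} (h₁ : IsC1Loop L₁) (h₂ : IsC1Loop L₂)
    (hne : ∀ s t, L₁ s ≠ L₂ t) {p : E4} (hp₁ : ∀ s, inner ℝ p (L₁ s) < ‖p‖)
    (hp₂ : ∀ s, inner ℝ p (L₂ s) < ‖p‖) :
    TorusMap (stereoDiff frameI p L₁ L₂) (stereoDiff frameJ p L₁ L₂)
      (stereoDiff frameK p L₁ L₂) := by
  have m : ∀ e, MixedC1 (stereoDiff e p L₁ L₂) := fun e =>
    (MixedC1.ofFst (h₁.contDiff_stereoCoord hp₁ e)).sub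
      (MixedC1.ofSnd (h₂.contDiff_stereoCoord hp₂ e))
  have b : ∀ e, Biperiodic (stereoDiff e p L₁ L₂) := fun e =>
    ⟨fun s t => by simp only [stereoDiff, h₁.periodic s], fun s t => by
      simp only [stereoDiff, h₂.periodic t]⟩
  refine ⟨m _, m _, m _, b _, b _, b _, fun s t => ?_⟩
  by_contra hc
  refine hne s t (eq_of_stereoCoord_eq (h₁.norm_eq_one s) (h₂.norm_eq_one t) (hp₁ s) (hp₂ t)
    (sub_eq_zero.1 ?_) (sub_eq_zero.1 ?_) (sub_eq_zero.1 ?_)) <;> change stereoDiff _ p L₁ L₂ s t = 0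
    <;> nlinarith

/-! ### Independence of the pole -/

/-- The coordinates `stereoCoord` are homogeneous of degree zero in the pole, so the pole can run
along a straight segment without normalization. The strict inequalities say that it never vanishes
and that its direction stays off the loops. -/
theorem linkDegree_eq_of_segment {L₁ L₂ : ℝ → E4} (h₁ : IsC1Loop L₁) (h₂ : IsC1Loop L₂)
    (hne : ∀ s t, L₁ s ≠ L₂ t) {p m : E4}
    (hm₁ : ∀ τ : unitInterval, ∀ s, inner ℝ (AffineMap.lineMap p m (τ : ℝ)) (L₁ s) <
      ‖AffineMap.lineMap p m (τ : ℝ)‖)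
    (hm₂ : ∀ τ : unitInterval, ∀ s, inner ℝ (AffineMap.lineMap p m (τ : ℝ)) (L₂ s) <
      ‖AffineMap.lineMap p m (τ : ℝ)‖) :
    linkDegree p L₁ L₂ = linkDegree m L₁ L₂ := by
  have cl : Continuous fun τ : unitInterval => (AffineMap.lineMap p m (τ : ℝ) : E4) :=
    AffineMap.lineMap_continuous.comp continuous_subtype_val
  have c : ∀ {e : E4 → E4}, Continuous e → Continuous fun v : unitInterval × ℝ × ℝ =>
      stereoDiff e (AffineMap.lineMap p m (v.1 : ℝ)) L₁ L₂ v.2.1 v.2.2 := by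
    intro e ce
    have q : Continuous fun v : unitInterval × ℝ × ℝ => (AffineMap.lineMap p m (v.1 : ℝ) : E4) :=
      cl.comp continuous_fst
    have eq : Continuous fun v : unitInterval × ℝ × ℝ => e (AffineMap.lineMap p m (v.1 : ℝ)) :=
      ce.comp q
    have l₁ : Continuous fun v : unitInterval × ℝ × ℝ => L₁ v.2.1 :=
      h₁.contDiff.continuous.comp (by fun_prop)
    have l₂ : Continuous fun v : unitInterval × ℝ × ℝ => L₂ v.2.2 :=
      h₂.contDiff.continuous.comp (by fun_prop)
    exact ((continuous_const.mul (eq.inner l₁)).div (q.norm.sub (q.inner l₁))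
      fun v => (sub_pos.2 (hm₁ _ _)).ne').sub ((continuous_const.mul (eq.inner l₂)).div
      (q.norm.sub (q.inner l₂)) fun v => (sub_pos.2 (hm₂ _ _)).ne')
  have cI : Continuous frameI := by unfold frameI; fun_prop
  have cJ : Continuous frameJ := by unfold frameJ; fun_prop
  have cK : Continuous frameK := by unfold frameK; fun_prop
  have := mapDegree_eq_of_family (T := unitInterval)
    (X := fun τ => stereoDiff frameI (AffineMap.lineMap p m (τ : ℝ)) L₁ L₂)
    (Y := fun τ => stereoDiff frameJ (AffineMap.lineMap p m (τ : ℝ)) L₁ L₂)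
    (Z := fun τ => stereoDiff frameK (AffineMap.lineMap p m (τ : ℝ)) L₁ L₂)
    (fun τ => torusMap_stereoDiff h₁ h₂ hne (hm₁ τ) (hm₂ τ)) (c cI) (c cJ) (c cK) 0 1
  simpa only [linkDegree, Set.Icc.coe_zero, Set.Icc.coe_one, AffineMap.lineMap_apply_zero,
    AffineMap.lineMap_apply_one] using this

/-- The points `m` for which the segment from `p` to `m` meets the cone over the loop `L`. -/
def coneObstruction (L : ℝ → E4) (p : E4) : Set E4 :=
  Set.range fun v : ℝ × ℝ × ℝ => v.1 • L v.2.1 - v.2.2 • p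

/-- The set is a C¹ image of ℝ³. In four-space its complement is therefore dense, which leaves room
for an intermediate pole. -/
theorem dimH_coneObstruction_le {L : ℝ → E4} (hL : IsC1Loop L) (p : E4) :
    dimH (coneObstruction L p) ≤ 3 := by
  have hc : ContDiff ℝ 1 fun v : ℝ × ℝ × ℝ => v.1 • L v.2.1 - v.2.2 • p := by
    have := hL.contDiff
    fun_prop
  refine hc.dimH_range_le.trans ?_
  simp

theorem inner_lineMap_lt {L : ℝ → E4} (hL : IsC1Loop L) {p m : E4}
    (hp : ∀ s, inner ℝ p (L s) < ‖p‖) (hm : m ∉ coneObstruction L p) (τ : unitInterval) (s : ℝ) :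
    inner ℝ (AffineMap.lineMap p m (τ : ℝ)) (L s) < ‖AffineMap.lineMap p m (τ : ℝ)‖ := by
  set x : E4 := AffineMap.lineMap p m (τ : ℝ) with hx
  have hle := real_inner_le_norm x (L s)
  rw [hL.norm_eq_one, mul_one] at hle
  refine lt_of_le_of_ne hle fun h => ?_
  have h2 : inner ℝ x (L s) = ‖x‖ * ‖L s‖ := by rw [hL.norm_eq_one, mul_one, h]
  rw [inner_eq_norm_mul_iff_real, hL.norm_eq_one, one_smul] at h2
  rcases τ.2.1.eq_or_lt with h0 | h0
  · have hxp : x = p := by rw [hx, ← h0]; simp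
    rw [hxp] at h
    exact (hp s).ne h
  -- Equality in Cauchy–Schwarz means (1 − τ) p + τ m = ‖x‖ L(s); solving this for m gives the three
  -- parameters.
  · refine hm ⟨(‖x‖ / τ, s, (1 - τ) / τ), ?_⟩
    simp only
    have e : x = (1 - (τ : ℝ)) • p + (τ : ℝ) • m := by rw [hx, AffineMap.lineMap_apply_module]
    have : (τ : ℝ) • m = ‖x‖ • L s - (1 - (τ : ℝ)) • p := by rw [← h2, e]; abel
    rw [div_eq_inv_mul, div_eq_inv_mul, mul_smul, mul_smul, ← smul_sub, ← this, smul_smul,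
      inv_mul_cancel₀ h0.ne', one_smul]

/-- The degree of the difference map does not depend on the pole. -/
theorem linkDegree_eq {L₁ L₂ : ℝ → E4} (h₁ : IsC1Loop L₁) (h₂ : IsC1Loop L₂)
    (hne : ∀ s t, L₁ s ≠ L₂ t) {p q : E4} (hp₁ : ∀ s, inner ℝ p (L₁ s) < ‖p‖)
    (hp₂ : ∀ s, inner ℝ p (L₂ s) < ‖p‖) (hq₁ : ∀ s, inner ℝ q (L₁ s) < ‖q‖)
    (hq₂ : ∀ s, inner ℝ q (L₂ s) < ‖q‖) : linkDegree p L₁ L₂ = linkDegree q L₁ L₂ := by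
  -- One intermediate pole m must be visible from p and from q past both loops; the four
  -- obstructions together still have dimension at most three.
  have hd : dimH ((coneObstruction L₁ p ∪ coneObstruction L₂ p) ∪
      (coneObstruction L₁ q ∪ coneObstruction L₂ q)) < (Module.finrank ℝ E4 : ℕ) := by
    rw [dimH_union, dimH_union, dimH_union]
    refine lt_of_le_of_lt (b := 3) ?_ (by simp; norm_num)
    exact max_le (max_le (dimH_coneObstruction_le h₁ p) (dimH_coneObstruction_le h₂ p))
      (max_le (dimH_coneObstruction_le h₁ q) (dimH_coneObstruction_le h₂ q))
  obtain ⟨m, hm⟩ := (dense_compl_of_dimH_lt_finrank hd).nonempty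
  simp only [Set.mem_compl_iff, Set.mem_union, not_or] at hm
  exact (linkDegree_eq_of_segment h₁ h₂ hne (inner_lineMap_lt h₁ hp₁ hm.1.1)
    (inner_lineMap_lt h₂ hp₂ hm.1.2)).trans (linkDegree_eq_of_segment h₁ h₂ hne
    (inner_lineMap_lt h₁ hq₁ hm.2.1) (inner_lineMap_lt h₂ hq₂ hm.2.2)).symm

/-! ### Solid torus coordinates and maps glued from two halves -/

/-- Continuously differentiable coordinates of a loop on the torus of a sphere: `c + i s` is the
exponential of the horizontal angle, `k + i l` that of the vertical angle, and `r` is a radius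
that decreases with the depth. -/
structure TorusCoords (c s r k l : ℝ → ℝ) : Prop where
  dc : ContDiff ℝ 1 c
  ds : ContDiff ℝ 1 s
  dr : ContDiff ℝ 1 r
  dk : ContDiff ℝ 1 k
  dl : ContDiff ℝ 1 l
  pc : ∀ x, c (x + 1) = c x
  ps : ∀ x, s (x + 1) = s x
  pr : ∀ x, r (x + 1) = r x
  pk : ∀ x, k (x + 1) = k x
  pl : ∀ x, l (x + 1) = l x
  cs : ∀ x, c x ^ 2 + s x ^ 2 = 1
  kl : ∀ x, k x ^ 2 + l x ^ 2 = 1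
  r_pos : ∀ x, 0 < r x
  r_lt : ∀ x, r x < 1

/-- `p X + q Y`, where `p` and `q` are cut-off functions supported in `C > 0` and in `C < 0`. -/
def blend (C X Y : ℝ → ℝ → ℝ) (s t : ℝ) : ℝ :=
  Real.smoothTransition (C s t) * X s t + Real.smoothTransition (-C s t) * Y s t

theorem MixedC1.transition {C : ℝ → ℝ → ℝ} (hC : MixedC1 C) :
    MixedC1 fun s t => Real.smoothTransition (C s t) :=
  hC.comp fun _ _ => Real.smoothTransition.contDiffAt

theorem MixedC1.blend {C X Y : ℝ → ℝ → ℝ} (hC : MixedC1 C) (hX : MixedC1 X) (hY : MixedC1 Y) :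
    MixedC1 (blend C X Y) :=
  (hC.transition.mul hX).add (hC.neg.transition.mul hY)

theorem Biperiodic.blend {C X Y : ℝ → ℝ → ℝ} (hC : Biperiodic C) (hX : Biperiodic X)
    (hY : Biperiodic Y) : Biperiodic (blend C X Y) :=
  ((hC.comp _).mul hX).add ((hC.neg.comp _).mul hY)

/-- The cut-off attains its minimum zero wherever C ≤ 0, so its derivative vanishes there too,
including on the boundary C = 0. -/
theorem derivFst_transition_mul {C X : ℝ → ℝ → ℝ} (hC : MixedC1 C) (hX : MixedC1 X) {s t : ℝ}
    (h : C s t ≤ 0) : derivFst (fun s t => Real.smoothTransition (C s t) * X s t) s t = 0 := by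
  have h0 := Real.smoothTransition.zero_of_nonpos h
  have hd := hC.transition.hasDerivFst s t
  have hm : IsLocalMin (fun s => Real.smoothTransition (C s t)) s :=
    Filter.Eventually.of_forall fun x => by
      simp only [h0]; exact Real.smoothTransition.nonneg _
  have e := hm.hasDerivAt_eq_zero hd
  have := (hd.mul (hX.hasDerivFst s t)).deriv
  rw [e, h0, zero_mul, zero_mul, add_zero] at this
  exact this

theorem derivSnd_transition_mul {C X : ℝ → ℝ → ℝ} (hC : MixedC1 C) (hX : MixedC1 X) {s t : ℝ}
    (h : C s t ≤ 0) : derivSnd (fun s t => Real.smoothTransition (C s t) * X s t) s t = 0 := by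
  have h0 := Real.smoothTransition.zero_of_nonpos h
  have hd := hC.transition.hasDerivSnd s t
  have hm : IsLocalMin (fun t => Real.smoothTransition (C s t)) t :=
    Filter.Eventually.of_forall fun x => by
      simp only [h0]; exact Real.smoothTransition.nonneg _
  have e := hm.hasDerivAt_eq_zero hd
  have := (hd.mul (hX.hasDerivSnd s t)).deriv
  rw [e, h0, zero_mul, zero_mul, add_zero] at this
  exact this

theorem derivFst_add {f g : ℝ → ℝ → ℝ} (hf : MixedC1 f) (hg : MixedC1 g) (s t : ℝ) :
    derivFst (fun s t => f s t + g s t) s t = derivFst f s t + derivFst g s t :=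
  ((hf.hasDerivFst s t).add (hg.hasDerivFst s t)).deriv

theorem derivSnd_add {f g : ℝ → ℝ → ℝ} (hf : MixedC1 f) (hg : MixedC1 g) (s t : ℝ) :
    derivSnd (fun s t => f s t + g s t) s t = derivSnd f s t + derivSnd g s t :=
  ((hf.hasDerivSnd s t).add (hg.hasDerivSnd s t)).deriv

theorem blend_congr_of_nonpos {C X Y X' : ℝ → ℝ → ℝ} (hC : MixedC1 C) (hX : MixedC1 X)
    (hY : MixedC1 Y) (hX' : MixedC1 X') {s t : ℝ} (h : C s t ≤ 0) :
    blend C X Y s t = blend C X' Y s t ∧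
      derivFst (blend C X Y) s t = derivFst (blend C X' Y) s t ∧
      derivSnd (blend C X Y) s t = derivSnd (blend C X' Y) s t := by
  have m1 := hC.transition.mul hX
  have m2 := hC.transition.mul hX'
  have m3 := hC.neg.transition.mul hY
  refine ⟨by simp [blend, Real.smoothTransition.zero_of_nonpos h], ?_, ?_⟩ <;> unfold blend
  · rw [derivFst_add m1 m3, derivFst_add m2 m3, derivFst_transition_mul hC hX h,
      derivFst_transition_mul hC hX' h]
  · rw [derivSnd_add m1 m3, derivSnd_add m2 m3, derivSnd_transition_mul hC hX h,
      derivSnd_transition_mul hC hX' h]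

theorem blend_congr_of_nonneg {C X Y Y' : ℝ → ℝ → ℝ} (hC : MixedC1 C) (hX : MixedC1 X)
    (hY : MixedC1 Y) (hY' : MixedC1 Y') {s t : ℝ} (h : 0 ≤ C s t) :
    blend C X Y s t = blend C X Y' s t ∧
      derivFst (blend C X Y) s t = derivFst (blend C X Y') s t ∧
      derivSnd (blend C X Y) s t = derivSnd (blend C X Y') s t := by
  have m1 := hC.neg.transition.mul hY
  have m2 := hC.neg.transition.mul hY'
  have m3 := hC.transition.mul hX
  have h' : -C s t ≤ 0 := by linarith
  refine ⟨by simp [blend, Real.smoothTransition.zero_of_nonpos h'], ?_, ?_⟩ <;> unfold blend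
  · rw [derivFst_add m3 m1, derivFst_add m3 m2, derivFst_transition_mul hC.neg hY h',
      derivFst_transition_mul hC.neg hY' h']
  · rw [derivSnd_add m3 m1, derivSnd_add m3 m2, derivSnd_transition_mul hC.neg hY h',
      derivSnd_transition_mul hC.neg hY' h']

/-- Linearity of the integral; it reduces an identity between degrees to a pointwise one. -/
theorem mapDegree_add_of_degreeDensity {X Y Z X' Y' Z' U V W U' V' W' : ℝ → ℝ → ℝ}
    (h1 : TorusMap X Y Z) (h2 : TorusMap X' Y' Z') (h3 : TorusMap U V W) (h4 : TorusMap U' V' W')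
    (hd : ∀ s t, degreeDensity X Y Z s t + degreeDensity X' Y' Z' s t =
      degreeDensity U V W s t + degreeDensity U' V' W' s t) :
    mapDegree X Y Z + mapDegree X' Y' Z' = mapDegree U V W + mapDegree U' V' W' := by
  have key : ∀ {X Y Z X' Y' Z' : ℝ → ℝ → ℝ}, TorusMap X Y Z → TorusMap X' Y' Z' →
      mapDegree X Y Z + mapDegree X' Y' Z' = 1 / (4 * π) * ∫ s in (0 : ℝ)..1, ∫ t in (0 : ℝ)..1,
        (degreeDensity X Y Z s t + degreeDensity X' Y' Z' s t) := by
    intro X Y Z X' Y' Z' h h'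
    have c1 := h.continuous_degreeDensity
    have c2 := h'.continuous_degreeDensity
    have i : ∀ {f : ℝ → ℝ → ℝ}, (Continuous fun v : ℝ × ℝ => f v.1 v.2) → ∀ s,
        IntervalIntegrable (fun t => f s t) MeasureTheory.volume 0 1 := fun hf s =>
      (hf.comp (f := fun t : ℝ => (s, t)) (by fun_prop)).intervalIntegrable 0 1
    have j : ∀ {f : ℝ → ℝ → ℝ}, (Continuous fun v : ℝ × ℝ => f v.1 v.2) →
        IntervalIntegrable (fun s => ∫ t in (0 : ℝ)..1, f s t) MeasureTheory.volume 0 1 := fun hf =>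
      (intervalIntegral.continuous_parametric_intervalIntegral_of_continuous' hf 0
        1).intervalIntegrable 0 1
    simp only [mapDegree]
    rw [← mul_add, ← intervalIntegral.integral_add (j c1) (j c2)]
    congr 1
    refine intervalIntegral.integral_congr fun s _ => ?_
    exact (intervalIntegral.integral_add (i c1 s) (i c2 s)).symm
  rw [key h1 h2, key h3 h4]
  simp only [hd]

/-- The last coordinate S vanishes only where C = ±1. At such points one cut-off is 1 and the other
is 0, so only one pair of functions has to be examined. -/
theorem TorusMap.blend {C S X₁ X₂ Y₁ Y₂ : ℝ → ℝ → ℝ} (mC : MixedC1 C) (mS : MixedC1 S)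
    (bC : Biperiodic C) (bS : Biperiodic S) (hCS : ∀ s t, C s t ^ 2 + S s t ^ 2 = 1)
    (m₁ : MixedC1 X₁) (m₂ : MixedC1 X₂) (n₁ : MixedC1 Y₁) (n₂ : MixedC1 Y₂)
    (b₁ : Biperiodic X₁) (b₂ : Biperiodic X₂) (d₁ : Biperiodic Y₁) (d₂ : Biperiodic Y₂)
    (hX : ∀ s t, C s t = 1 → X₁ s t = 0 → X₂ s t = 0 → False)
    (hY : ∀ s t, C s t = -1 → Y₁ s t = 0 → Y₂ s t = 0 → False) :
    TorusMap (blend C X₁ Y₁) (blend C X₂ Y₂) S := by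
  refine ⟨mC.blend m₁ n₁, mC.blend m₂ n₂, mS, bC.blend b₁ d₁, bC.blend b₂ d₂, bS, fun s t => ?_⟩
  by_contra hc
  have e1 : TorusDiagram.blend C X₁ Y₁ s t = 0 := by nlinarith
  have e2 : TorusDiagram.blend C X₂ Y₂ s t = 0 := by nlinarith
  have e3 : S s t = 0 := by nlinarith
  have h1 := hCS s t
  rw [e3] at h1
  have h2 : (C s t - 1) * (C s t + 1) = 0 := by linear_combination h1
  simp only [TorusDiagram.blend] at e1 e2
  rcases mul_eq_zero.1 h2 with h | h
  · have hC : C s t = 1 := by linarith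
    rw [hC, Real.smoothTransition.one, Real.smoothTransition.zero_of_nonpos (by norm_num)] at e1 e2
    exact hX s t hC (by linarith) (by linarith)
  · have hC : C s t = -1 := by linarith
    rw [hC, neg_neg, Real.smoothTransition.one,
      Real.smoothTransition.zero_of_nonpos (by norm_num)] at e1 e2
    exact hY s t hC (by linarith) (by linarith)

theorem mapDegree_eq_zero_of_snd {X Z : ℝ → ℝ → ℝ} : mapDegree X (fun _ _ => 0) Z = 0 := by
  simp [mapDegree, degreeDensity, solidForm, tripleDet, derivFst, derivSnd]

/-- Where C ≤ 0 the density only sees the Y-data, and where C ≥ 0 only the X-data. Exchanging the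
Y-data between two maps thus permutes their densities pointwise, and the sum of the degrees is
unchanged. -/
theorem mapDegree_blend_add {C S X₁ X₂ Y₁ Y₂ X₁' X₂' Y₁' Y₂' : ℝ → ℝ → ℝ} (mC : MixedC1 C)
    (mX₁ : MixedC1 X₁) (mX₂ : MixedC1 X₂) (mY₁ : MixedC1 Y₁) (mY₂ : MixedC1 Y₂)
    (mX₁' : MixedC1 X₁') (mX₂' : MixedC1 X₂') (mY₁' : MixedC1 Y₁') (mY₂' : MixedC1 Y₂')
    (h1 : TorusMap (blend C X₁ Y₁) (blend C X₂ Y₂) S)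
    (h2 : TorusMap (blend C X₁' Y₁') (blend C X₂' Y₂') S)
    (h3 : TorusMap (blend C X₁ Y₁') (blend C X₂ Y₂') S)
    (h4 : TorusMap (blend C X₁' Y₁) (blend C X₂' Y₂) S) :
    mapDegree (blend C X₁ Y₁) (blend C X₂ Y₂) S + mapDegree (blend C X₁' Y₁') (blend C X₂' Y₂') S =
      mapDegree (blend C X₁ Y₁') (blend C X₂ Y₂') S +
        mapDegree (blend C X₁' Y₁) (blend C X₂' Y₂) S := by
  refine mapDegree_add_of_degreeDensity h1 h2 h3 h4 fun s t => ?_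
  simp only [degreeDensity]
  rcases le_total (C s t) 0 with h | h
  · obtain ⟨a1, a2, a3⟩ := blend_congr_of_nonpos mC mX₁ mY₁ mX₁' h
    obtain ⟨b1, b2, b3⟩ := blend_congr_of_nonpos mC mX₂ mY₂ mX₂' h
    obtain ⟨c1, c2, c3⟩ := blend_congr_of_nonpos mC mX₁ mY₁' mX₁' h
    obtain ⟨d1, d2, d3⟩ := blend_congr_of_nonpos mC mX₂ mY₂' mX₂' h
    rw [a1, a2, a3, b1, b2, b3, c1, c2, c3, d1, d2, d3, add_comm]
  · obtain ⟨a1, a2, a3⟩ := blend_congr_of_nonneg mC mX₁ mY₁ mY₁' h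
    obtain ⟨b1, b2, b3⟩ := blend_congr_of_nonneg mC mX₂ mY₂ mY₂' h
    obtain ⟨c1, c2, c3⟩ := blend_congr_of_nonneg mC mX₁' mY₁ mY₁' h
    obtain ⟨d1, d2, d3⟩ := blend_congr_of_nonneg mC mX₂' mY₂ mY₂' h
    rw [a1, a2, a3, b1, b2, b3, c1, c2, c3, d1, d2, d3]

/-- The cosine of the difference of two angles, given by their cosines and sines. -/
def cosDiff (c₁ s₁ c₂ s₂ : ℝ → ℝ) (s t : ℝ) : ℝ := c₁ s * c₂ t + s₁ s * s₂ t

/-- The sine of the difference of two angles, given by their cosines and sines. -/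
def sinDiff (c₁ s₁ c₂ s₂ : ℝ → ℝ) (s t : ℝ) : ℝ := s₁ s * c₂ t - c₁ s * s₂ t

section Diff

variable {c₁ s₁ c₂ s₂ : ℝ → ℝ}

theorem MixedC1.cosDiff (h1 : ContDiff ℝ 1 c₁) (h2 : ContDiff ℝ 1 s₁) (h3 : ContDiff ℝ 1 c₂)
    (h4 : ContDiff ℝ 1 s₂) : MixedC1 (cosDiff c₁ s₁ c₂ s₂) :=
  ((ofFst h1).mul (ofSnd h3)).add ((ofFst h2).mul (ofSnd h4))

theorem MixedC1.sinDiff (h1 : ContDiff ℝ 1 c₁) (h2 : ContDiff ℝ 1 s₁) (h3 : ContDiff ℝ 1 c₂)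
    (h4 : ContDiff ℝ 1 s₂) : MixedC1 (sinDiff c₁ s₁ c₂ s₂) :=
  ((ofFst h2).mul (ofSnd h3)).sub ((ofFst h1).mul (ofSnd h4))

theorem Biperiodic.cosDiff (h1 : ∀ x, c₁ (x + 1) = c₁ x) (h2 : ∀ x, s₁ (x + 1) = s₁ x)
    (h3 : ∀ x, c₂ (x + 1) = c₂ x) (h4 : ∀ x, s₂ (x + 1) = s₂ x) :
    Biperiodic (cosDiff c₁ s₁ c₂ s₂) :=
  ((ofFst h1).mul (ofSnd h3)).add ((ofFst h2).mul (ofSnd h4))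

theorem Biperiodic.sinDiff (h1 : ∀ x, c₁ (x + 1) = c₁ x) (h2 : ∀ x, s₁ (x + 1) = s₁ x)
    (h3 : ∀ x, c₂ (x + 1) = c₂ x) (h4 : ∀ x, s₂ (x + 1) = s₂ x) :
    Biperiodic (sinDiff c₁ s₁ c₂ s₂) :=
  ((ofFst h2).mul (ofSnd h3)).sub ((ofFst h1).mul (ofSnd h4))

theorem cosDiff_sq_add_sinDiff_sq (h₁ : ∀ x, c₁ x ^ 2 + s₁ x ^ 2 = 1)
    (h₂ : ∀ x, c₂ x ^ 2 + s₂ x ^ 2 = 1) (s t : ℝ) :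
    cosDiff c₁ s₁ c₂ s₂ s t ^ 2 + sinDiff c₁ s₁ c₂ s₂ s t ^ 2 = 1 := by
  simp only [cosDiff, sinDiff]
  linear_combination (c₂ t ^ 2 + s₂ t ^ 2) * h₁ s + h₂ t

end Diff

/-! ### The Cayley transform from the disc to the half-plane -/

/-- Real part of `(1 + ω) / (1 - ω)` for `ω = r (k + i l)`. -/
def cayleyRe (r k : ℝ) : ℝ := (1 - r ^ 2) / (1 - 2 * r * k + r ^ 2)

/-- Imaginary part of `(1 + ω) / (1 - ω)` for `ω = r (k + i l)`. -/
def cayleyIm (r k l : ℝ) : ℝ := 2 * r * l / (1 - 2 * r * k + r ^ 2)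

theorem cayley_den_pos {r k l : ℝ} (h0 : 0 < r) (h1 : r < 1) (hkl : k ^ 2 + l ^ 2 = 1) :
    0 < 1 - 2 * r * k + r ^ 2 := by
  have : k ≤ 1 := by nlinarith
  nlinarith [mul_le_mul_of_nonneg_left this h0.le]

theorem cayley_eq {r k l : ℝ} (h0 : 0 < r) (h1 : r < 1) (hkl : k ^ 2 + l ^ 2 = 1) :
    (⟨cayleyRe r k, cayleyIm r k l⟩ : ℂ) * (1 - ⟨r * k, r * l⟩) = 1 + ⟨r * k, r * l⟩ := by
  have := (cayley_den_pos h0 h1 hkl).ne'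
  simp only [cayleyRe, cayleyIm]
  generalize hD : 1 - 2 * r * k + r ^ 2 = D at this
  apply Complex.ext
  · simp
    field_simp
    rw [← hD]
    linear_combination (2 * r ^ 2) * hkl
  · simp
    field_simp
    rw [← hD]
    ring

/-- A convex combination of the difference in the disc and of the difference in the half-plane
vanishes only when the two points agree. -/
theorem eq_of_cayley_segment {r k l r' k' l' τ : ℝ} (h0 : 0 < r) (h1 : r < 1)
    (hkl : k ^ 2 + l ^ 2 = 1) (h0' : 0 < r') (h1' : r' < 1) (hkl' : k' ^ 2 + l' ^ 2 = 1)
    (τ0 : 0 ≤ τ) (τ1 : τ ≤ 1)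
    (e1 : (1 - τ) * (2 * (cayleyRe r k - cayleyRe r' k')) + τ * (r * k - r' * k') = 0)
    (e2 : (1 - τ) * (2 * (cayleyIm r k l - cayleyIm r' k' l')) + τ * (r * l - r' * l') = 0) :
    r * k = r' * k' ∧ r * l = r' * l' := by
  set ω : ℂ := ⟨r * k, r * l⟩ with hω
  set ω' : ℂ := ⟨r' * k', r' * l'⟩ with hω'
  set ζ : ℂ := ⟨cayleyRe r k, cayleyIm r k l⟩ with hζ
  set ζ' : ℂ := ⟨cayleyRe r' k', cayleyIm r' k' l'⟩ with hζ'
  have c := cayley_eq h0 h1 hkl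
  have c' := cayley_eq h0' h1' hkl'
  rw [← hω, ← hζ] at c
  rw [← hω', ← hζ'] at c'
  have e : (1 - (τ : ℂ)) * (2 * (ζ - ζ')) + τ * (ω - ω') = 0 := by
    apply Complex.ext
    · simpa [hω, hω', hζ, hζ'] using e1
    · simpa [hω, hω', hζ, hζ'] using e2
  -- The Cayley transform satisfies ζ − ζ' = 2 (ω − ω') / ((1 − ω)(1 − ω')). Clearing the
  -- denominators therefore leaves the common factor ω − ω'.
  have hprod : (ω - ω') * (4 * (1 - τ) + τ * ((1 - ω) * (1 - ω'))) = 0 := by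
    linear_combination (1 - ω) * (1 - ω') * e - 2 * (1 - (τ : ℂ)) * (1 - ω') * c +
      2 * (1 - (τ : ℂ)) * (1 - ω) * c'
  rcases mul_eq_zero.1 hprod with h | h
  · have h2 := sub_eq_zero.1 h
    exact ⟨congrArg Complex.re h2, congrArg Complex.im h2⟩
  -- Vanishing of the second factor would make τ (1 − ω)(1 − ω') the real number −4 (1 − τ) ≤ 0. But
  -- 1 − ω and 1 − ω' have positive real parts, and the product of two such numbers is never real
  -- and non-positive.
  · exfalso
    have re1 := congrArg Complex.re h
    have im1 := congrArg Complex.im h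
    simp [hω, hω'] at re1 im1
    have a : 0 < 1 - r * k := by
      have : k ≤ 1 := by nlinarith
      nlinarith
    have a' : 0 < 1 - r' * k' := by
      have : k' ≤ 1 := by nlinarith
      nlinarith
    rcases τ0.eq_or_lt with h | h
    · rw [← h] at re1; norm_num at re1
    · rcases im1 with im1 | im1
      · exact h.ne' im1
      · have b : (1 - r * k) * (r' * l') ^ 2 = - (1 - r' * k') * (r * l * (r' * l')) := by
          linear_combination (r' * l') * (-im1)
        have b2 : 0 ≤ - (r * l * (r' * l')) := by
          have : 0 ≤ (1 - r' * k') * (- (r * l * (r' * l'))) := by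
            have := mul_nonneg a.le (sq_nonneg (r' * l')); linarith
          exact nonneg_of_mul_nonneg_right this a'
        have b3 := mul_pos a a'
        nlinarith [mul_nonneg h.le b2, mul_pos h b3]

theorem TorusMap.cycle {X Y Z : ℝ → ℝ → ℝ} (h : TorusMap X Y Z) : TorusMap Y Z X :=
  ⟨h.mixedY, h.mixedZ, h.mixedX, h.perY, h.perZ, h.perX, fun s t => by linarith [h.pos s t]⟩

theorem TorusMap.swap {X Y Z : ℝ → ℝ → ℝ} (h : TorusMap X Y Z) : TorusMap Y X Z :=
  ⟨h.mixedY, h.mixedX, h.mixedZ, h.perY, h.perX, h.perZ, fun s t => by linarith [h.pos s t]⟩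

theorem TorusMap.neg_last {X Y Z : ℝ → ℝ → ℝ} (h : TorusMap X Y fun s t => -Z s t) :
    TorusMap X Y Z := by
  have e : Z = fun s t => - -Z s t := by simp
  refine ⟨h.mixedX, h.mixedY, ?_, h.perX, h.perY, ?_, fun s t => by simpa using h.pos s t⟩
  · rw [e]; exact h.mixedZ.neg
  · rw [e]; exact h.perZ.neg

theorem mapDegree_neg_eq_swap (X Y Z : ℝ → ℝ → ℝ) :
    mapDegree X Y (fun s t => -Z s t) = mapDegree X Z Y := by
  rw [mapDegree_neg, ← mapDegree_cycle X Z Y, ← mapDegree_cycle Z Y X, ← mapDegree_swap]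

/-! ### Splitting the degree into a crossing part and a winding part -/

section Chain

variable {c₁ s₁ r₁ k₁ l₁ c₂ s₂ r₂ k₂ l₂ : ℝ → ℝ}

theorem cos_eq_of_sin_eq_zero {C S : ℝ} (hCS : C ^ 2 + S ^ 2 = 1) (hS : S = 0) :
    C = 1 ∨ C = -1 := by
  rw [hS] at hCS
  have : (C - 1) * (C + 1) = 0 := by linear_combination hCS
  rcases mul_eq_zero.1 this with h | h
  · left; linarith
  · right; linarith

theorem blend_of_one {C X Y : ℝ → ℝ → ℝ} {s t : ℝ} (h : C s t = 1) : blend C X Y s t = X s t := by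
  rw [blend, h, Real.smoothTransition.one, Real.smoothTransition.zero_of_nonpos (by norm_num)]
  ring

theorem blend_of_neg_one {C X Y : ℝ → ℝ → ℝ} {s t : ℝ} (h : C s t = -1) :
    blend C X Y s t = Y s t := by
  rw [blend, h, neg_neg, Real.smoothTransition.one,
    Real.smoothTransition.zero_of_nonpos (by norm_num)]
  ring

theorem MixedC1.blend_coords (h₁ : TorusCoords c₁ s₁ r₁ k₁ l₁) (h₂ : TorusCoords c₂ s₂ r₂ k₂ l₂)
    {X Y : ℝ → ℝ → ℝ} (mX : MixedC1 X) (mY : MixedC1 Y) :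
    MixedC1 (TorusDiagram.blend (TorusDiagram.cosDiff c₁ s₁ c₂ s₂) X Y) :=
  (MixedC1.cosDiff h₁.dc h₁.ds h₂.dc h₂.ds).blend mX mY

theorem TorusMap.blend_coords (h₁ : TorusCoords c₁ s₁ r₁ k₁ l₁) (h₂ : TorusCoords c₂ s₂ r₂ k₂ l₂)
    {X₁ X₂ Y₁ Y₂ : ℝ → ℝ → ℝ}
    (m₁ : MixedC1 X₁) (m₂ : MixedC1 X₂) (n₁ : MixedC1 Y₁) (n₂ : MixedC1 Y₂)
    (b₁ : Biperiodic X₁) (b₂ : Biperiodic X₂) (d₁ : Biperiodic Y₁) (d₂ : Biperiodic Y₂)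
    (hX : ∀ s t, cosDiff c₁ s₁ c₂ s₂ s t = 1 → X₁ s t = 0 → X₂ s t = 0 → False)
    (hY : ∀ s t, cosDiff c₁ s₁ c₂ s₂ s t = -1 → Y₁ s t = 0 → Y₂ s t = 0 → False) :
    TorusMap (TorusDiagram.blend (cosDiff c₁ s₁ c₂ s₂) X₁ Y₁)
      (TorusDiagram.blend (cosDiff c₁ s₁ c₂ s₂) X₂ Y₂) (sinDiff c₁ s₁ c₂ s₂) :=
  TorusMap.blend (MixedC1.cosDiff h₁.dc h₁.ds h₂.dc h₂.ds) (MixedC1.sinDiff h₁.dc h₁.ds h₂.dc h₂.ds)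
    (Biperiodic.cosDiff h₁.pc h₁.ps h₂.pc h₂.ps) (Biperiodic.sinDiff h₁.pc h₁.ps h₂.pc h₂.ps)
    (cosDiff_sq_add_sinDiff_sq h₁.cs h₂.cs) m₁ m₂ n₁ n₂ b₁ b₂ d₁ d₂ hX hY

/-- The difference of the real parts of the disc coordinates. -/
def discRe (r₁ k₁ r₂ k₂ : ℝ → ℝ) (s t : ℝ) : ℝ := r₁ s * k₁ s - r₂ t * k₂ t

theorem MixedC1.discRe (h1 : ContDiff ℝ 1 r₁) (h2 : ContDiff ℝ 1 k₁) (h3 : ContDiff ℝ 1 r₂)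
    (h4 : ContDiff ℝ 1 k₂) : MixedC1 (discRe r₁ k₁ r₂ k₂) :=
  ((ofFst h1).mul (ofFst h2)).sub ((ofSnd h3).mul (ofSnd h4))

theorem Biperiodic.discRe (h1 : ∀ x, r₁ (x + 1) = r₁ x) (h2 : ∀ x, k₁ (x + 1) = k₁ x)
    (h3 : ∀ x, r₂ (x + 1) = r₂ x) (h4 : ∀ x, k₂ (x + 1) = k₂ x) :
    Biperiodic (discRe r₁ k₁ r₂ k₂) :=
  ((ofFst h1).mul (ofFst h2)).sub ((ofSnd h3).mul (ofSnd h4))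

/-- The winding contribution to the degree: the part of it that only depends on the homotopy types
of the projections of the two loops. -/
def windingDegree (c₁ s₁ c₂ s₂ r₂ k₂ l₂ : ℝ → ℝ) : ℝ :=
  mapDegree (blend (cosDiff c₁ s₁ c₂ s₂) (fun _ _ => 1) fun _ t => -(r₂ t * k₂ t))
    (blend (cosDiff c₁ s₁ c₂ s₂) (fun _ _ => 0) fun _ t => -(r₂ t * l₂ t)) (sinDiff c₁ s₁ c₂ s₂)

/-- The last coordinate of the crossing map. It is positive at the crossings where the first strand
is over, and negative at those where it is under and at the points with opposite horizontal
angles. -/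
def crossingHeight (c₁ s₁ r₁ k₁ l₁ c₂ s₂ r₂ k₂ l₂ : ℝ → ℝ) : ℝ → ℝ → ℝ :=
  blend (cosDiff c₁ s₁ c₂ s₂) (fun s t => r₁ s * cosDiff k₁ l₁ k₂ l₂ s t - r₂ t) fun _ t => -r₂ t

/-- The degree of the map whose zeros in the first two coordinates are the crossings. -/
def crossingDegree (c₁ s₁ r₁ k₁ l₁ c₂ s₂ r₂ k₂ l₂ : ℝ → ℝ) : ℝ :=
  mapDegree (sinDiff k₁ l₁ k₂ l₂) (sinDiff c₁ s₁ c₂ s₂)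
    (crossingHeight c₁ s₁ r₁ k₁ l₁ c₂ s₂ r₂ k₂ l₂)

theorem torusMap_winding (h₁ : TorusCoords c₁ s₁ r₁ k₁ l₁) (h₂ : TorusCoords c₂ s₂ r₂ k₂ l₂) :
    TorusMap (blend (cosDiff c₁ s₁ c₂ s₂) (fun _ _ => 1) fun _ t => -(r₂ t * k₂ t))
    (blend (cosDiff c₁ s₁ c₂ s₂) (fun _ _ => 0) fun _ t => -(r₂ t * l₂ t))
    (sinDiff c₁ s₁ c₂ s₂) := by
  refine .blend_coords h₁ h₂ (.const 1) (.const 0) (.neg (.mul (.ofSnd h₂.dr) (.ofSnd h₂.dk)))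
    (.neg (.mul (.ofSnd h₂.dr) (.ofSnd h₂.dl))) (.const 1) (.const 0)
    (.neg (.mul (.ofSnd h₂.pr) (.ofSnd h₂.pk))) (.neg (.mul (.ofSnd h₂.pr) (.ofSnd h₂.pl)))
    (fun s t _ h _ => one_ne_zero h) fun s t _ e1 e2 => ?_
  have h3 := h₂.kl t
  have h4 := (h₂.r_pos t).ne'
  simp only [neg_eq_zero, mul_eq_zero, h4, false_or] at e1 e2
  rw [e1, e2] at h3
  norm_num at h3

/-- For opposite horizontal angles the height is −r₂ < 0. For equal ones, a vanishing vertical sine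
leaves two cases: opposite vertical angles, with height −r₁ − r₂ < 0, or equal ones, where height
zero means equal radii and hence a common point of the loops. -/
theorem crossingHeight_cases (h₁ : TorusCoords c₁ s₁ r₁ k₁ l₁) (h₂ : TorusCoords c₂ s₂ r₂ k₂ l₂)
    (hdis : ∀ s t, cosDiff c₁ s₁ c₂ s₂ s t = 1 → r₁ s * k₁ s = r₂ t * k₂ t →
      r₁ s * l₁ s = r₂ t * l₂ t → False) {s t : ℝ}
    (hS : sinDiff c₁ s₁ c₂ s₂ s t = 0)
    (hH : crossingHeight c₁ s₁ r₁ k₁ l₁ c₂ s₂ r₂ k₂ l₂ s t = 0) :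
    cosDiff c₁ s₁ c₂ s₂ s t = 1 ∧ sinDiff k₁ l₁ k₂ l₂ s t ≠ 0 := by
  rcases cos_eq_of_sin_eq_zero (cosDiff_sq_add_sinDiff_sq h₁.cs h₂.cs s t) hS with hC | hC
  · refine ⟨hC, fun hz => ?_⟩
    rw [crossingHeight, blend_of_one hC] at hH
    have hr := h₁.r_pos s
    have hr' := h₂.r_pos t
    rcases cos_eq_of_sin_eq_zero (cosDiff_sq_add_sinDiff_sq h₁.kl h₂.kl s t) hz with hk | hk
    · rw [hk] at hH
      have hrr : r₁ s = r₂ t := by linarith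
      have hk1 : k₁ s = k₂ t := by
        simp only [cosDiff, sinDiff] at hk hz
        linear_combination (-k₁ s) * h₂.kl t + k₂ t * hk - l₂ t * hz
      have hl1 : l₁ s = l₂ t := by
        simp only [cosDiff, sinDiff] at hk hz
        linear_combination (-l₁ s) * h₂.kl t + l₂ t * hk + k₂ t * hz
      exact hdis s t hC (by rw [hrr, hk1]) (by rw [hrr, hl1])
    · rw [hk] at hH
      linarith
  · rw [crossingHeight, blend_of_neg_one hC] at hH
    linarith [h₂.r_pos t]

theorem torusMap_crossing (h₁ : TorusCoords c₁ s₁ r₁ k₁ l₁) (h₂ : TorusCoords c₂ s₂ r₂ k₂ l₂)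
    (hdis : ∀ s t, cosDiff c₁ s₁ c₂ s₂ s t = 1 → r₁ s * k₁ s = r₂ t * k₂ t →
      r₁ s * l₁ s = r₂ t * l₂ t → False) :
    TorusMap (sinDiff k₁ l₁ k₂ l₂) (sinDiff c₁ s₁ c₂ s₂)
      (crossingHeight c₁ s₁ r₁ k₁ l₁ c₂ s₂ r₂ k₂ l₂) := by
  refine ⟨.sinDiff h₁.dk h₁.dl h₂.dk h₂.dl, .sinDiff h₁.dc h₁.ds h₂.dc h₂.ds,
    .blend_coords h₁ h₂ (.sub (.mul (.ofFst h₁.dr) (.cosDiff h₁.dk h₁.dl h₂.dk h₂.dl))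
      (.ofSnd h₂.dr)) (.neg (.ofSnd h₂.dr)), .sinDiff h₁.pk h₁.pl h₂.pk h₂.pl,
    .sinDiff h₁.pc h₁.ps h₂.pc h₂.ps, .blend (.cosDiff h₁.pc h₁.ps h₂.pc h₂.ps)
    (.sub (.mul (.ofFst h₁.pr) (.cosDiff h₁.pk h₁.pl h₂.pk h₂.pl)) (.ofSnd h₂.pr))
    (.neg (.ofSnd h₂.pr)), fun s t => ?_⟩
  by_contra hc
  exact (crossingHeight_cases h₁ h₂ hdis (s := s) (t := t) (by nlinarith) (by nlinarith)).2
    (by nlinarith)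

/-- A rotation by minus the vertical angle of the second strand depends on t only, so it preserves
the degree. It turns ω₁ − ω₂ into r₁ exp(iΔ) − r₂, with Δ the vertical angle difference, and −ω₂
into −r₂. The real part is then `crossingHeight`; the imaginary part is sin Δ up to a factor that is
positive wherever the other two coordinates vanish. -/
theorem mapDegree_blend_disc (h₁ : TorusCoords c₁ s₁ r₁ k₁ l₁) (h₂ : TorusCoords c₂ s₂ r₂ k₂ l₂)
    (hdis : ∀ s t, cosDiff c₁ s₁ c₂ s₂ s t = 1 → r₁ s * k₁ s = r₂ t * k₂ t →
      r₁ s * l₁ s = r₂ t * l₂ t → False) :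
    TorusMap (blend (cosDiff c₁ s₁ c₂ s₂) (discRe r₁ k₁ r₂ k₂) fun _ t => -(r₂ t * k₂ t))
      (blend (cosDiff c₁ s₁ c₂ s₂) (discRe r₁ l₁ r₂ l₂) fun _ t => -(r₂ t * l₂ t))
      (sinDiff c₁ s₁ c₂ s₂) ∧
    mapDegree (blend (cosDiff c₁ s₁ c₂ s₂) (discRe r₁ k₁ r₂ k₂) fun _ t => -(r₂ t * k₂ t))
      (blend (cosDiff c₁ s₁ c₂ s₂) (discRe r₁ l₁ r₂ l₂) fun _ t => -(r₂ t * l₂ t))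
      (sinDiff c₁ s₁ c₂ s₂) = crossingDegree c₁ s₁ r₁ k₁ l₁ c₂ s₂ r₂ k₂ l₂ := by
  have h0 : TorusMap (blend (cosDiff c₁ s₁ c₂ s₂) (discRe r₁ k₁ r₂ k₂) fun _ t => -(r₂ t * k₂ t))
      (blend (cosDiff c₁ s₁ c₂ s₂) (discRe r₁ l₁ r₂ l₂) fun _ t => -(r₂ t * l₂ t))
      (sinDiff c₁ s₁ c₂ s₂) := by
    refine .blend_coords h₁ h₂ (.discRe h₁.dr h₁.dk h₂.dr h₂.dk) (.discRe h₁.dr h₁.dl h₂.dr h₂.dl)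
      (.neg (.mul (.ofSnd h₂.dr) (.ofSnd h₂.dk)))
      (.neg (.mul (.ofSnd h₂.dr) (.ofSnd h₂.dl))) (.discRe h₁.pr h₁.pk h₂.pr h₂.pk)
      (.discRe h₁.pr h₁.pl h₂.pr h₂.pl)
      (.neg (.mul (.ofSnd h₂.pr) (.ofSnd h₂.pk))) (.neg (.mul (.ofSnd h₂.pr) (.ofSnd h₂.pl)))
      (fun s t hC e1 e2 => hdis s t hC (sub_eq_zero.1 e1) (sub_eq_zero.1 e2)) fun s t _ e1 e2 => ?_
    have h3 := h₂.kl t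
    have h4 := (h₂.r_pos t).ne'
    simp only [neg_eq_zero, mul_eq_zero, h4, false_or] at e1 e2
    rw [e1, e2] at h3
    norm_num at h3
  refine ⟨h0, ?_⟩
  obtain ⟨t1, d1⟩ := mapDegree_rotate h0 h₂.dk h₂.dl.neg h₂.pk (fun t => by simp [h₂.pl t])
    (fun t => by simpa using h₂.kl t)
  rw [← d1]
  have eX : (fun s t => k₂ t * blend (cosDiff c₁ s₁ c₂ s₂) (discRe r₁ k₁ r₂ k₂)
      (fun _ t => -(r₂ t * k₂ t)) s t - -l₂ t * blend (cosDiff c₁ s₁ c₂ s₂) (discRe r₁ l₁ r₂ l₂)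
      (fun _ t => -(r₂ t * l₂ t)) s t) = crossingHeight c₁ s₁ r₁ k₁ l₁ c₂ s₂ r₂ k₂ l₂ := by
    ext s t
    have := h₂.kl t
    simp only [blend, crossingHeight, discRe, cosDiff]
    linear_combination (-r₂ t) * (Real.smoothTransition (c₁ s * c₂ t + s₁ s * s₂ t) +
      Real.smoothTransition (-(c₁ s * c₂ t + s₁ s * s₂ t))) * this
  have eY : (fun s t => -l₂ t * blend (cosDiff c₁ s₁ c₂ s₂) (discRe r₁ k₁ r₂ k₂)
      (fun _ t => -(r₂ t * k₂ t)) s t + k₂ t * blend (cosDiff c₁ s₁ c₂ s₂) (discRe r₁ l₁ r₂ l₂)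
      (fun _ t => -(r₂ t * l₂ t)) s t) = fun s t => Real.smoothTransition (cosDiff c₁ s₁ c₂ s₂ s t) *
      r₁ s * sinDiff k₁ l₁ k₂ l₂ s t := by
    ext s t
    simp only [blend, discRe, sinDiff]
    ring
  rw [eX, eY] at t1 ⊢
  rw [← mapDegree_cycle]
  -- The segment removes the factor in front of sin Δ: zeros of the other coordinates force equal
  -- horizontal angles, where that factor is r₁ > 0.
  refine mapDegree_eq_of_segment t1.cycle (torusMap_crossing h₁ h₂ hdis)
    fun k k0 k1 s t e1 e2 e3 => ?_
  simp only [sub_self, mul_zero, add_zero] at e2 e3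
  obtain ⟨hC, hz⟩ := crossingHeight_cases h₁ h₂ hdis e2 e3
  rw [hC, Real.smoothTransition.one] at e1
  have : ((1 - k) * r₁ s + k) * sinDiff k₁ l₁ k₂ l₂ s t = 0 := by linear_combination e1
  have h3 : 0 < (1 - k) * r₁ s + k := by nlinarith [h₁.r_pos s]
  exact (mul_ne_zero h3.ne' hz) this

/-- The difference in the half-plane can be deformed to ω₁ − ω₂ where C = 1 and to (−1, 0) where C =
−1. Then (−1, 0) is exchanged for −ω₂ by `mapDegree_blend_add`. The partner in this exchange has the
constant (1, 0) on the front half: it passes from `windingDegree` to a map with vanishing second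
coordinate, of degree zero. -/
theorem mapDegree_cayley (h₁ : TorusCoords c₁ s₁ r₁ k₁ l₁) (h₂ : TorusCoords c₂ s₂ r₂ k₂ l₂)
    (hdis : ∀ s t, cosDiff c₁ s₁ c₂ s₂ s t = 1 → r₁ s * k₁ s = r₂ t * k₂ t →
      r₁ s * l₁ s = r₂ t * l₂ t → False)
    (ht : TorusMap (fun s t => 2 * (cayleyRe (r₁ s) (k₁ s) * cosDiff c₁ s₁ c₂ s₂ s t -
        cayleyRe (r₂ t) (k₂ t)))
      (fun s t => 2 * (cayleyIm (r₁ s) (k₁ s) (l₁ s) - cayleyIm (r₂ t) (k₂ t) (l₂ t)))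
      fun s t => 2 * (cayleyRe (r₁ s) (k₁ s) * sinDiff c₁ s₁ c₂ s₂ s t)) :
    mapDegree (fun s t => 2 * (cayleyRe (r₁ s) (k₁ s) * cosDiff c₁ s₁ c₂ s₂ s t -
        cayleyRe (r₂ t) (k₂ t)))
      (fun s t => 2 * (cayleyIm (r₁ s) (k₁ s) (l₁ s) - cayleyIm (r₂ t) (k₂ t) (l₂ t)))
      (fun s t => 2 * (cayleyRe (r₁ s) (k₁ s) * sinDiff c₁ s₁ c₂ s₂ s t)) =
    crossingDegree c₁ s₁ r₁ k₁ l₁ c₂ s₂ r₂ k₂ l₂ - windingDegree c₁ s₁ c₂ s₂ r₂ k₂ l₂ := by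
  have mC := MixedC1.cosDiff h₁.dc h₁.ds h₂.dc h₂.ds
  have m1 := MixedC1.discRe h₁.dr h₁.dk h₂.dr h₂.dk
  have m2 := MixedC1.discRe h₁.dr h₁.dl h₂.dr h₂.dl
  have n1 := MixedC1.neg (.mul (.ofSnd h₂.dr) (.ofSnd h₂.dk))
  have n2 := MixedC1.neg (.mul (.ofSnd h₂.dr) (.ofSnd h₂.dl))
  have b1 := Biperiodic.discRe h₁.pr h₁.pk h₂.pr h₂.pk
  have b2 := Biperiodic.discRe h₁.pr h₁.pl h₂.pr h₂.pl
  have u1 : TorusMap (blend (cosDiff c₁ s₁ c₂ s₂) (discRe r₁ k₁ r₂ k₂) fun _ _ => -1)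
      (blend (cosDiff c₁ s₁ c₂ s₂) (discRe r₁ l₁ r₂ l₂) fun _ _ => 0) (sinDiff c₁ s₁ c₂ s₂) :=
    .blend_coords h₁ h₂ m1 m2 (.const (-1)) (.const 0) b1 b2 (.const (-1)) (.const 0)
      (fun s t hC e1 e2 => hdis s t hC (sub_eq_zero.1 e1) (sub_eq_zero.1 e2))
      fun s t _ e1 _ => by norm_num at e1
  have u2 : TorusMap (blend (cosDiff c₁ s₁ c₂ s₂) (fun _ _ => 1) fun _ _ => -1)
      (blend (cosDiff c₁ s₁ c₂ s₂) (fun _ _ => 0) fun _ _ => 0) (sinDiff c₁ s₁ c₂ s₂) :=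
    .blend_coords h₁ h₂ (.const 1) (.const 0) (.const (-1)) (.const 0) (.const 1) (.const 0)
      (.const (-1)) (.const 0) (fun s t _ e1 _ => by norm_num at e1)
      fun s t _ e1 _ => by norm_num at e1
  obtain ⟨u3, e3⟩ := mapDegree_blend_disc h₁ h₂ hdis
  have hadd := mapDegree_blend_add mC m1 m2 (.const (-1)) (.const 0) (.const 1) (.const 0) n1 n2
    u1 (torusMap_winding h₁ h₂) u3 u2
  have hz : mapDegree (blend (cosDiff c₁ s₁ c₂ s₂) (fun _ _ => 1) fun _ _ => -1)
      (blend (cosDiff c₁ s₁ c₂ s₂) (fun _ _ => 0) fun _ _ => 0) (sinDiff c₁ s₁ c₂ s₂) = 0 := by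
    have : blend (cosDiff c₁ s₁ c₂ s₂) (fun _ _ => 0) (fun _ _ => 0) = fun _ _ => 0 := by
      ext s t; simp [blend]
    rw [this]
    exact mapDegree_eq_zero_of_snd
  rw [hz, e3, add_zero] at hadd
  rw [windingDegree, ← hadd, add_sub_cancel_right]
  -- A zero on the segment has C = ±1. For C = 1 the convexity statement `eq_of_cayley_segment`
  -- gives a common point of the loops; for C = −1 the first coordinate is negative at both ends of
  -- the segment.
  refine mapDegree_eq_of_segment ht u1 fun κ κ0 κ1 s t e1 e2 e3 => ?_
  have p1 : 0 < cayleyRe (r₁ s) (k₁ s) :=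
    div_pos (by nlinarith [h₁.r_pos s, h₁.r_lt s])
      (cayley_den_pos (h₁.r_pos s) (h₁.r_lt s) (h₁.kl s))
  have p2 : 0 < cayleyRe (r₂ t) (k₂ t) :=
    div_pos (by nlinarith [h₂.r_pos t, h₂.r_lt t])
      (cayley_den_pos (h₂.r_pos t) (h₂.r_lt t) (h₂.kl t))
  have hS : sinDiff c₁ s₁ c₂ s₂ s t = 0 := by
    have h3 : (2 * (1 - κ) * cayleyRe (r₁ s) (k₁ s) + κ) * sinDiff c₁ s₁ c₂ s₂ s t = 0 := by
      linear_combination e3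
    exact (mul_eq_zero.1 h3).resolve_left (by nlinarith)
  rcases cos_eq_of_sin_eq_zero (cosDiff_sq_add_sinDiff_sq h₁.cs h₂.cs s t) hS with hC | hC
  · rw [blend_of_one hC] at e1 e2
    simp only [hC, discRe] at e1 e2
    obtain ⟨a, b⟩ := eq_of_cayley_segment (h₁.r_pos s) (h₁.r_lt s) (h₁.kl s) (h₂.r_pos t)
      (h₂.r_lt t) (h₂.kl t) κ0.le κ1.le (by linear_combination e1) (by linear_combination e2)
    exact hdis s t hC a b
  · rw [blend_of_neg_one hC] at e1
    simp only [hC] at e1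
    nlinarith

end Chain

/-! ### Loops seen from a pole on the front core circle -/

/-- The norm of the horizontal part of a point. -/
def horizontalNorm (x : E4) : ℝ := √(x 0 ^ 2 + x 1 ^ 2)

/-- The norm of the vertical part of a point. -/
def verticalNorm (x : E4) : ℝ := √(x 2 ^ 2 + x 3 ^ 2)

/-- The radius of a point in the disc: a decreasing function of its depth. -/
def discRadius (x : E4) : ℝ := verticalNorm x / (1 + horizontalNorm x)

theorem horizontalNorm_sq_add (x : E4) (hx : ‖x‖ = 1) :
    horizontalNorm x ^ 2 + verticalNorm x ^ 2 = 1 := by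
  rw [horizontalNorm, verticalNorm, Real.sq_sqrt (by positivity), Real.sq_sqrt (by positivity)]
  have := norm_sq_eq_sum x
  rw [hx] at this
  linarith

theorem torusCoords_of_loop {L : ℝ → E4} (hL : IsC1Loop L) (hh : ∀ s, 0 < horizontalNorm (L s))
    (hv : ∀ s, 0 < verticalNorm (L s)) :
    TorusCoords (fun s => L s 0 / horizontalNorm (L s)) (fun s => L s 1 / horizontalNorm (L s))
      (fun s => discRadius (L s)) (fun s => L s 2 / verticalNorm (L s))
      (fun s => -L s 3 / verticalNorm (L s)) := by
  have hi : ∀ i : Fin 4, ContDiff ℝ 1 fun s => L s i := fun i => contDiff_euclidean.1 hL.contDiff i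
  have dh : ContDiff ℝ 1 fun s => horizontalNorm (L s) :=
    (((hi 0).pow 2).add ((hi 1).pow 2)).sqrt fun s => (Real.sqrt_pos.1 (hh s)).ne'
  have dv : ContDiff ℝ 1 fun s => verticalNorm (L s) :=
    (((hi 2).pow 2).add ((hi 3).pow 2)).sqrt fun s => (Real.sqrt_pos.1 (hv s)).ne'
  have n1 := fun s => horizontalNorm_sq_add (L s) (hL.norm_eq_one s)
  have e1 : ∀ s, horizontalNorm (L s) ^ 2 = L s 0 ^ 2 + L s 1 ^ 2 := fun s =>
    Real.sq_sqrt (by positivity)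
  have e2 : ∀ s, verticalNorm (L s) ^ 2 = L s 2 ^ 2 + L s 3 ^ 2 := fun s =>
    Real.sq_sqrt (by positivity)
  refine ⟨(hi 0).div dh fun s => (hh s).ne', (hi 1).div dh fun s => (hh s).ne',
    dv.div (contDiff_const.add dh) fun s => by linarith [hh s], (hi 2).div dv fun s => (hv s).ne',
    (hi 3).neg.div dv fun s => (hv s).ne', ?_, ?_, ?_, ?_, ?_, fun s => ?_, fun s => ?_,
    fun s => div_pos (hv s) (by linarith [hh s]), fun s => ?_⟩
  iterate 5 exact fun s => by simp only [hL.periodic s]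
  · have := (hh s).ne'
    rw [div_pow, div_pow, ← add_div, ← e1, div_self (pow_ne_zero 2 this)]
  · have := (hv s).ne'
    rw [div_pow, div_pow, ← add_div, neg_sq, ← e2, div_self (pow_ne_zero 2 this)]
  · rw [discRadius, div_lt_one (by linarith [hh s])]
    nlinarith [hh s, n1 s]

/-- The pole that lies on the front core circle. -/
def frontPole : E4 := !₂[0, 0, 1, 0]

theorem inner_frontPole (x : E4) : inner ℝ frontPole x = x 2 := by
  rw [inner_eq_sum]; simp [frontPole]

theorem norm_frontPole : ‖frontPole‖ = 1 := by
  simp [EuclideanSpace.norm_eq, frontPole, Fin.sum_univ_four]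

/-- The Cayley transform of the disc coordinate is, up to scale and sign, the cylindrical coordinate
of the stereographic projection from `frontPole`: the distance from the axis and the position along
it. -/
theorem cayleyRe_loop {x : E4} (hx : ‖x‖ = 1) (hh : 0 < horizontalNorm x)
    (hv : 0 < verticalNorm x) :
    cayleyRe (discRadius x) (x 2 / verticalNorm x) = horizontalNorm x / (1 - x 2) ∧
    cayleyIm (discRadius x) (x 2 / verticalNorm x) (-x 3 / verticalNorm x) = -x 3 / (1 - x 2) ∧
      x 2 < 1 := by
  have n1 := horizontalNorm_sq_add x hx
  have e2 : verticalNorm x ^ 2 = x 2 ^ 2 + x 3 ^ 2 := Real.sq_sqrt (by positivity)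
  have hlt : x 2 < 1 := by nlinarith
  have h1 : 1 - x 2 ≠ 0 := by linarith
  have h2 : 1 + horizontalNorm x ≠ 0 := by linarith
  have hD : 1 - 2 * discRadius x * (x 2 / verticalNorm x) + discRadius x ^ 2 =
      2 * (1 - x 2) / (1 + horizontalNorm x) := by
    rw [discRadius]
    field_simp
    linear_combination n1
  have hN : 1 - discRadius x ^ 2 = 2 * horizontalNorm x / (1 + horizontalNorm x) := by
    rw [discRadius]
    field_simp
    linear_combination -n1
  refine ⟨?_, ?_, hlt⟩
  · rw [cayleyRe, hD, hN]; field_simp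
  · rw [cayleyIm, hD, discRadius]; field_simp

theorem eq_of_coords_eq {a b : E4} (ha : ‖a‖ = 1) (hb : ‖b‖ = 1) (hha : 0 < horizontalNorm a)
    (hva : 0 < verticalNorm a) (hhb : 0 < horizontalNorm b) (hvb : 0 < verticalNorm b)
    (hc : a 0 / horizontalNorm a * (b 0 / horizontalNorm b) +
      a 1 / horizontalNorm a * (b 1 / horizontalNorm b) = 1)
    (hk : discRadius a * (a 2 / verticalNorm a) = discRadius b * (b 2 / verticalNorm b))
    (hl : discRadius a * (-a 3 / verticalNorm a) = discRadius b * (-b 3 / verticalNorm b)) :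
    a = b := by
  have na := horizontalNorm_sq_add a ha
  have nb := horizontalNorm_sq_add b hb
  have ea1 : horizontalNorm a ^ 2 = a 0 ^ 2 + a 1 ^ 2 := Real.sq_sqrt (by positivity)
  have eb1 : horizontalNorm b ^ 2 = b 0 ^ 2 + b 1 ^ 2 := Real.sq_sqrt (by positivity)
  have ea2 : verticalNorm a ^ 2 = a 2 ^ 2 + a 3 ^ 2 := Real.sq_sqrt (by positivity)
  have eb2 : verticalNorm b ^ 2 = b 2 ^ 2 + b 3 ^ 2 := Real.sq_sqrt (by positivity)
  have pa : 0 < 1 + horizontalNorm a := by linarith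
  have pb : 0 < 1 + horizontalNorm b := by linarith
  simp only [discRadius] at hk hl
  field_simp at hc hk hl
  have hk' : a 2 * (1 + horizontalNorm b) = b 2 * (1 + horizontalNorm a) := by linarith
  have hl' : a 3 * (1 + horizontalNorm b) = b 3 * (1 + horizontalNorm a) := by linarith
  have hn : horizontalNorm a = horizontalNorm b := by
    have h1 : (a 2 ^ 2 + a 3 ^ 2) * (1 + horizontalNorm b) ^ 2 =
        (b 2 ^ 2 + b 3 ^ 2) * (1 + horizontalNorm a) ^ 2 := by
      linear_combination (a 2 * (1 + horizontalNorm b) + b 2 * (1 + horizontalNorm a)) * hk' +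
        (a 3 * (1 + horizontalNorm b) + b 3 * (1 + horizontalNorm a)) * hl'
    rw [← ea2, ← eb2] at h1
    have h2 : 2 * (1 + horizontalNorm a) * (1 + horizontalNorm b) *
        (horizontalNorm a - horizontalNorm b) = 0 := by
      linear_combination -h1 + (1 + horizontalNorm b) ^ 2 * na - (1 + horizontalNorm a) ^ 2 * nb
    have h3 := (mul_eq_zero.1 h2).resolve_left (by positivity)
    linarith
  rw [hn] at hk' hl' ea1 hc
  have e2 := mul_right_cancel₀ pb.ne' hk'
  have e3 := mul_right_cancel₀ pb.ne' hl'
  have hz : (a 0 - b 0) ^ 2 + (a 1 - b 1) ^ 2 = 0 := by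
    linear_combination -ea1 - eb1 - 2 * hc
  have e0 : a 0 = b 0 := sub_eq_zero.1 (pow_eq_zero_iff two_ne_zero |>.1
    (le_antisymm (by linarith [sq_nonneg (a 1 - b 1)]) (sq_nonneg (a 0 - b 0))))
  have e1 : a 1 = b 1 := sub_eq_zero.1 (pow_eq_zero_iff two_ne_zero |>.1
    (le_antisymm (by linarith [sq_nonneg (a 0 - b 0)]) (sq_nonneg (a 1 - b 1))))
  ext i
  fin_cases i
  · exact e0
  · exact e1
  · exact e2
  · exact e3

/-- The horizontal angle is the cylindrical angle about the image of the front core circle. Rotation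
about this axis by the angle of the second strand, which depends on t only, brings the difference
map into the form of `mapDegree_cayley`. -/
theorem linkDegree_frontPole {L₁ L₂ : ℝ → E4} (h₁ : IsC1Loop L₁) (h₂ : IsC1Loop L₂)
    (hne : ∀ s t, L₁ s ≠ L₂ t) (hh₁ : ∀ s, 0 < horizontalNorm (L₁ s))
    (hv₁ : ∀ s, 0 < verticalNorm (L₁ s)) (hh₂ : ∀ s, 0 < horizontalNorm (L₂ s))
    (hv₂ : ∀ s, 0 < verticalNorm (L₂ s)) :
    linkDegree frontPole L₁ L₂ =
      crossingDegree (fun s => L₁ s 0 / horizontalNorm (L₁ s))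
        (fun s => L₁ s 1 / horizontalNorm (L₁ s)) (fun s => discRadius (L₁ s))
        (fun s => L₁ s 2 / verticalNorm (L₁ s)) (fun s => -L₁ s 3 / verticalNorm (L₁ s))
        (fun s => L₂ s 0 / horizontalNorm (L₂ s)) (fun s => L₂ s 1 / horizontalNorm (L₂ s))
        (fun s => discRadius (L₂ s)) (fun s => L₂ s 2 / verticalNorm (L₂ s))
        (fun s => -L₂ s 3 / verticalNorm (L₂ s)) -
      windingDegree (fun s => L₁ s 0 / horizontalNorm (L₁ s))
        (fun s => L₁ s 1 / horizontalNorm (L₁ s)) (fun s => L₂ s 0 / horizontalNorm (L₂ s))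
        (fun s => L₂ s 1 / horizontalNorm (L₂ s)) (fun s => discRadius (L₂ s))
        (fun s => L₂ s 2 / verticalNorm (L₂ s)) (fun s => -L₂ s 3 / verticalNorm (L₂ s)) := by
  have t₁ := torusCoords_of_loop h₁ hh₁ hv₁
  have t₂ := torusCoords_of_loop h₂ hh₂ hv₂
  have n₁ := h₁.norm_eq_one
  have n₂ := h₂.norm_eq_one
  have y₁ := fun s => cayleyRe_loop (n₁ s) (hh₁ s) (hv₁ s)
  have y₂ := fun s => cayleyRe_loop (n₂ s) (hh₂ s) (hv₂ s)
  have p₁ : ∀ s, inner ℝ frontPole (L₁ s) < ‖frontPole‖ := fun s => by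
    rw [inner_frontPole, norm_frontPole]; exact (y₁ s).2.2
  have p₂ : ∀ s, inner ℝ frontPole (L₂ s) < ‖frontPole‖ := fun s => by
    rw [inner_frontPole, norm_frontPole]; exact (y₂ s).2.2
  have hI : ∀ x : E4, stereoCoord frameI frontPole x = 2 * x 3 / (1 - x 2) := fun x => by
    rw [stereoCoord, inner_frontPole, norm_frontPole, inner_frameI]; simp [frontPole]
  have hJ : ∀ x : E4, stereoCoord frameJ frontPole x = -(2 * x 0) / (1 - x 2) := fun x => by
    rw [stereoCoord, inner_frontPole, norm_frontPole, inner_frameJ]; simp [frontPole]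
  have hK : ∀ x : E4, stereoCoord frameK frontPole x = -(2 * x 1) / (1 - x 2) := fun x => by
    rw [stereoCoord, inner_frontPole, norm_frontPole, inner_frameK]; simp [frontPole]
  have hdis := fun s t hC e1 e2 => hne s t (eq_of_coords_eq (n₁ s) (n₂ t) (hh₁ s) (hv₁ s) (hh₂ t)
    (hv₂ t) hC e1 e2)
  have t0 := (torusMap_stereoDiff h₁ h₂ hne p₁ p₂).cycle
  -- The rotation angle is π minus the horizontal angle of the second strand. The half turn
  -- compensates the minus signs in the second and third frame coordinates seen from `frontPole`.
  obtain ⟨t1, d1⟩ := mapDegree_rotate t0 t₂.dc.neg t₂.ds (fun t => by simp only [t₂.pc t])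
    (fun t => by simp only [t₂.ps t]) (fun t => by rw [neg_sq]; exact t₂.cs t)
  have eX : (fun s t => -(L₂ t 0 / horizontalNorm (L₂ t)) * stereoDiff frameJ frontPole L₁ L₂ s t -
      L₂ t 1 / horizontalNorm (L₂ t) * stereoDiff frameK frontPole L₁ L₂ s t) = fun s t =>
      2 * (cayleyRe (discRadius (L₁ s)) (L₁ s 2 / verticalNorm (L₁ s)) *
        cosDiff (fun s => L₁ s 0 / horizontalNorm (L₁ s)) (fun s => L₁ s 1 / horizontalNorm (L₁ s))
        (fun s => L₂ s 0 / horizontalNorm (L₂ s)) (fun s => L₂ s 1 / horizontalNorm (L₂ s)) s t -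
        cayleyRe (discRadius (L₂ t)) (L₂ t 2 / verticalNorm (L₂ t))) := by
    ext s t
    have a1 : 1 - L₁ s 2 ≠ 0 := (sub_pos.2 (y₁ s).2.2).ne'
    have a2 : 1 - L₂ t 2 ≠ 0 := (sub_pos.2 (y₂ t).2.2).ne'
    have b1 := (hh₁ s).ne'
    have b2 := (hh₂ t).ne'
    have e : horizontalNorm (L₂ t) ^ 2 = L₂ t 0 ^ 2 + L₂ t 1 ^ 2 := Real.sq_sqrt (by positivity)
    rw [(y₁ s).1, (y₂ t).1]
    simp only [stereoDiff, hJ, hK, cosDiff]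
    field_simp
    linear_combination (1 - L₁ s 2) * e
  have eY : (fun s t => L₂ t 1 / horizontalNorm (L₂ t) * stereoDiff frameJ frontPole L₁ L₂ s t +
      -(L₂ t 0 / horizontalNorm (L₂ t)) * stereoDiff frameK frontPole L₁ L₂ s t) = fun s t =>
      2 * (cayleyRe (discRadius (L₁ s)) (L₁ s 2 / verticalNorm (L₁ s)) *
        sinDiff (fun s => L₁ s 0 / horizontalNorm (L₁ s)) (fun s => L₁ s 1 / horizontalNorm (L₁ s))
        (fun s => L₂ s 0 / horizontalNorm (L₂ s)) (fun s => L₂ s 1 / horizontalNorm (L₂ s))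
        s t) := by
    ext s t
    have a1 : 1 - L₁ s 2 ≠ 0 := (sub_pos.2 (y₁ s).2.2).ne'
    have a2 : 1 - L₂ t 2 ≠ 0 := (sub_pos.2 (y₂ t).2.2).ne'
    have b1 := (hh₁ s).ne'
    have b2 := (hh₂ t).ne'
    rw [(y₁ s).1]
    simp only [stereoDiff, hJ, hK, sinDiff]
    field_simp
    ring
  have eZ : stereoDiff frameI frontPole L₁ L₂ = fun s t => -(2 *
      (cayleyIm (discRadius (L₁ s)) (L₁ s 2 / verticalNorm (L₁ s)) (-L₁ s 3 / verticalNorm (L₁ s)) -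
      cayleyIm (discRadius (L₂ t)) (L₂ t 2 / verticalNorm (L₂ t))
        (-L₂ t 3 / verticalNorm (L₂ t)))) := by
    ext s t
    rw [(y₁ s).2.1, (y₂ t).2.1]
    simp only [stereoDiff, hI]
    ring
  rw [eX, eY, eZ] at t1 d1
  rw [linkDegree, eZ, ← mapDegree_cycle, ← d1, mapDegree_neg_eq_swap]
  exact mapDegree_cayley t₁ t₂ hdis t1.neg_last.cycle.cycle.swap

/-! ### The winding contribution -/

theorem cos_two_pi_int_mul_add (a : ℤ) (s u : ℝ) :
    Real.cos (2 * π * (a * (s + 1) + u)) = Real.cos (2 * π * (a * s + u)) := by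
  rw [← Real.cos_add_int_mul_two_pi (2 * π * (a * s + u)) a]; ring_nf

theorem sin_two_pi_int_mul_add (a : ℤ) (s u : ℝ) :
    Real.sin (2 * π * (a * (s + 1) + u)) = Real.sin (2 * π * (a * s + u)) := by
  rw [← Real.sin_add_int_mul_two_pi (2 * π * (a * s + u)) a]; ring_nf

theorem torusCoords_of_angles (a b : ℤ) {u v r : ℝ → ℝ} (hu : ContDiff ℝ 1 u)
    (hv : ContDiff ℝ 1 v) (hr : ContDiff ℝ 1 r) (pu : ∀ x, u (x + 1) = u x)
    (pv : ∀ x, v (x + 1) = v x) (pr : ∀ x, r (x + 1) = r x) (r0 : ∀ x, 0 < r x)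
    (r1 : ∀ x, r x < 1) :
    TorusCoords (fun s => Real.cos (2 * π * (a * s + u s))) (fun s => Real.sin (2 * π * (a * s + u s)))
      r (fun s => Real.cos (2 * π * (b * s + v s))) (fun s => Real.sin (2 * π * (b * s + v s))) := by
  refine ⟨by fun_prop, by fun_prop, hr, by fun_prop, by fun_prop, fun s => ?_, fun s => ?_, pr,
    fun s => ?_, fun s => ?_, fun s => Real.cos_sq_add_sin_sq _, fun s => Real.cos_sq_add_sin_sq _,
    r0, r1⟩
  · rw [pu, cos_two_pi_int_mul_add]
  · rw [pu, sin_two_pi_int_mul_add]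
  · rw [pv, cos_two_pi_int_mul_add]
  · rw [pv, sin_two_pi_int_mul_add]

theorem integral_periodic_comp_int_mul {f : ℝ → ℝ} (hf : Continuous f) (hp : ∀ x, f (x + 1) = f x)
    {a : ℤ} (ha : a ≠ 0) (c : ℝ) :
    ∫ s in (0 : ℝ)..1, f (a * s + c) = ∫ s in (0 : ℝ)..1, f s := by
  have ha' : (a : ℝ) ≠ 0 := Int.cast_ne_zero.2 ha
  have hP : Function.Periodic f 1 := hp
  rw [intervalIntegral.integral_comp_mul_add f ha' c]
  have h1 := hP.intervalIntegral_add_zsmul_eq a (a * 0 + c) (fun _ _ => hf.intervalIntegrable _ _)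
  rw [hP.intervalIntegral_add_eq _ 0] at h1
  simp only [zsmul_eq_mul, mul_one, mul_zero, zero_add] at h1 ⊢
  rw [add_comm c] at h1
  rw [h1, smul_eq_mul, inv_mul_cancel_left₀ ha']

/-- Cut-off function of an angle, supported on the half-circle around `0`. -/
def cutFront (x : ℝ) : ℝ := Real.smoothTransition (Real.cos x)

/-- Half the cut-off function of an angle that is supported on the half-circle around `π`. -/
def cutBack (x : ℝ) : ℝ := Real.smoothTransition (-Real.cos x) / 2

theorem contDiff_cutFront : ContDiff ℝ 1 cutFront :=
  Real.smoothTransition.contDiff.comp Real.contDiff_cos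

theorem contDiff_cutBack : ContDiff ℝ 1 cutBack :=
  (Real.smoothTransition.contDiff.comp Real.contDiff_cos.neg).div_const 2

theorem cutFront_eq_zero {x : ℝ} (h : Real.cos x ≤ 0) : cutFront x = 0 ∧ deriv cutFront x = 0 := by
  have h0 : cutFront x = 0 := Real.smoothTransition.zero_of_nonpos h
  refine ⟨h0, IsLocalMin.deriv_eq_zero (Filter.Eventually.of_forall fun y => ?_)⟩
  rw [h0]; exact Real.smoothTransition.nonneg _

theorem cutBack_eq_zero {x : ℝ} (h : 0 ≤ Real.cos x) : cutBack x = 0 ∧ deriv cutBack x = 0 := by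
  have h0 : cutBack x = 0 := by
    rw [cutBack, Real.smoothTransition.zero_of_nonpos (by linarith), zero_div]
  refine ⟨h0, IsLocalMin.deriv_eq_zero (Filter.Eventually.of_forall fun y => ?_)⟩
  rw [h0]; exact div_nonneg (Real.smoothTransition.nonneg _) two_pos.le

theorem cut_pos (x : ℝ) : 0 < cutFront x ^ 2 + cutBack x ^ 2 + Real.sin x ^ 2 := by
  by_contra hc
  have h1 : cutFront x = 0 := by nlinarith
  have h2 : cutBack x = 0 := by nlinarith
  have h3 : Real.sin x = 0 := by nlinarith
  rcases cos_eq_of_sin_eq_zero (Real.cos_sq_add_sin_sq x) h3 with h | h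
  · rw [cutFront, h, Real.smoothTransition.one] at h1; norm_num at h1
  · rw [cutBack, h, neg_neg, Real.smoothTransition.one] at h2; norm_num at h2

/-- The degree density of the model winding map, up to a constant. -/
def windingDensity (x : ℝ) : ℝ :=
  cutBack x * (deriv cutBack x * Real.sin x - cutBack x * Real.cos x) /
    √(cutFront x ^ 2 + cutBack x ^ 2 + Real.sin x ^ 2) ^ 3

theorem continuous_windingDensity : Continuous windingDensity := by
  have h1 := contDiff_cutFront.continuous
  have h2 := contDiff_cutBack.continuous
  have h3 := contDiff_cutBack.continuous_deriv le_rfl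
  exact Continuous.div (by fun_prop) (by fun_prop) fun x =>
    pow_ne_zero 3 (Real.sqrt_pos.2 (cut_pos x)).ne'

theorem cutBack_add_two_pi (x : ℝ) : cutBack (x + 2 * π) = cutBack x := by
  simp only [cutBack, Real.cos_add_two_pi]

theorem windingDensity_add_two_pi (x : ℝ) : windingDensity (x + 2 * π) = windingDensity x := by
  have h : deriv cutBack (x + 2 * π) = deriv cutBack x := by
    rw [← deriv_comp_add_const]
    simp only [cutBack_add_two_pi]
  simp only [windingDensity, cutBack_add_two_pi, h, cutFront, Real.cos_add_two_pi,
    Real.sin_add_two_pi]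

/-- On the half-circle cos x ≥ 0 the factor `cutBack` vanishes. On the other half `cutFront`
vanishes and −sin x / √(cutBack² + sin²) is a primitive, which runs from −1 to 1. The integral over
the circle is therefore 2, and rescaling to a unit interval divides it by 2π. -/
theorem integral_windingDensity :
    ∫ x in (0 : ℝ)..1, windingDensity (2 * π * x) = 1 / π := by
  have hP : Function.Periodic windingDensity (2 * π) := windingDensity_add_two_pi
  have hc := continuous_windingDensity
  have e1 : ∫ x in (0 : ℝ)..1, windingDensity (2 * π * x) =
      (2 * π)⁻¹ * ∫ x in (0 : ℝ)..(2 * π), windingDensity x := by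
    rw [intervalIntegral.integral_comp_mul_left _ (by positivity)]
    simp
  -- The period is started at π/2 so that the first half of it is the half-circle with non-positive
  -- cosine.
  have e2 := hP.intervalIntegral_add_eq 0 (π / 2)
  rw [zero_add] at e2
  rw [e1, e2, ← intervalIntegral.integral_add_adjacent_intervals (b := π / 2 + π)
    (hc.intervalIntegrable _ _) (hc.intervalIntegrable _ _)]
  have e3 : ∫ x in (π / 2 + π)..(π / 2 + 2 * π), windingDensity x = 0 := by
    rw [intervalIntegral.integral_congr (g := fun _ => 0), intervalIntegral.integral_zero]
    intro x hx
    rw [Set.uIcc_of_le (by linarith [Real.pi_pos])] at hx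
    have : 0 ≤ Real.cos x := by
      rw [← Real.cos_sub_two_pi]
      exact Real.cos_nonneg_of_mem_Icc ⟨by linarith [hx.1], by linarith [hx.2]⟩
    simp [windingDensity, (cutBack_eq_zero this).1]
  have hcos : ∀ x ∈ Set.uIcc (π / 2) (π / 2 + π), Real.cos x ≤ 0 := fun x hx => by
    rw [Set.uIcc_of_le (by linarith [Real.pi_pos])] at hx
    exact Real.cos_nonpos_of_pi_div_two_le_of_le hx.1 (by linarith [hx.2])
  have e4 : ∫ x in (π / 2)..(π / 2 + π), windingDensity x = 2 := by
    have hd : ∀ x ∈ Set.uIcc (π / 2) (π / 2 + π), HasDerivAt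
        (fun x => - (Real.sin x / √(cutFront x ^ 2 + cutBack x ^ 2 + Real.sin x ^ 2)))
        (windingDensity x) x := by
      intro x hx
      have h1 := (contDiff_cutFront.differentiable one_ne_zero x).hasDerivAt
      have h2 := (contDiff_cutBack.differentiable one_ne_zero x).hasDerivAt
      have h3 := Real.hasDerivAt_sin x
      obtain ⟨z1, z2⟩ := cutFront_eq_zero (hcos x hx)
      have hp := cut_pos x
      have hN := (((h1.pow 2).add (h2.pow 2)).add (h3.pow 2)).sqrt hp.ne'
      have hρ := (Real.sqrt_pos.2 hp).ne'
      have hsq := Real.sq_sqrt hp.le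
      refine (h3.div hN hρ).neg.congr_deriv ?_
      simp only [windingDensity, Pi.add_apply, Pi.pow_apply]
      generalize √(cutFront x ^ 2 + cutBack x ^ 2 + Real.sin x ^ 2) = ρ at hρ hsq
      rw [z1] at hsq ⊢
      rw [z2]
      field_simp
      rw [hsq]
      ring
    rw [intervalIntegral.integral_eq_sub_of_hasDerivAt hd (hc.intervalIntegrable _ _)]
    have a1 : Real.cos (π / 2) ≤ 0 := by simp
    have a2 : Real.cos (π / 2 + π) ≤ 0 := by rw [Real.cos_add_pi]; simp
    have b1 : 0 ≤ Real.cos (π / 2) := by simp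
    have b2 : 0 ≤ Real.cos (π / 2 + π) := by rw [Real.cos_add_pi]; simp
    rw [(cutFront_eq_zero a1).1, (cutFront_eq_zero a2).1, (cutBack_eq_zero b1).1,
      (cutBack_eq_zero b2).1, Real.sin_add_pi, Real.sin_pi_div_two]
    norm_num
  rw [e3, e4]
  field_simp
  norm_num

/-- The density is 4π²ab times a function of the horizontal angle difference 2π(as − a't) alone.
Integration in s absorbs the shift a't, so a' drops out and 4π²ab · (1/π) · 1/(4π) = ab remains. -/
theorem windingDegree_linear (a a' b : ℤ) :
    windingDegree (fun s => Real.cos (2 * π * (a * s))) (fun s => Real.sin (2 * π * (a * s)))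
      (fun s => Real.cos (2 * π * (a' * s))) (fun s => Real.sin (2 * π * (a' * s)))
      (fun _ => 1 / 2) (fun s => Real.cos (2 * π * (b * s))) (fun s => Real.sin (2 * π * (b * s))) =
    a * b := by
  have eC : cosDiff (fun s => Real.cos (2 * π * (a * s))) (fun s => Real.sin (2 * π * (a * s)))
      (fun s => Real.cos (2 * π * (a' * s))) (fun s => Real.sin (2 * π * (a' * s))) =
      fun s t => Real.cos (2 * π * (a * s - a' * t)) := by
    ext s t
    rw [mul_sub, Real.cos_sub]; rfl
  have eS : sinDiff (fun s => Real.cos (2 * π * (a * s))) (fun s => Real.sin (2 * π * (a * s)))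
      (fun s => Real.cos (2 * π * (a' * s))) (fun s => Real.sin (2 * π * (a' * s))) =
      fun s t => Real.sin (2 * π * (a * s - a' * t)) := by
    ext s t
    rw [mul_sub, Real.sin_sub]; rfl
  have eX : blend (fun s t => Real.cos (2 * π * (a * s - a' * t))) (fun _ _ => 1)
      (fun _ t => -(1 / 2 * Real.cos (2 * π * (b * t)))) = fun s t =>
      cutFront (2 * π * (a * s - a' * t)) -
        cutBack (2 * π * (a * s - a' * t)) * Real.cos (2 * π * (b * t)) := by
    ext s t
    simp only [blend, cutFront, cutBack]; ring
  have eY : blend (fun s t => Real.cos (2 * π * (a * s - a' * t))) (fun _ _ => 0)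
      (fun _ t => -(1 / 2 * Real.sin (2 * π * (b * t)))) = fun s t =>
      - (cutBack (2 * π * (a * s - a' * t)) * Real.sin (2 * π * (b * t))) := by
    ext s t
    simp only [blend, cutBack]; ring
  rw [windingDegree, eC, eS, eX, eY, mapDegree]
  have hdens : ∀ s t, degreeDensity (fun s t => cutFront (2 * π * (a * s - a' * t)) -
        cutBack (2 * π * (a * s - a' * t)) * Real.cos (2 * π * (b * t)))
      (fun s t => - (cutBack (2 * π * (a * s - a' * t)) * Real.sin (2 * π * (b * t))))
      (fun s t => Real.sin (2 * π * (a * s - a' * t))) s t =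
      4 * π ^ 2 * a * b * windingDensity (2 * π * (a * s - a' * t)) := by
    intro s t
    set θ := 2 * π * (a * s - a' * t) with hθ
    set ψ := 2 * π * (b * t) with hψ
    have d1 : HasDerivAt (fun s : ℝ => 2 * π * (a * s - a' * t)) (2 * π * a) s :=
      ((((hasDerivAt_id s).const_mul (a : ℝ)).sub_const _).const_mul (2 * π)).congr_deriv (by ring)
    have d2 : HasDerivAt (fun t : ℝ => 2 * π * (a * s - a' * t)) (-(2 * π * a')) t :=
      ((((hasDerivAt_id t).const_mul (a' : ℝ)).const_sub _).const_mul (2 * π)).congr_deriv (by ring)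
    have d3 : HasDerivAt (fun t : ℝ => 2 * π * (b * t)) (2 * π * b) t :=
      (((hasDerivAt_id t).const_mul (b : ℝ)).const_mul (2 * π)).congr_deriv (by ring)
    have f1 := (contDiff_cutFront.differentiable one_ne_zero θ).hasDerivAt
    have f2 := (contDiff_cutBack.differentiable one_ne_zero θ).hasDerivAt
    have g1 := f1.comp s d1
    have g2 := f2.comp s d1
    have g3 := (Real.hasDerivAt_sin θ).comp s d1
    have i1 := f1.comp t d2
    have i2 := f2.comp t d2
    have i3 := (Real.hasDerivAt_sin θ).comp t d2
    have j1 := (Real.hasDerivAt_cos ψ).comp t d3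
    have j2 := (Real.hasDerivAt_sin ψ).comp t d3
    have x1 : derivFst (fun s t => cutFront (2 * π * (a * s - a' * t)) -
        cutBack (2 * π * (a * s - a' * t)) * Real.cos (2 * π * (b * t))) s t =
        deriv cutFront θ * (2 * π * a) - deriv cutBack θ * (2 * π * a) * Real.cos ψ :=
      (g1.sub (g2.mul_const (Real.cos ψ))).deriv
    have x2 : derivFst (fun s t => - (cutBack (2 * π * (a * s - a' * t)) *
        Real.sin (2 * π * (b * t)))) s t = -(deriv cutBack θ * (2 * π * a) * Real.sin ψ) :=
      (g2.mul_const (Real.sin ψ)).neg.deriv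
    have x3 : derivFst (fun s t => Real.sin (2 * π * (a * s - a' * t))) s t =
        Real.cos θ * (2 * π * a) := g3.deriv
    have y1 : derivSnd (fun s t => cutFront (2 * π * (a * s - a' * t)) -
        cutBack (2 * π * (a * s - a' * t)) * Real.cos (2 * π * (b * t))) s t =
        deriv cutFront θ * (-(2 * π * a')) - (deriv cutBack θ * (-(2 * π * a')) * Real.cos ψ +
          cutBack θ * (-Real.sin ψ * (2 * π * b))) := (i1.sub (i2.mul j1)).deriv
    have y2 : derivSnd (fun s t => - (cutBack (2 * π * (a * s - a' * t)) *
        Real.sin (2 * π * (b * t)))) s t = -(deriv cutBack θ * (-(2 * π * a')) * Real.sin ψ +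
          cutBack θ * (Real.cos ψ * (2 * π * b))) := (i2.mul j2).neg.deriv
    have y3 : derivSnd (fun s t => Real.sin (2 * π * (a * s - a' * t))) s t =
        Real.cos θ * (-(2 * π * a')) := i3.deriv
    simp only [degreeDensity, x1, x2, x3, y1, y2, y3]
    rw [← hθ, ← hψ]
    have hψ1 := Real.cos_sq_add_sin_sq ψ
    rcases le_total (Real.cos θ) 0 with h | h
    · obtain ⟨z1, z2⟩ := cutFront_eq_zero h
      have hN : (cutFront θ - cutBack θ * Real.cos ψ) ^ 2 + (-(cutBack θ * Real.sin ψ)) ^ 2 +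
          Real.sin θ ^ 2 = cutFront θ ^ 2 + cutBack θ ^ 2 + Real.sin θ ^ 2 := by
        rw [z1]; linear_combination cutBack θ ^ 2 * hψ1
      rw [solidForm, hN, windingDensity, z1, z2, ← mul_div_assoc]
      congr 1
      simp only [tripleDet]
      linear_combination (4 * π ^ 2 * a * b * cutBack θ * (deriv cutBack θ * Real.sin θ -
        cutBack θ * Real.cos θ)) * hψ1
    · obtain ⟨z1, z2⟩ := cutBack_eq_zero h
      rw [solidForm, windingDensity, z1, z2]
      simp only [tripleDet]
      ring
  simp only [hdens]
  -- The substitution in s needs a ≠ 0; for a = 0 the density vanishes because of the factor a.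
  rcases eq_or_ne a 0 with rfl | ha
  · simp
  have hc : Continuous fun x => windingDensity (2 * π * x) :=
    continuous_windingDensity.comp (by fun_prop)
  rw [intervalIntegral_swap_of_continuous (f := fun s t =>
    4 * π ^ 2 * a * b * windingDensity (2 * π * (a * s - a' * t)))
    (continuous_const.mul (continuous_windingDensity.comp (by fun_prop)))]
  have hi : ∀ t : ℝ, ∫ s in (0 : ℝ)..1, 4 * π ^ 2 * a * b * windingDensity (2 * π * (a * s - a' * t)) =
      4 * π ^ 2 * a * b * (1 / π) := fun t => by
    rw [intervalIntegral.integral_const_mul, ← integral_windingDensity,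
      ← integral_periodic_comp_int_mul hc (fun x => ?_) ha (-(a' * t))]
    · simp only [← sub_eq_add_neg]
    · rw [mul_add, mul_one, windingDensity_add_two_pi]
  simp only [hi, intervalIntegral.integral_const, smul_eq_mul]
  field_simp
  ring

/-- The winding contribution, computed from the homotopy types of the projections. -/
theorem windingDegree_eq {c₁ s₁ c₂ s₂ r₂ k₂ l₂ : ℝ → ℝ} (a a' b : ℤ) {u u' v : ℝ → ℝ}
    (hu : ContDiff ℝ 1 u) (hu' : ContDiff ℝ 1 u') (hv : ContDiff ℝ 1 v) (hr : ContDiff ℝ 1 r₂)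
    (pu : ∀ x, u (x + 1) = u x) (pu' : ∀ x, u' (x + 1) = u' x) (pv : ∀ x, v (x + 1) = v x)
    (pr : ∀ x, r₂ (x + 1) = r₂ x) (r0 : ∀ x, 0 < r₂ x) (r1 : ∀ x, r₂ x < 1)
    (hc₁ : ∀ s, c₁ s = Real.cos (2 * π * (a * s + u s)))
    (hs₁ : ∀ s, s₁ s = Real.sin (2 * π * (a * s + u s)))
    (hc₂ : ∀ s, c₂ s = Real.cos (2 * π * (a' * s + u' s)))
    (hs₂ : ∀ s, s₂ s = Real.sin (2 * π * (a' * s + u' s)))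
    (hk₂ : ∀ s, k₂ s = Real.cos (2 * π * (b * s + v s)))
    (hl₂ : ∀ s, l₂ s = Real.sin (2 * π * (b * s + v s))) :
    windingDegree c₁ s₁ c₂ s₂ r₂ k₂ l₂ = a * b := by
  obtain rfl := funext hc₁
  obtain rfl := funext hs₁
  obtain rfl := funext hc₂
  obtain rfl := funext hs₂
  obtain rfl := funext hk₂
  obtain rfl := funext hl₂
  -- The homotopy shrinks the periodic parts of the angles to zero and moves the radius to 1/2,
  -- which ends at the linear model. The radius and vertical angle of the first loop do not enter
  -- `windingDegree`, so constants fill their places.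
  have h₁ : ∀ τ : unitInterval, TorusCoords (fun s => Real.cos (2 * π * (a * s + τ * u s)))
      (fun s => Real.sin (2 * π * (a * s + τ * u s))) (fun _ => 1 / 2)
      (fun s => Real.cos (2 * π * ((0 : ℤ) * s + (fun _ => (0 : ℝ)) s)))
      (fun s => Real.sin (2 * π * ((0 : ℤ) * s + (fun _ => (0 : ℝ)) s))) := fun τ =>
    torusCoords_of_angles a 0 (contDiff_const.mul hu) contDiff_const contDiff_const
      (fun x => by rw [pu]) (fun _ => rfl) (fun _ => rfl) (fun _ => by norm_num)
      fun _ => by norm_num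
  have hτ : ∀ (τ : unitInterval) x, (τ : ℝ) * r₂ x + (1 - τ) * (1 / 2) ∈ Set.Ioo (0 : ℝ) 1 :=
    fun τ x => (convex_Ioo (0 : ℝ) 1) ⟨r0 x, r1 x⟩ (y := 1 / 2) ⟨by norm_num, by norm_num⟩ τ.2.1
      (sub_nonneg.2 τ.2.2) (add_sub_cancel _ _)
  have h₂ : ∀ τ : unitInterval, TorusCoords (fun s => Real.cos (2 * π * (a' * s + τ * u' s)))
      (fun s => Real.sin (2 * π * (a' * s + τ * u' s))) (fun s => τ * r₂ s + (1 - τ) * (1 / 2))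
      (fun s => Real.cos (2 * π * (b * s + τ * v s)))
      (fun s => Real.sin (2 * π * (b * s + τ * v s))) := fun τ =>
    torusCoords_of_angles a' b (contDiff_const.mul hu') (contDiff_const.mul hv)
      ((contDiff_const.mul hr).add contDiff_const) (fun x => by rw [pu']) (fun x => by rw [pv])
      (fun x => by rw [pr]) (fun x => (hτ τ x).1) fun x => (hτ τ x).2
  have cu := hu.continuous
  have cu' := hu'.continuous
  have cv := hv.continuous
  have cr := hr.continuous
  have cst := Real.smoothTransition.continuous
  have h := mapDegree_eq_of_family (T := unitInterval) (fun τ => torusMap_winding (h₁ τ) (h₂ τ))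
    (by unfold blend cosDiff; fun_prop) (by unfold blend cosDiff; fun_prop)
    (by unfold sinDiff; fun_prop) 1 0
  have h0 := windingDegree_linear a a' b
  simp only [windingDegree] at h0 ⊢
  simpa only [Set.Icc.coe_zero, Set.Icc.coe_one, one_mul, zero_mul, add_zero, sub_self, sub_zero,
    zero_add, h0] using h

/-! ### A model map of degree one -/

theorem mapDegree_neg_mid (X Y Z : ℝ → ℝ → ℝ) :
    mapDegree X (fun s t => -Y s t) Z = - mapDegree X Y Z := by
  rw [mapDegree_cycle Z X, mapDegree_neg, ← mapDegree_cycle Z X]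

theorem mapDegree_neg_first (X Y Z : ℝ → ℝ → ℝ) :
    mapDegree (fun s t => -X s t) Y Z = - mapDegree X Y Z := by
  rw [← mapDegree_cycle _ Y, mapDegree_neg, mapDegree_cycle]

/-- `sin (2 π (x - a))`. -/
def sinAt (a x : ℝ) : ℝ := Real.sin (2 * π * (x - a))

/-- `cos (2 π (x - a))`. -/
def cosAt (a x : ℝ) : ℝ := Real.cos (2 * π * (x - a))

theorem contDiff_sinAt (a : ℝ) : ContDiff ℝ 1 (sinAt a) := by unfold sinAt; fun_prop

theorem contDiff_cosAt (a : ℝ) : ContDiff ℝ 1 (cosAt a) := by unfold cosAt; fun_prop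

theorem sinAt_add_one (a x : ℝ) : sinAt a (x + 1) = sinAt a x := by
  rw [sinAt, sinAt, ← Real.sin_add_two_pi (2 * π * (x - a))]; ring_nf

theorem cosAt_add_one (a x : ℝ) : cosAt a (x + 1) = cosAt a x := by
  rw [cosAt, cosAt, ← Real.cos_add_two_pi (2 * π * (x - a))]; ring_nf

theorem cosAt_sq_add_sinAt_sq (a x : ℝ) : cosAt a x ^ 2 + sinAt a x ^ 2 = 1 :=
  Real.cos_sq_add_sin_sq _

theorem cosAt_le_one (a x : ℝ) : cosAt a x ≤ 1 := Real.cos_le_one _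

theorem mixedC1_sinAt_fst (a : ℝ) : MixedC1 fun s _ => sinAt a s := .ofFst (contDiff_sinAt a)
theorem mixedC1_sinAt_snd (a : ℝ) : MixedC1 fun _ t => sinAt a t := .ofSnd (contDiff_sinAt a)
theorem mixedC1_cosAt_fst (a : ℝ) : MixedC1 fun s _ => cosAt a s := .ofFst (contDiff_cosAt a)
theorem mixedC1_cosAt_snd (a : ℝ) : MixedC1 fun _ t => cosAt a t := .ofSnd (contDiff_cosAt a)
theorem biperiodic_sinAt_fst (a : ℝ) : Biperiodic fun s _ => sinAt a s := .ofFst (sinAt_add_one a)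
theorem biperiodic_sinAt_snd (a : ℝ) : Biperiodic fun _ t => sinAt a t := .ofSnd (sinAt_add_one a)
theorem biperiodic_cosAt_fst (a : ℝ) : Biperiodic fun s _ => cosAt a s := .ofFst (cosAt_add_one a)
theorem biperiodic_cosAt_snd (a : ℝ) : Biperiodic fun _ t => cosAt a t := .ofSnd (cosAt_add_one a)

theorem torusMap_model (a b : ℝ) : TorusMap (fun s _ => sinAt a s) (fun _ t => sinAt b t)
    fun s t => cosAt a s + cosAt b t - 1 := by
  refine ⟨mixedC1_sinAt_fst a, mixedC1_sinAt_snd b,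
    ((mixedC1_cosAt_fst a).add (mixedC1_cosAt_snd b)).sub (.const 1), biperiodic_sinAt_fst a,
    biperiodic_sinAt_snd b, ((biperiodic_cosAt_fst a).add (biperiodic_cosAt_snd b)).sub (.const 1),
    fun s t => ?_⟩
  by_contra hc
  have e1 : sinAt a s = 0 := by nlinarith
  have e2 : sinAt b t = 0 := by nlinarith
  have e3 : cosAt a s + cosAt b t - 1 = 0 := by nlinarith
  rcases cos_eq_of_sin_eq_zero (cosAt_sq_add_sinAt_sq a s) e1 with h | h <;>
  rcases cos_eq_of_sin_eq_zero (cosAt_sq_add_sinAt_sq b t) e2 with h' | h' <;>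
  rw [h, h'] at e3 <;> norm_num at e3

/-- The normalization comes from the integral already computed: after signs and a permutation of the
coordinates, the model centred at (1/2, 0) is homotopic to the winding map with a = 1, a' = 0, b =
1. Its centre can be moved freely by homotopy invariance. -/
theorem mapDegree_model (a b : ℝ) : mapDegree (fun s _ => sinAt a s) (fun _ t => sinAt b t)
    (fun s t => cosAt a s + cosAt b t - 1) = 1 := by
  have h := mapDegree_eq_of_family (T := ℝ × ℝ) (fun v => torusMap_model v.1 v.2)
    (by unfold sinAt; fun_prop) (by unfold sinAt; fun_prop) (by unfold cosAt; fun_prop)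
    (a, b) (1 / 2, 0)
  simp only at h
  rw [h]
  have e1 : (fun s (_ : ℝ) => sinAt (1 / 2) s) = fun s _ => -Real.sin (2 * π * s) := by
    ext s t
    rw [sinAt, ← Real.sin_sub_pi]; ring_nf
  have e2 : (fun (_ : ℝ) t => sinAt 0 t) = fun _ t => - (-Real.sin (2 * π * t)) := by
    ext s t
    rw [sinAt, sub_zero, neg_neg]
  have e3 : (fun s t => cosAt (1 / 2) s + cosAt 0 t - 1) =
      fun s t => -(1 + Real.cos (2 * π * s) - Real.cos (2 * π * t)) := by
    ext s t
    have : cosAt (1 / 2) s = - Real.cos (2 * π * s) := by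
      rw [cosAt, ← Real.cos_sub_pi]; ring_nf
    rw [this, cosAt, sub_zero]; ring
  rw [e1, e2, e3, mapDegree_neg_first, mapDegree_neg_mid, mapDegree_neg, neg_neg]
  have hw := windingDegree_linear 1 0 1
  have t₁ := torusCoords_of_angles 1 0 (u := fun _ => 0) (v := fun _ => 0) (r := fun _ => 1 / 2)
    contDiff_const contDiff_const contDiff_const (fun _ => rfl) (fun _ => rfl) (fun _ => rfl)
    (fun _ => by norm_num) (fun _ => by norm_num)
  have t₂ := torusCoords_of_angles 0 1 (u := fun _ => 0) (v := fun _ => 0) (r := fun _ => 1 / 2)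
    contDiff_const contDiff_const contDiff_const (fun _ => rfl) (fun _ => rfl) (fun _ => rfl)
    (fun _ => by norm_num) (fun _ => by norm_num)
  have tw := torusMap_winding t₁ t₂
  have eC : cosDiff (fun s => Real.cos (2 * π * s)) (fun s => Real.sin (2 * π * s)) (fun _ => 1)
      (fun _ => 0) = fun s _ => Real.cos (2 * π * s) := by
    ext s t; simp [cosDiff]
  have eS : sinDiff (fun s => Real.cos (2 * π * s)) (fun s => Real.sin (2 * π * s)) (fun _ => 1)
      (fun _ => 0) = fun s _ => Real.sin (2 * π * s) := by
    ext s t; simp [sinDiff]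
  simp only [windingDegree, Int.cast_one, Int.cast_zero, zero_mul, mul_zero, add_zero, one_mul,
    mul_one, Real.cos_zero, Real.sin_zero, eC, eS] at tw hw
  have tm : TorusMap (fun s t => 1 + Real.cos (2 * π * s) - Real.cos (2 * π * t))
      (fun _ t => -Real.sin (2 * π * t)) fun s _ => Real.sin (2 * π * s) := by
    refine ⟨((MixedC1.const 1).add (.ofFst (u := fun s => Real.cos (2 * π * s)) (by fun_prop))).sub
      (.ofSnd (u := fun t => Real.cos (2 * π * t)) (by fun_prop)),
      .ofSnd (u := fun t => -Real.sin (2 * π * t)) (by fun_prop), tw.mixedZ,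
      ((Biperiodic.const 1).add (.ofFst (u := fun s => Real.cos (2 * π * s)) fun s => ?_)).sub
      (.ofSnd (u := fun t => Real.cos (2 * π * t)) fun t => ?_),
      .ofSnd (u := fun t => -Real.sin (2 * π * t)) fun t => ?_, tw.perZ, fun s t => ?_⟩
    · simp [mul_add]
    · simp [mul_add]
    · simp [mul_add]
    by_contra hc
    have x1 : 1 + Real.cos (2 * π * s) - Real.cos (2 * π * t) = 0 := by nlinarith
    have x2 : Real.sin (2 * π * t) = 0 := by nlinarith
    have x3 : Real.sin (2 * π * s) = 0 := by nlinarith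
    rcases cos_eq_of_sin_eq_zero (Real.cos_sq_add_sin_sq (2 * π * s)) x3 with h | h <;>
    rcases cos_eq_of_sin_eq_zero (Real.cos_sq_add_sin_sq (2 * π * t)) x2 with h' | h' <;>
    rw [h, h'] at x1 <;> norm_num at x1
  have key := mapDegree_eq_of_segment tw tm fun k k0 k1 s t x1 x2 x3 => ?_
  · rw [hw] at key
    rw [mapDegree_swap, neg_neg, mapDegree_cycle, ← key]
  · simp only [sub_self, mul_zero, add_zero] at x3
    have hsc := Real.cos_sq_add_sin_sq (2 * π * t)
    rcases cos_eq_of_sin_eq_zero (Real.cos_sq_add_sin_sq (2 * π * s)) x3 with h | h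
    · rw [blend_of_one (C := fun s _ => Real.cos (2 * π * s)) h, h] at x1
      nlinarith [Real.cos_le_one (2 * π * t)]
    · rw [blend_of_neg_one (C := fun s _ => Real.cos (2 * π * s)) h] at x1 x2
      rw [h] at x1
      have y1 : ((1 - k) / 2 + k) * Real.cos (2 * π * t) = 0 := by linear_combination -x1
      have y2 : ((1 - k) / 2 + k) * Real.sin (2 * π * t) = 0 := by linear_combination -x2
      have hk : (1 - k) / 2 + k ≠ 0 := by linarith
      rw [(mul_eq_zero.1 y1).resolve_left hk, (mul_eq_zero.1 y2).resolve_left hk] at hsc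
      norm_num at hsc

/-! ### Linear patches and their local degree -/

/-- A measure for the distance of `(s, t)` from `(a, b)` on the torus. -/
def torusGap (a b s t : ℝ) : ℝ := 2 - cosAt a s - cosAt b t

theorem mixedC1_torusGap (a b : ℝ) : MixedC1 (torusGap a b) :=
  ((MixedC1.const 2).sub (mixedC1_cosAt_fst a)).sub (mixedC1_cosAt_snd b)

theorem biperiodic_torusGap (a b : ℝ) : Biperiodic (torusGap a b) :=
  ((Biperiodic.const 2).sub (biperiodic_cosAt_fst a)).sub (biperiodic_cosAt_snd b)

/-- A cut-off function on the torus, equal to one where `torusGap a b ≤ ρ` and to zero where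
`2 ρ ≤ torusGap a b`. -/
def bump (ρ a b s t : ℝ) : ℝ := Real.smoothTransition (2 - torusGap a b s t / ρ)

theorem bump_eq_one {ρ a b s t : ℝ} (hρ : 0 < ρ) (h : torusGap a b s t ≤ ρ) :
    bump ρ a b s t = 1 := by
  refine Real.smoothTransition.one_of_one_le ?_
  have := (div_le_one hρ).2 h
  linarith

theorem bump_eq_zero {ρ a b s t : ℝ} (hρ : 0 < ρ) (h : 2 * ρ ≤ torusGap a b s t) :
    bump ρ a b s t = 0 := by
  refine Real.smoothTransition.zero_of_nonpos ?_
  have := (le_div_iff₀ hρ).2 h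
  linarith

theorem bump_nonneg (ρ a b s t : ℝ) : 0 ≤ bump ρ a b s t := Real.smoothTransition.nonneg _

theorem mixedC1_bumpArg (ρ a b : ℝ) : MixedC1 fun s t => 2 - torusGap a b s t / ρ := by
  simpa only [div_eq_mul_inv] using
    (MixedC1.const 2).sub ((mixedC1_torusGap a b).mul (.const ρ⁻¹))

theorem mixedC1_bump (ρ a b : ℝ) : MixedC1 (bump ρ a b) := (mixedC1_bumpArg ρ a b).transition

theorem biperiodic_bump (ρ a b : ℝ) : Biperiodic (bump ρ a b) :=
  (biperiodic_torusGap a b).comp fun x => Real.smoothTransition (2 - x / ρ)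

/-- A linear function, in the coordinates `sinAt` about the point `(a, b)`. -/
def linearAt (a b p q s t : ℝ) : ℝ := p * sinAt a s + q * sinAt b t

theorem mixedC1_linearAt (a b p q : ℝ) : MixedC1 (linearAt a b p q) :=
  ((MixedC1.const p).mul (mixedC1_sinAt_fst a)).add ((MixedC1.const q).mul (mixedC1_sinAt_snd b))

theorem biperiodic_linearAt (a b p q : ℝ) : Biperiodic (linearAt a b p q) :=
  ((Biperiodic.const p).mul (biperiodic_sinAt_fst a)).add
    ((Biperiodic.const q).mul (biperiodic_sinAt_snd b))

theorem torusGap_of_sinAt_eq_zero {a b s t : ℝ} (h : sinAt a s = 0) (h' : sinAt b t = 0) :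
    torusGap a b s t = 0 ∨ 2 ≤ torusGap a b s t := by
  rcases cos_eq_of_sin_eq_zero (cosAt_sq_add_sinAt_sq a s) h with e | e <;>
  rcases cos_eq_of_sin_eq_zero (cosAt_sq_add_sinAt_sq b t) h' with e' | e' <;>
  rw [torusGap, e, e'] <;> norm_num

/-- The sines vanish together at the centre and at the half-period points, where the gap is at least
2. The bound ρ ≤ 1 keeps the latter outside the support of the cut-off. -/
theorem bump_of_sinAt_eq_zero {ρ a b s t : ℝ} (h0 : 0 < ρ) (h1 : ρ ≤ 1) (h : sinAt a s = 0)
    (h' : sinAt b t = 0) : bump ρ a b s t = 0 ∨ bump ρ a b s t = 1 := by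
  rcases torusGap_of_sinAt_eq_zero h h' with e | e
  · exact .inr (bump_eq_one h0 (by linarith))
  · exact .inl (bump_eq_zero h0 (by linarith))

theorem eq_zero_of_linear {p q p' q' x y : ℝ} (hd : p * q' - q * p' ≠ 0) (h : p * x + q * y = 0)
    (h' : p' * x + q' * y = 0) : x = 0 ∧ y = 0 :=
  ⟨(mul_eq_zero.1 (by linear_combination q' * h - q * h' :
      (p * q' - q * p') * x = 0)).resolve_left hd,
    (mul_eq_zero.1 (by linear_combination p * h' - p' * h :
      (p * q' - q * p') * y = 0)).resolve_left hd⟩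

/-- The last coordinate vanishes only where the cut-off is 1/2, while at the zeros of the linear
part the cut-off is 0 or 1. -/
theorem local_ne_zero {ρ a b p q p' q' s t : ℝ} (h0 : 0 < ρ) (h1 : ρ ≤ 1)
    (hd : p * q' - q * p' ≠ 0) (h : bump ρ a b s t * linearAt a b p q s t = 0)
    (h' : bump ρ a b s t * linearAt a b p' q' s t = 0) (hz : 2 * bump ρ a b s t - 1 = 0) :
    False := by
  have hb : bump ρ a b s t ≠ 0 := by intro e; rw [e] at hz; norm_num at hz
  obtain ⟨x, y⟩ := eq_zero_of_linear hd ((mul_eq_zero.1 h).resolve_left hb)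
    ((mul_eq_zero.1 h').resolve_left hb)
  rcases bump_of_sinAt_eq_zero h0 h1 x y with e | e <;> rw [e] at hz <;> norm_num at hz

/-- A linear map near a point of the torus, completed by `(0, 0, -1)` away from that point. -/
theorem torusMap_local {ρ p q p' q' : ℝ} (a b : ℝ) (h0 : 0 < ρ) (h1 : ρ ≤ 1)
    (hd : p * q' - q * p' ≠ 0) :
    TorusMap (fun s t => bump ρ a b s t * linearAt a b p q s t)
      (fun s t => bump ρ a b s t * linearAt a b p' q' s t) fun s t => 2 * bump ρ a b s t - 1 := by
  refine ⟨(mixedC1_bump ρ a b).mul (mixedC1_linearAt a b p q),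
    (mixedC1_bump ρ a b).mul (mixedC1_linearAt a b p' q'),
    ((MixedC1.const 2).mul (mixedC1_bump ρ a b)).sub (.const 1),
    (biperiodic_bump ρ a b).mul (biperiodic_linearAt a b p q),
    (biperiodic_bump ρ a b).mul (biperiodic_linearAt a b p' q'),
    ((Biperiodic.const 2).mul (biperiodic_bump ρ a b)).sub (.const 1), fun s t => ?_⟩
  by_contra hc
  exact local_ne_zero (s := s) (t := t) (a := a) (b := b) h0 h1 hd (by nlinarith) (by nlinarith)
    (by nlinarith)

/-- The degree of the map of `torusMap_local`. -/
def localDegree (ρ a b p q p' q' : ℝ) : ℝ :=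
  mapDegree (fun s t => bump ρ a b s t * linearAt a b p q s t)
    (fun s t => bump ρ a b s t * linearAt a b p' q' s t) fun s t => 2 * bump ρ a b s t - 1

theorem localDegree_eq_of_segment {ρ a b p q p' q' x y x' y' : ℝ} (h0 : 0 < ρ) (h1 : ρ ≤ 1)
    (hd : p * q' - q * p' ≠ 0) (hd' : x * y' - y * x' ≠ 0)
    (hk : ∀ k, 0 < k → k < 1 → (p + k * (x - p)) * (q' + k * (y' - q')) -
      (q + k * (y - q)) * (p' + k * (x' - p')) ≠ 0) :
    localDegree ρ a b p q p' q' = localDegree ρ a b x y x' y' := by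
  refine mapDegree_eq_of_segment (torusMap_local a b h0 h1 hd) (torusMap_local a b h0 h1 hd')
    fun k k0 k1 s t e1 e2 e3 => ?_
  refine local_ne_zero (s := s) (t := t) (a := a) (b := b) h0 h1 (hk k k0 k1) ?_ ?_ ?_
  · simp only [linearAt] at e1 ⊢; linear_combination e1
  · simp only [linearAt] at e2 ⊢; linear_combination e2
  · linear_combination e3

/-- Along the straight homotopy to `torusMap_model` the first two coordinates are positive multiples
of the sines. At their common zeros both heights are positive at the centre and negative elsewhere.
-/
theorem localDegree_one {ρ : ℝ} (a b : ℝ) (h0 : 0 < ρ) (h1 : ρ ≤ 1) :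
    localDegree ρ a b 1 0 0 1 = 1 := by
  refine Eq.trans ?_ (mapDegree_model a b)
  refine mapDegree_eq_of_segment (torusMap_local (p := 1) (q := 0) (p' := 0) (q' := 1) a b h0 h1
    (by norm_num)) (torusMap_model a b)
    fun k k0 k1 s t e1 e2 e3 => ?_
  have hb := bump_nonneg ρ a b s t
  have hpos : 0 < (1 - k) * bump ρ a b s t + k := by nlinarith
  simp only [linearAt] at e1 e2
  have x : sinAt a s = 0 := (mul_eq_zero.1 (by linear_combination e1 :
    ((1 - k) * bump ρ a b s t + k) * sinAt a s = 0)).resolve_left hpos.ne'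
  have y : sinAt b t = 0 := (mul_eq_zero.1 (by linear_combination e2 :
    ((1 - k) * bump ρ a b s t + k) * sinAt b t = 0)).resolve_left hpos.ne'
  have eg : cosAt a s + cosAt b t - 1 = 1 - torusGap a b s t := by rw [torusGap]; ring
  rw [eg] at e3
  rcases torusGap_of_sinAt_eq_zero x y with e | e
  · rw [bump_eq_one h0 (by linarith), e] at e3
    linarith
  · rw [bump_eq_zero h0 (by linarith)] at e3
    nlinarith

/-- A matrix of positive determinant is joined to the identity: adding its cofactor matrix makes it
a multiple of a rotation, scaling makes it a rotation, and a constant rotation is covered by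
`mapDegree_rotate`. -/
theorem localDegree_of_pos {ρ p q p' q' : ℝ} (a b : ℝ) (h0 : 0 < ρ) (h1 : ρ ≤ 1)
    (hd : 0 < p * q' - q * p') : localDegree ρ a b p q p' q' = 1 := by
  have hsq : 0 < (p + q') ^ 2 + (p' - q) ^ 2 := by nlinarith [sq_nonneg (p - q'), sq_nonneg (p' + q)]
  have e1 : localDegree ρ a b p q p' q' =
      localDegree ρ a b (p + q') (-(p' - q)) (p' - q) (p + q') := by
    refine localDegree_eq_of_segment h0 h1 hd.ne' (by nlinarith) fun k k0 k1 => ?_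
    -- This is the determinant of the matrix plus k times its cofactor matrix.
    have : 0 < (p * q' - q * p') * (1 + k ^ 2) + k * (p ^ 2 + q ^ 2 + p' ^ 2 + q' ^ 2) := by
      positivity
    nlinarith
  set x := p + q'
  set y := p' - q
  set n := √(x ^ 2 + y ^ 2)
  have hn : 0 < n := Real.sqrt_pos.2 hsq
  have hn2 : n ^ 2 = x ^ 2 + y ^ 2 := Real.sq_sqrt hsq.le
  have e2 : localDegree ρ a b x (-y) y x = localDegree ρ a b (x / n) (-(y / n)) (y / n) (x / n) := by
    have hu : x / n * (x / n) - -(y / n) * (y / n) = 1 := by field_simp; linarith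
    refine localDegree_eq_of_segment h0 h1 (by nlinarith) (by rw [hu]; exact one_ne_zero)
      fun k k0 k1 => ?_
    have hk : 0 < 1 - k + k / n := by have := div_pos k0 hn; linarith
    have : 0 < (1 - k + k / n) ^ 2 * (x ^ 2 + y ^ 2) := by positivity
    refine (this.trans_eq ?_).ne'
    field_simp
    ring
  have e3 : localDegree ρ a b (x / n) (-(y / n)) (y / n) (x / n) = localDegree ρ a b 1 0 0 1 := by
    have hr := (mapDegree_rotate (torusMap_local a b h0 h1 (p := 1) (q := 0) (p' := 0) (q' := 1)
      (by norm_num)) (c := fun _ => x / n) (d := fun _ => y / n) contDiff_const contDiff_const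
      (fun _ => rfl) (fun _ => rfl) (fun _ => by field_simp; linarith)).2
    rw [localDegree, localDegree, ← hr]
    congr 1 <;> ext s t <;> simp only [linearAt] <;> ring
  rw [e1, e2, e3, localDegree_one a b h0 h1]

theorem localDegree_of_neg {ρ p q p' q' : ℝ} (a b : ℝ) (h0 : 0 < ρ) (h1 : ρ ≤ 1)
    (hd : p * q' - q * p' < 0) : localDegree ρ a b p q p' q' = -1 := by
  have h := localDegree_of_pos (p := p) (q := q) (p' := -p') (q' := -q') a b h0 h1 (by linarith)
  rw [← h, localDegree, localDegree, ← neg_neg (mapDegree _ _ _), ← mapDegree_neg_mid]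
  congr 2; ext s t; simp only [linearAt]; ring

theorem localDegree_eq_sign {ρ p q p' q' : ℝ} (a b : ℝ) (h0 : 0 < ρ) (h1 : ρ ≤ 1)
    (hd : p * q' - q * p' ≠ 0) : localDegree ρ a b p q p' q' = SignType.sign (p * q' - q * p') := by
  rcases hd.lt_or_gt with h | h
  · rw [localDegree_of_neg a b h0 h1 h, sign_neg h]; simp
  · rw [localDegree_of_pos a b h0 h1 h, sign_pos h]; simp

theorem degreeDensity_congr_zero {X Y Z : ℝ → ℝ → ℝ} {s t : ℝ} (h : derivFst X s t = 0)
    (h' : derivFst Y s t = 0) (h'' : derivFst Z s t = 0) : degreeDensity X Y Z s t = 0 := by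
  simp [degreeDensity, solidForm, tripleDet, h, h', h'']

theorem derivFst_sum {ι : Type*} (I : Finset ι) {f : ι → ℝ → ℝ → ℝ} (h : ∀ i, MixedC1 (f i))
    (s t : ℝ) : derivFst (fun s t => ∑ i ∈ I, f i s t) s t = ∑ i ∈ I, derivFst (f i) s t :=
  (HasDerivAt.fun_sum fun i _ => (h i).hasDerivFst s t).deriv

theorem derivSnd_sum {ι : Type*} (I : Finset ι) {f : ι → ℝ → ℝ → ℝ} (h : ∀ i, MixedC1 (f i))
    (s t : ℝ) : derivSnd (fun s t => ∑ i ∈ I, f i s t) s t = ∑ i ∈ I, derivSnd (f i) s t :=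
  (HasDerivAt.fun_sum fun i _ => (h i).hasDerivSnd s t).deriv

theorem MixedC1.sum {ι : Type*} (I : Finset ι) {f : ι → ℝ → ℝ → ℝ} (h : ∀ i, MixedC1 (f i)) :
    MixedC1 fun s t => ∑ i ∈ I, f i s t := by
  classical
  induction I using Finset.induction_on with
  | empty => simpa using MixedC1.const 0
  | insert i I hi ih => simpa only [Finset.sum_insert hi] using (h i).add ih

theorem Biperiodic.sum {ι : Type*} (I : Finset ι) {f : ι → ℝ → ℝ → ℝ} (h : ∀ i, Biperiodic (f i)) :
    Biperiodic fun s t => ∑ i ∈ I, f i s t :=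
  ⟨fun s t => Finset.sum_congr rfl fun i _ => (h i).fst s t,
    fun s t => Finset.sum_congr rfl fun i _ => (h i).snd s t⟩

theorem derivFst_bump_mul {ρ a b s t : ℝ} {X : ℝ → ℝ → ℝ} (hX : MixedC1 X)
    (h : bump ρ a b s t = 0) : derivFst (fun s t => bump ρ a b s t * X s t) s t = 0 :=
  derivFst_transition_mul (mixedC1_bumpArg ρ a b) hX (Real.smoothTransition.zero_iff_nonpos.1 h)

theorem derivSnd_bump_mul {ρ a b s t : ℝ} {X : ℝ → ℝ → ℝ} (hX : MixedC1 X)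
    (h : bump ρ a b s t = 0) : derivSnd (fun s t => bump ρ a b s t * X s t) s t = 0 :=
  derivSnd_transition_mul (mixedC1_bumpArg ρ a b) hX (Real.smoothTransition.zero_iff_nonpos.1 h)

theorem mapDegree_eq_sum {ι : Type*} (I : Finset ι) {X Y Z : ℝ → ℝ → ℝ} {U V W : ι → ℝ → ℝ → ℝ}
    (h : ∀ i, TorusMap (U i) (V i) (W i))
    (hd : ∀ s t, degreeDensity X Y Z s t = ∑ i ∈ I, degreeDensity (U i) (V i) (W i) s t) :
    mapDegree X Y Z = ∑ i ∈ I, mapDegree (U i) (V i) (W i) := by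
  simp only [mapDegree, hd, ← Finset.mul_sum]
  congr 1
  have c i := (h i).continuous_degreeDensity
  rw [← intervalIntegral.integral_finsetSum fun i _ =>
    (intervalIntegral.continuous_parametric_intervalIntegral_of_continuous' (c i) 0
        1).intervalIntegrable 0 1]
  refine intervalIntegral.integral_congr fun s _ => ?_
  exact intervalIntegral.integral_finsetSum fun i _ =>
    ((c i).comp (f := fun t : ℝ => (s, t)) (by fun_prop)).intervalIntegrable 0 1

theorem derivFst_bump {ρ a b s t : ℝ} (h : bump ρ a b s t = 0) : derivFst (bump ρ a b) s t = 0 := by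
  simpa only [mul_one] using derivFst_bump_mul (.const 1) h

theorem derivSnd_bump {ρ a b s t : ℝ} (h : bump ρ a b s t = 0) : derivSnd (bump ρ a b) s t = 0 := by
  simpa only [mul_one] using derivSnd_bump_mul (.const 1) h

theorem derivFst_two_mul_sub {f : ℝ → ℝ → ℝ} (h : MixedC1 f) (s t : ℝ) :
    derivFst (fun s t => 2 * f s t - 1) s t = 2 * derivFst f s t :=
  (((h.hasDerivFst s t).const_mul 2).sub_const 1).deriv

theorem derivSnd_two_mul_sub {f : ℝ → ℝ → ℝ} (h : MixedC1 f) (s t : ℝ) :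
    derivSnd (fun s t => 2 * f s t - 1) s t = 2 * derivSnd f s t :=
  (((h.hasDerivSnd s t).const_mul 2).sub_const 1).deriv

/-! ### Several disjoint patches -/

section multi

variable {ι : Type*} (I : Finset ι) (ρ : ℝ) (a b p q p' q' : ι → ℝ)

/-- Finitely many linear functions, each cut off near a point of the torus. -/
def patchSum (s t : ℝ) : ℝ := ∑ i ∈ I, bump ρ (a i) (b i) s t * linearAt (a i) (b i) (p i) (q i) s t

/-- The last component of the map with finitely many linear patches. -/
def patchHeight (s t : ℝ) : ℝ := 2 * ∑ i ∈ I, bump ρ (a i) (b i) s t - 1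

theorem mixedC1_patch (i : ι) : MixedC1 fun s t =>
    bump ρ (a i) (b i) s t * linearAt (a i) (b i) (p i) (q i) s t :=
  (mixedC1_bump _ _ _).mul (mixedC1_linearAt _ _ _ _)

variable {I ρ a b p q p' q'}

theorem torusMap_patch (h0 : 0 < ρ) (h1 : ρ ≤ 1) (hd : ∀ i, p i * q' i - q i * p' i ≠ 0)
    (hI : ∀ s t, ∀ i ∈ I, ∀ j ∈ I, bump ρ (a i) (b i) s t ≠ 0 → bump ρ (a j) (b j) s t ≠ 0 → i = j) :
    TorusMap (patchSum I ρ a b p q) (patchSum I ρ a b p' q') (patchHeight I ρ a b) := by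
  refine ⟨.sum I (mixedC1_patch ρ a b p q), .sum I (mixedC1_patch ρ a b p' q'),
    ((MixedC1.const 2).mul (.sum I fun i => mixedC1_bump ρ (a i) (b i))).sub (.const 1),
    .sum I fun i => (biperiodic_bump _ _ _).mul (biperiodic_linearAt _ _ _ _),
    .sum I fun i => (biperiodic_bump _ _ _).mul (biperiodic_linearAt _ _ _ _),
    ((Biperiodic.const 2).mul (.sum I fun i => biperiodic_bump ρ (a i) (b i))).sub (.const 1),
    fun s t => ?_⟩
  by_contra hc
  have e1 : patchSum I ρ a b p q s t = 0 := by nlinarith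
  have e2 : patchSum I ρ a b p' q' s t = 0 := by nlinarith
  have e3 : patchHeight I ρ a b s t = 0 := by nlinarith
  unfold patchSum at e1 e2
  unfold patchHeight at e3
  by_cases hj : ∃ j ∈ I, bump ρ (a j) (b j) s t ≠ 0
  · obtain ⟨j, hj, hb⟩ := hj
    have hz : ∀ i ∈ I, i ≠ j → bump ρ (a i) (b i) s t = 0 := fun i hi hij => by
      by_contra hn; exact hij (hI s t i hi j hj hn hb)
    rw [Finset.sum_eq_single_of_mem j hj fun i hi hij => by rw [hz i hi hij, zero_mul]] at e1 e2
    rw [Finset.sum_eq_single_of_mem j hj hz] at e3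
    exact local_ne_zero h0 h1 (hd j) e1 e2 e3
  · push Not at hj
    rw [Finset.sum_eq_zero hj] at e3
    norm_num at e3

/-- The cut-offs have disjoint supports, so at each point at most one summand is active and the
density is that of a single patch. Off all supports the map is (0, 0, −1) and every density
vanishes. -/
theorem mapDegree_patch (h0 : 0 < ρ) (h1 : ρ ≤ 1) (hd : ∀ i, p i * q' i - q i * p' i ≠ 0)
    (hI : ∀ s t, ∀ i ∈ I, ∀ j ∈ I, bump ρ (a i) (b i) s t ≠ 0 → bump ρ (a j) (b j) s t ≠ 0 → i = j) :
    mapDegree (patchSum I ρ a b p q) (patchSum I ρ a b p' q') (patchHeight I ρ a b) =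
      ∑ i ∈ I, localDegree ρ (a i) (b i) (p i) (q i) (p' i) (q' i) := by
  refine mapDegree_eq_sum I (fun i => torusMap_local (a i) (b i) h0 h1 (hd i)) fun s t => ?_
  have mb i := mixedC1_bump ρ (a i) (b i)
  have f1 : derivFst (patchSum I ρ a b p q) s t = _ := derivFst_sum I (mixedC1_patch ρ a b p q) s t
  have f2 : derivFst (patchSum I ρ a b p' q') s t = _ :=
    derivFst_sum I (mixedC1_patch ρ a b p' q') s t
  have f3 : derivFst (patchHeight I ρ a b) s t = _ := derivFst_two_mul_sub (.sum I mb) s t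
  have g1 : derivSnd (patchSum I ρ a b p q) s t = _ := derivSnd_sum I (mixedC1_patch ρ a b p q) s t
  have g2 : derivSnd (patchSum I ρ a b p' q') s t = _ :=
    derivSnd_sum I (mixedC1_patch ρ a b p' q') s t
  have g3 : derivSnd (patchHeight I ρ a b) s t = _ := derivSnd_two_mul_sub (.sum I mb) s t
  rw [derivFst_sum I mb] at f3
  rw [derivSnd_sum I mb] at g3
  have dz : ∀ i, bump ρ (a i) (b i) s t = 0 → degreeDensity
      (fun s t => bump ρ (a i) (b i) s t * linearAt (a i) (b i) (p i) (q i) s t)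
      (fun s t => bump ρ (a i) (b i) s t * linearAt (a i) (b i) (p' i) (q' i) s t)
      (fun s t => 2 * bump ρ (a i) (b i) s t - 1) s t = 0 := fun i hi =>
    degreeDensity_congr_zero (derivFst_bump_mul (mixedC1_linearAt _ _ _ _) hi)
      (derivFst_bump_mul (mixedC1_linearAt _ _ _ _) hi)
      (by rw [derivFst_two_mul_sub (mb i), derivFst_bump hi, mul_zero])
  by_cases hj : ∃ j ∈ I, bump ρ (a j) (b j) s t ≠ 0
  · obtain ⟨j, hj, hb⟩ := hj
    have hz : ∀ i ∈ I, i ≠ j → bump ρ (a i) (b i) s t = 0 := fun i hi hij => by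
      by_contra hn; exact hij (hI s t i hi j hj hn hb)
    rw [Finset.sum_eq_single_of_mem j hj fun i hi hij => dz i (hz i hi hij)]
    rw [Finset.sum_eq_single_of_mem j hj fun i hi hij =>
      derivFst_bump_mul (mixedC1_linearAt _ _ _ _) (hz i hi hij)] at f1 f2
    rw [Finset.sum_eq_single_of_mem j hj fun i hi hij =>
      derivSnd_bump_mul (mixedC1_linearAt _ _ _ _) (hz i hi hij)] at g1 g2
    rw [Finset.sum_eq_single_of_mem j hj fun i hi hij => derivFst_bump (hz i hi hij)] at f3
    rw [Finset.sum_eq_single_of_mem j hj fun i hi hij => derivSnd_bump (hz i hi hij)] at g3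
    simp only [degreeDensity]
    rw [f1, f2, f3, g1, g2, g3, derivFst_two_mul_sub (mb j), derivSnd_two_mul_sub (mb j)]
    unfold patchSum patchHeight
    rw [Finset.sum_eq_single_of_mem j hj fun i hi hij => by rw [hz i hi hij, zero_mul],
      Finset.sum_eq_single_of_mem j hj fun i hi hij => by rw [hz i hi hij, zero_mul],
      Finset.sum_eq_single_of_mem j hj hz]
  · push Not at hj
    rw [Finset.sum_eq_zero fun i hi => dz i (hj i hi)]
    refine degreeDensity_congr_zero (f1.trans (Finset.sum_eq_zero fun i hi => ?_))
      (f2.trans (Finset.sum_eq_zero fun i hi => ?_)) (f3.trans ?_)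
    · exact derivFst_bump_mul (mixedC1_linearAt _ _ _ _) (hj i hi)
    · exact derivFst_bump_mul (mixedC1_linearAt _ _ _ _) (hj i hi)
    · rw [Finset.sum_eq_zero fun i hi => derivFst_bump (hj i hi), mul_zero]

end multi

/-! ### Uniform and linear estimates -/

/-- The graph over a compact set is compact, so a condition that holds near each of its points holds
on a uniform tube around it. It serves to pass from the knots to all sufficiently close loops. -/
theorem exists_forall_dist_lt_of_eventually {X Y : Type*} [PseudoMetricSpace X]
    [PseudoMetricSpace Y] {g : X → Y} (hg : Continuous g) {S : Set X} (hS : IsCompact S)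
    {P : X × Y → Prop} (h : ∀ x ∈ S, ∀ᶠ q in 𝓝 (x, g x), P q) :
    ∃ ε > 0, ∀ x ∈ S, ∀ y, dist y (g x) < ε → P (x, y) := by
  have hG : IsCompact ((fun x => (x, g x)) '' S) := hS.image (by fun_prop)
  obtain ⟨ε, ε0, hε⟩ := hG.exists_thickening_subset_open (isOpen_interior (s := {q | P q})) <| by
    rintro _ ⟨x, hx, rfl⟩
    exact mem_interior_iff_mem_nhds.2 (h x hx)
  refine ⟨ε, ε0, fun x hx y hy => interior_subset (hε ?_)⟩
  exact Metric.mem_thickening_iff.2 ⟨_, ⟨x, hx, rfl⟩, by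
    rw [Prod.dist_eq, dist_self]; exact max_lt ε0 hy⟩

theorem four_mul_abs_le_abs_sinAt {a s : ℝ} (h : |s - a| ≤ 1 / 4) : 4 * |s - a| ≤ |sinAt a s| := by
  have h2 : |2 * π * (s - a)| = 2 * π * |s - a| := by rw [abs_mul, abs_of_pos Real.two_pi_pos]
  have := Real.mul_abs_le_abs_sin (x := 2 * π * (s - a)) (by rw [h2]; nlinarith [Real.pi_pos])
  rw [h2] at this
  refine Eq.trans_le ?_ this
  field_simp
  ring

/-- The constant 8 is (2/π²)(2π)², from the estimate 1 − cos θ ≥ (2/π²) θ² for |θ| ≤ π, applied at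
the distance to the nearest integer. -/
theorem exists_int_abs_sub_le {a s ρ : ℝ} (h : 1 - cosAt a s ≤ ρ) :
    ∃ m : ℤ, 8 * (s - a - m) ^ 2 ≤ ρ := by
  refine ⟨round (s - a), ?_⟩
  have hr := abs_sub_round (s - a)
  set x := s - a - round (s - a) with hx
  have hc : Real.cos (2 * π * x) = cosAt a s := by
    rw [cosAt, hx, mul_sub, mul_comm (2 * π) (round (s - a) : ℝ), Real.cos_sub_int_mul_two_pi]
  have := Real.cos_le_one_sub_mul_cos_sq (x := 2 * π * x) (by
    rw [abs_mul, abs_of_pos (by positivity)]; nlinarith [Real.pi_pos])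
  have e : 2 / π ^ 2 * (2 * π * x) ^ 2 = 8 * x ^ 2 := by field_simp; ring
  linarith

theorem exists_int_of_torusGap_le {a b s t ρ δ : ℝ} (hδ : 0 < δ) (hρ : ρ < δ ^ 2)
    (h : torusGap a b s t ≤ 2 * ρ) : ∃ m n : ℤ, |s - m - a| < δ ∧ |t - n - b| < δ := by
  have := cosAt_le_one a s
  have := cosAt_le_one b t
  rw [torusGap] at h
  obtain ⟨m, hm⟩ := exists_int_abs_sub_le (a := a) (s := s) (ρ := 2 * ρ) (by linarith)
  obtain ⟨n, hn⟩ := exists_int_abs_sub_le (a := b) (s := t) (ρ := 2 * ρ) (by linarith)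
  refine ⟨m, n, abs_lt_of_sq_lt_sq ?_ hδ.le, abs_lt_of_sq_lt_sq ?_ hδ.le⟩
  · nlinarith [sq_nonneg (s - a - m)]
  · nlinarith [sq_nonneg (t - b - n)]

theorem hasDerivAt_sinAt (a : ℝ) : HasDerivAt (sinAt a) (2 * π) a := by
  have h := (((hasDerivAt_id a).sub_const a).const_mul (2 * π)).sin
  exact h.congr_deriv (by simp)

/-- The linear map with the partial derivatives `2 π p` and `2 π q`. -/
def planeForm (p q : ℝ) : ℝ × ℝ →L[ℝ] ℝ :=
  (2 * π * p) • ContinuousLinearMap.fst ℝ ℝ ℝ + (2 * π * q) • ContinuousLinearMap.snd ℝ ℝ ℝ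

theorem hasFDerivAt_linearAt (a b p q : ℝ) :
    HasFDerivAt (fun x : ℝ × ℝ => linearAt a b p q x.1 x.2) (planeForm p q) (a, b) := by
  have h1 := (hasDerivAt_sinAt a).comp_hasFDerivAt (a, b) (hasFDerivAt_fst (𝕜 := ℝ) (p := (a, b)))
  have h2 := (hasDerivAt_sinAt b).comp_hasFDerivAt (a, b) (hasFDerivAt_snd (𝕜 := ℝ) (p := (a, b)))
  refine ((h1.const_mul p).add (h2.const_mul q)).congr_fderiv ?_
  ext <;> simp [planeForm] <;> ring

/-- The error of linearization is o(r) at distance r from the zero, while an invertible linear map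
is bounded below by a multiple of r. This strict inequality is the Rouché condition: it keeps the
straight homotopy to the linear part free of zeros, and it shows that the zero is isolated. -/
theorem exists_linear_estimate {V U : ℝ → ℝ → ℝ} {a b p q p' q' : ℝ} (hV0 : V a b = 0)
    (hU0 : U a b = 0)
    (hV : HasFDerivAt (fun x : ℝ × ℝ => V x.1 x.2) (planeForm p q) (a, b))
    (hU : HasFDerivAt (fun x : ℝ × ℝ => U x.1 x.2) (planeForm p' q') (a, b))
    (hd : p * q' - q * p' ≠ 0) :
    ∀ᶠ x : ℝ × ℝ in 𝓝 (a, b), x ≠ (a, b) →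
      (V x.1 x.2 - linearAt a b p q x.1 x.2) ^ 2 + (U x.1 x.2 - linearAt a b p' q' x.1 x.2) ^ 2 <
      linearAt a b p q x.1 x.2 ^ 2 + linearAt a b p' q' x.1 x.2 ^ 2 := by
  set d := p * q' - q * p' with hd'
  set M := |p| + |q| + |p'| + |q'| with hM
  have hM0 : 0 ≤ M := by positivity
  have hdp : 0 < |d| := abs_pos.2 hd
  -- By Cramer's rule the larger of |A| and |B| is at least 4|d|r / M. With this c it is at least
  -- 4cr, whereas each error is at most cr.
  set c := |d| / (M + 1) with hc
  have hc0 : 0 < c := by positivity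
  have hl : ∀ p q, linearAt a b p q a b = 0 := fun p q => by simp [linearAt, sinAt]
  have key : ∀ {V : ℝ → ℝ → ℝ} {p q : ℝ}, V a b = 0 →
      HasFDerivAt (fun x : ℝ × ℝ => V x.1 x.2) (planeForm p q) (a, b) →
      ∀ᶠ x : ℝ × ℝ in 𝓝 (a, b), |V x.1 x.2 - linearAt a b p q x.1 x.2| ≤ c * ‖x - (a, b)‖ := by
    intro V p q h0 h
    have h1 := (h.sub (hasFDerivAt_linearAt a b p q)).isLittleO.def hc0
    filter_upwards [h1] with x hx
    simpa [h0, hl] using hx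
  have hnear : ∀ᶠ x : ℝ × ℝ in 𝓝 (a, b), |x.1 - a| ≤ 1 / 4 ∧ |x.2 - b| ≤ 1 / 4 := by
    refine Filter.Eventually.mono (Metric.ball_mem_nhds (a, b) (by norm_num : (0 : ℝ) < 1 / 4)) ?_
    intro x hx
    replace hx : dist x (a, b) < 1 / 4 := hx
    rw [Prod.dist_eq, max_lt_iff] at hx
    exact ⟨hx.1.le, hx.2.le⟩
  filter_upwards [key hV0 hV, key hU0 hU, hnear] with x h1 h2 h3 hx
  have n1 := four_mul_abs_le_abs_sinAt h3.1
  have n2 := four_mul_abs_le_abs_sinAt h3.2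
  set A := linearAt a b p q x.1 x.2 with hA
  set B := linearAt a b p' q' x.1 x.2 with hB
  have hr : 0 < ‖x - (a, b)‖ := norm_pos_iff.2 (sub_ne_zero.2 hx)
  set r := ‖x - (a, b)‖ with hr'
  have hs : |d| * (4 * r) ≤ M * max |A| |B| := by
    have e1 : d * sinAt a x.1 = q' * A - q * B := by rw [hA, hB, linearAt, linearAt]; ring
    have e2 : d * sinAt b x.2 = p * B - p' * A := by rw [hA, hB, linearAt, linearAt]; ring
    have m1 := le_max_left |A| |B|
    have m2 := le_max_right |A| |B|
    have b1 : |d| * |sinAt a x.1| ≤ M * max |A| |B| := by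
      rw [← abs_mul, e1]
      calc |q' * A - q * B| ≤ |q' * A| + |q * B| := abs_sub _ _
        _ = |q'| * |A| + |q| * |B| := by rw [abs_mul, abs_mul]
        _ ≤ |q'| * max |A| |B| + |q| * max |A| |B| := by gcongr
        _ ≤ M * max |A| |B| := by
          have := abs_nonneg p
          have := abs_nonneg p'
          rw [hM]; nlinarith [abs_nonneg A]
    have b2 : |d| * |sinAt b x.2| ≤ M * max |A| |B| := by
      rw [← abs_mul, e2]
      calc |p * B - p' * A| ≤ |p * B| + |p' * A| := abs_sub _ _
        _ = |p| * |B| + |p'| * |A| := by rw [abs_mul, abs_mul]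
        _ ≤ |p| * max |A| |B| + |p'| * max |A| |B| := by gcongr
        _ ≤ M * max |A| |B| := by
          have := abs_nonneg q
          have := abs_nonneg q'
          rw [hM]; nlinarith [abs_nonneg A]
    rcases max_choice ‖(x - (a, b)).1‖ ‖(x - (a, b)).2‖ with e | e
    · have : r = |x.1 - a| := by rw [hr', Prod.norm_def, e]; rfl
      rw [this]
      exact (mul_le_mul_of_nonneg_left n1 hdp.le).trans b1
    · have : r = |x.2 - b| := by rw [hr', Prod.norm_def, e]; rfl
      rw [this]
      exact (mul_le_mul_of_nonneg_left n2 hdp.le).trans b2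
  have hm : 4 * (c * r) ≤ max |A| |B| := by
    have e : |d| = c * (M + 1) := by rw [hc]; field_simp
    have hm0 : 0 ≤ max |A| |B| := (abs_nonneg A).trans (le_max_left _ _)
    rw [e] at hs
    by_contra hlt
    push Not at hlt
    nlinarith [mul_pos hc0 hr]
  have hcr : 0 < c * r := by positivity
  have hmsq : (max |A| |B|) ^ 2 ≤ A ^ 2 + B ^ 2 := by
    rcases max_choice |A| |B| with e | e <;> rw [e, sq_abs] <;> nlinarith [sq_nonneg A, sq_nonneg B]
  have s1 := sq_le_sq' (neg_le_of_abs_le h1) (le_of_abs_le h1)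
  have s2 := sq_le_sq' (neg_le_of_abs_le h2) (le_of_abs_le h2)
  nlinarith

/-! ### Angle functions on four-space and their continuity -/

/-- The cosine of the horizontal angle of a point. -/
def horCos (x : E4) : ℝ := x 0 / horizontalNorm x

/-- The sine of the horizontal angle of a point. -/
def horSin (x : E4) : ℝ := x 1 / horizontalNorm x

/-- The cosine of the vertical angle of a point. -/
def verCos (x : E4) : ℝ := x 2 / verticalNorm x

/-- The sine of the vertical angle of a point. -/
def verSin (x : E4) : ℝ := -x 3 / verticalNorm x

/-- The sine of the difference of the horizontal angles of two points. -/
def horSinDiff (x y : E4) : ℝ := horSin x * horCos y - horCos x * horSin y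

/-- The cosine of the difference of the horizontal angles of two points. -/
def horCosDiff (x y : E4) : ℝ := horCos x * horCos y + horSin x * horSin y

/-- The sine of the difference of the vertical angles of two points. -/
def verSinDiff (x y : E4) : ℝ := verSin x * verCos y - verCos x * verSin y

/-- The cosine of the difference of the vertical angles of two points. -/
def verCosDiff (x y : E4) : ℝ := verCos x * verCos y + verSin x * verSin y

/-- For two points with the same projection to the torus, this is positive when the first one lies
in front of the second one. -/
def overHeight (x y : E4) : ℝ :=
  Real.smoothTransition (horCosDiff x y) * (discRadius x * verCosDiff x y - discRadius y) +
    Real.smoothTransition (-horCosDiff x y) * -discRadius y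

theorem continuous_horizontalNorm : Continuous horizontalNorm := by
  unfold horizontalNorm; fun_prop

theorem continuous_verticalNorm : Continuous verticalNorm := by
  unfold verticalNorm; fun_prop

theorem continuous_discRadius : Continuous discRadius := by
  unfold discRadius
  exact continuous_verticalNorm.div (continuous_const.add continuous_horizontalNorm) fun x => by
    have : 0 ≤ horizontalNorm x := Real.sqrt_nonneg _
    positivity

section Continuity

variable {α : Type*} [TopologicalSpace α] {f g : α → E4} {z : α}

theorem ContinuousAt.horCos (hf : ContinuousAt f z) (h : 0 < horizontalNorm (f z)) :
    ContinuousAt (fun z => horCos (f z)) z :=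
  ContinuousAt.div (by fun_prop) (continuous_horizontalNorm.continuousAt.comp hf) h.ne'

theorem ContinuousAt.horSin (hf : ContinuousAt f z) (h : 0 < horizontalNorm (f z)) :
    ContinuousAt (fun z => horSin (f z)) z :=
  ContinuousAt.div (by fun_prop) (continuous_horizontalNorm.continuousAt.comp hf) h.ne'

theorem ContinuousAt.verCos (hf : ContinuousAt f z) (h : 0 < verticalNorm (f z)) :
    ContinuousAt (fun z => verCos (f z)) z :=
  ContinuousAt.div (by fun_prop) (continuous_verticalNorm.continuousAt.comp hf) h.ne'

theorem ContinuousAt.verSin (hf : ContinuousAt f z) (h : 0 < verticalNorm (f z)) :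
    ContinuousAt (fun z => verSin (f z)) z :=
  ContinuousAt.div (by fun_prop) (continuous_verticalNorm.continuousAt.comp hf) h.ne'

theorem ContinuousAt.horSinDiff (hf : ContinuousAt f z) (hg : ContinuousAt g z)
    (h : 0 < horizontalNorm (f z)) (h' : 0 < horizontalNorm (g z)) :
    ContinuousAt (fun z => horSinDiff (f z) (g z)) z :=
  ((ContinuousAt.horSin hf h).mul (ContinuousAt.horCos hg h')).sub
    ((ContinuousAt.horCos hf h).mul (ContinuousAt.horSin hg h'))

theorem ContinuousAt.horCosDiff (hf : ContinuousAt f z) (hg : ContinuousAt g z)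
    (h : 0 < horizontalNorm (f z)) (h' : 0 < horizontalNorm (g z)) :
    ContinuousAt (fun z => horCosDiff (f z) (g z)) z :=
  ((ContinuousAt.horCos hf h).mul (ContinuousAt.horCos hg h')).add
    ((ContinuousAt.horSin hf h).mul (ContinuousAt.horSin hg h'))

theorem ContinuousAt.verSinDiff (hf : ContinuousAt f z) (hg : ContinuousAt g z)
    (h : 0 < verticalNorm (f z)) (h' : 0 < verticalNorm (g z)) :
    ContinuousAt (fun z => verSinDiff (f z) (g z)) z :=
  ((ContinuousAt.verSin hf h).mul (ContinuousAt.verCos hg h')).sub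
    ((ContinuousAt.verCos hf h).mul (ContinuousAt.verSin hg h'))

theorem ContinuousAt.verCosDiff (hf : ContinuousAt f z) (hg : ContinuousAt g z)
    (h : 0 < verticalNorm (f z)) (h' : 0 < verticalNorm (g z)) :
    ContinuousAt (fun z => verCosDiff (f z) (g z)) z :=
  ((ContinuousAt.verCos hf h).mul (ContinuousAt.verCos hg h')).add
    ((ContinuousAt.verSin hf h).mul (ContinuousAt.verSin hg h'))

theorem ContinuousAt.overHeight (hf : ContinuousAt f z) (hg : ContinuousAt g z)
    (h : 0 < horizontalNorm (f z)) (h' : 0 < horizontalNorm (g z)) (k : 0 < verticalNorm (f z))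
    (k' : 0 < verticalNorm (g z)) : ContinuousAt (fun z => overHeight (f z) (g z)) z := by
  have c1 := ContinuousAt.horCosDiff hf hg h h'
  have c2 := ContinuousAt.verCosDiff hf hg k k'
  have t : ∀ {u : α → ℝ}, ContinuousAt u z → ContinuousAt (fun z => Real.smoothTransition (u z)) z :=
    fun hu => Real.smoothTransition.continuous.continuousAt.comp hu
  have d : ∀ {u : α → E4}, ContinuousAt u z → ContinuousAt (fun z => discRadius (u z)) z :=
    fun hu => continuous_discRadius.continuousAt.comp hu
  exact ((t c1).mul (((d hf).mul c2).sub (d hg))).add ((t c1.neg).mul (d hg).neg)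

end Continuity

/-! ### Counting zeros with signs, stably under perturbation -/

theorem sinAt_sub_int (a s : ℝ) (m : ℤ) : sinAt a (s - m) = sinAt a s := by
  rw [sinAt, sinAt, ← Real.sin_sub_int_mul_two_pi (2 * π * (s - a)) m]; ring_nf

theorem cosAt_sub_int (a s : ℝ) (m : ℤ) : cosAt a (s - m) = cosAt a s := by
  rw [cosAt, cosAt, ← Real.cos_sub_int_mul_two_pi (2 * π * (s - a)) m]; ring_nf

theorem linearAt_sub_int (a b p q s t : ℝ) (m n : ℤ) :
    linearAt a b p q (s - m) (t - n) = linearAt a b p q s t := by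
  rw [linearAt, linearAt, sinAt_sub_int, sinAt_sub_int]

theorem torusGap_sub_int (a b s t : ℝ) (m n : ℤ) :
    torusGap a b (s - m) (t - n) = torusGap a b s t := by
  rw [torusGap, torusGap, cosAt_sub_int, cosAt_sub_int]

theorem torusGap_self (a b : ℝ) : torusGap a b a b = 0 := by simp [torusGap, cosAt]; norm_num

/-- The map whose last coordinate is `H` and whose first coordinates are close to linear functions
near their zeros with `0 ≤ H` has the degree that is the sum of the signs of these zeros. -/
theorem mapDegree_eq_sum_sign {ι : Type*} [Fintype ι] {V U H : ℝ → ℝ → ℝ} (hT : TorusMap V U H)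
    {ρ : ℝ} (h0 : 0 < ρ) (h1 : ρ ≤ 1) {a b p q p' q' : ι → ℝ}
    (hd : ∀ i, p i * q' i - q i * p' i ≠ 0)
    (hI : ∀ s t i j, torusGap (a i) (b i) s t < 2 * ρ → torusGap (a j) (b j) s t < 2 * ρ → i = j)
    (hzero : ∀ s t, V s t = 0 → U s t = 0 → 0 ≤ H s t → ∃ i, torusGap (a i) (b i) s t < ρ)
    (hpos : ∀ s t i, torusGap (a i) (b i) s t ≤ 2 * ρ → 0 < H s t)
    (hest : ∀ s t i, ρ ≤ torusGap (a i) (b i) s t → torusGap (a i) (b i) s t ≤ 2 * ρ →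
      (V s t - linearAt (a i) (b i) (p i) (q i) s t) ^ 2 +
        (U s t - linearAt (a i) (b i) (p' i) (q' i) s t) ^ 2 <
      linearAt (a i) (b i) (p i) (q i) s t ^ 2 + linearAt (a i) (b i) (p' i) (q' i) s t ^ 2) :
    mapDegree V U H = ∑ i, ((SignType.sign (p i * q' i - q i * p' i) : ℤ) : ℝ) := by
  have hlt : ∀ {i s t}, bump ρ (a i) (b i) s t ≠ 0 → torusGap (a i) (b i) s t < 2 * ρ :=
    fun h => lt_of_not_ge fun h' => h (bump_eq_zero h0 h')
  have hI' : ∀ s t, ∀ i ∈ Finset.univ, ∀ j ∈ Finset.univ, bump ρ (a i) (b i) s t ≠ 0 →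
      bump ρ (a j) (b j) s t ≠ 0 → i = j := fun s t i _ j _ hi hj => hI s t i j (hlt hi) (hlt hj)
  have hP := torusMap_patch h0 h1 hd hI'
  have key : mapDegree V U H = mapDegree (patchSum Finset.univ ρ a b p q)
      (patchSum Finset.univ ρ a b p' q') (patchHeight Finset.univ ρ a b) := by
    refine mapDegree_eq_of_segment hT hP fun k k0 k1 s t e1 e2 e3 => ?_
    unfold patchSum at e1 e2
    unfold patchHeight at e3
    by_cases hj : ∃ j, bump ρ (a j) (b j) s t ≠ 0
    · obtain ⟨j, hb⟩ := hj
      have hz : ∀ i ∈ Finset.univ, i ≠ j → bump ρ (a i) (b i) s t = 0 := fun i hi hij => by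
        by_contra hn; exact hij (hI' s t i hi j (Finset.mem_univ j) hn hb)
      rw [Finset.sum_eq_single_of_mem j (Finset.mem_univ j) fun i hi hij => by
        rw [hz i hi hij, zero_mul]] at e1 e2
      rw [Finset.sum_eq_single_of_mem j (Finset.mem_univ j) hz] at e3
      have hH := hpos s t j (hlt hb).le
      have hb0 := bump_nonneg ρ (a j) (b j) s t
      -- Where the cut-off is one, both heights are positive and a zero is impossible; only the
      -- annulus where the estimate holds remains.
      have hg : ρ ≤ torusGap (a j) (b j) s t := by
        by_contra hg
        push Not at hg
        rw [bump_eq_one h0 hg.le] at e3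
        nlinarith
      have he := hest s t j hg (hlt hb).le
      set c := k * bump ρ (a j) (b j) s t
      have hc : 0 ≤ c := by positivity
      set A := linearAt (a j) (b j) (p j) (q j) s t
      set B := linearAt (a j) (b j) (p' j) (q' j) s t
      -- At a zero of the segment (V, U) is a non-positive multiple of (A, B), so (V, U) is at least
      -- as far from (A, B) as the origin is, against the estimate.
      have x1 : (1 - k) * V s t = -c * A := by linear_combination e1
      have x2 : (1 - k) * U s t = -c * B := by linear_combination e2
      have y1 : (1 - k) ^ 2 * (V s t - A) ^ 2 = (1 - k + c) ^ 2 * A ^ 2 := by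
        rw [← mul_pow, mul_sub, x1]; ring
      have y2 : (1 - k) ^ 2 * (U s t - B) ^ 2 = (1 - k + c) ^ 2 * B ^ 2 := by
        rw [← mul_pow, mul_sub, x2]; ring
      have hk : 0 < (1 - k) ^ 2 := by have : 0 < 1 - k := by linarith
                                      positivity
      have := mul_lt_mul_of_pos_left he hk
      have hm : (1 - k) ^ 2 ≤ (1 - k + c) ^ 2 := by gcongr; linarith
      nlinarith [sq_nonneg A, sq_nonneg B, mul_le_mul_of_nonneg_right hm (sq_nonneg A),
        mul_le_mul_of_nonneg_right hm (sq_nonneg B)]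
    -- Off all patches the target is (0, 0, −1), so a zero of the segment is a common zero of V and
    -- U with H ≥ 0. Every such point lies where some cut-off is one.
    · push Not at hj
      simp only [hj, zero_mul, Finset.sum_const_zero, zero_sub] at e1 e2 e3
      have hk : 1 - k ≠ 0 := by linarith
      have x1 : V s t = 0 :=
        (mul_eq_zero.1 (by linear_combination e1 : (1 - k) * V s t = 0)).resolve_left hk
      have x2 : U s t = 0 :=
        (mul_eq_zero.1 (by linear_combination e2 : (1 - k) * U s t = 0)).resolve_left hk
      have x3 : 0 ≤ H s t := by
        have : (1 - k) * H s t = k := by linear_combination e3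
        by_contra hn
        push Not at hn
        nlinarith
      obtain ⟨i, hi⟩ := hzero s t x1 x2 x3
      have := hj i
      rw [bump_eq_one h0 hi.le] at this
      exact one_ne_zero this
  rw [key, mapDegree_patch h0 h1 hd hI']
  refine Finset.sum_congr rfl fun i _ => ?_
  rw [localDegree_eq_sign _ _ h0 h1 (hd i)]
  rcases (hd i).lt_or_gt with h | h
  · rw [sign_neg h]; simp
  · rw [sign_pos h]; simp

/-- A loop in four-space that avoids the two core planes. -/
structure OffCoreLoop (K : ℝ → E4) : Prop where
  cont : Continuous K
  periodic : Function.Periodic K 1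
  hor_pos : ∀ s, 0 < horizontalNorm (K s)
  ver_pos : ∀ s, 0 < verticalNorm (K s)

theorem OffCoreLoop.apply_sub_int {K : ℝ → E4} (h : OffCoreLoop K) (s : ℝ) (m : ℤ) :
    K (s - m) = K s := by simpa using h.periodic.sub_int_mul_eq m (x := s)

/-- Loops `A`, `B` near `K₁`, `K₂` have the same crossings where the first strand is in front, with
the same signs. -/
theorem exists_forall_mapDegree_eq_sum_sign {ι : Type*} [Fintype ι] {K₁ K₂ : ℝ → E4}
    (h₁ : OffCoreLoop K₁) (h₂ : OffCoreLoop K₂) {a b p q p' q' : ι → ℝ}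
    (hd : ∀ i, p i * q' i - q i * p' i ≠ 0)
    (hV0 : ∀ i, verSinDiff (K₁ (a i)) (K₂ (b i)) = 0)
    (hU0 : ∀ i, horSinDiff (K₁ (a i)) (K₂ (b i)) = 0)
    (hH : ∀ i, 0 < overHeight (K₁ (a i)) (K₂ (b i)))
    (hV : ∀ i, HasFDerivAt (fun x : ℝ × ℝ => verSinDiff (K₁ x.1) (K₂ x.2))
      (planeForm (p i) (q i)) (a i, b i))
    (hU : ∀ i, HasFDerivAt (fun x : ℝ × ℝ => horSinDiff (K₁ x.1) (K₂ x.2))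
      (planeForm (p' i) (q' i)) (a i, b i))
    (hinj : ∀ i j, ∀ m n : ℤ, a i = a j + m → b i = b j + n → i = j)
    (hzero : ∀ s t, verSinDiff (K₁ s) (K₂ t) = 0 → horSinDiff (K₁ s) (K₂ t) = 0 →
      0 ≤ overHeight (K₁ s) (K₂ t) → ∃ i, ∃ m n : ℤ, s = a i + m ∧ t = b i + n) :
    ∃ ε > 0, ∀ A B : ℝ → E4, (∀ s, dist (A s) (K₁ s) < ε) → (∀ s, dist (B s) (K₂ s) < ε) →
      Function.Periodic A 1 → Function.Periodic B 1 →
      TorusMap (fun s t => verSinDiff (A s) (B t)) (fun s t => horSinDiff (A s) (B t))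
        (fun s t => overHeight (A s) (B t)) →
      mapDegree (fun s t => verSinDiff (A s) (B t)) (fun s t => horSinDiff (A s) (B t))
        (fun s t => overHeight (A s) (B t)) =
      ∑ i, ((SignType.sign (p i * q' i - q i * p' i) : ℤ) : ℝ) := by
  -- estimates at the crossings
  have hδ : ∀ i, ∃ δ > 0, ∀ s t, |s - a i| < δ → |t - b i| < δ →
      0 < overHeight (K₁ s) (K₂ t) ∧ ((s, t) ≠ (a i, b i) →
      (verSinDiff (K₁ s) (K₂ t) - linearAt (a i) (b i) (p i) (q i) s t) ^ 2 +
        (horSinDiff (K₁ s) (K₂ t) - linearAt (a i) (b i) (p' i) (q' i) s t) ^ 2 <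
      linearAt (a i) (b i) (p i) (q i) s t ^ 2 + linearAt (a i) (b i) (p' i) (q' i) s t ^ 2) := by
    intro i
    have e1 := exists_linear_estimate (V := fun s t => verSinDiff (K₁ s) (K₂ t))
      (U := fun s t => horSinDiff (K₁ s) (K₂ t)) (hV0 i) (hU0 i) (hV i) (hU i) (hd i)
    have e2 := (ContinuousAt.overHeight (f := fun x : ℝ × ℝ => K₁ x.1) (g := fun x => K₂ x.2)
      (z := (a i, b i)) (h₁.cont.comp continuous_fst).continuousAt
      (h₂.cont.comp continuous_snd).continuousAt (h₁.hor_pos _) (h₂.hor_pos _) (h₁.ver_pos _)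
      (h₂.ver_pos _)).eventually (lt_mem_nhds (hH i))
    obtain ⟨δ, δ0, hδ⟩ := Metric.eventually_nhds_iff.1 (e2.and e1)
    refine ⟨δ, δ0, fun s t hs ht => ?_⟩
    exact hδ (y := (s, t)) (by rw [Prod.dist_eq]; exact max_lt hs ht)
  choose D D0 hD using hδ
  -- The factor two is for overlapping patches: then one centre is within 2δ of the other modulo
  -- integers.
  obtain ⟨δ, hδ, δ0⟩ : ∃ δ, (∀ i, 2 * δ < D i) ∧ 0 < δ := by
    have e : ∀ᶠ δ : ℝ in 𝓝[>] 0, ∀ i, δ < D i / 2 := Filter.eventually_all.2 fun i =>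
      nhdsWithin_le_nhds (gt_mem_nhds (half_pos (D0 i)))
    obtain ⟨δ, h, h'⟩ := (e.and self_mem_nhdsWithin).exists
    exact ⟨δ, fun i => by linarith [h i], h'⟩
  -- Small enough that gap at most 2ρ implies distance less than δ modulo integers, and at most one
  -- as the patches require.
  set ρ := min (δ ^ 2 / 2) 1 with hρdef
  have ρ0 : 0 < ρ := by positivity
  have ρ1 : ρ ≤ 1 := min_le_right _ _
  have ρδ : ρ < δ ^ 2 := (min_le_left _ _).trans_lt (by nlinarith [sq_pos_of_pos δ0])
  have hnear : ∀ i s t, torusGap (a i) (b i) s t ≤ 2 * ρ → 0 < overHeight (K₁ s) (K₂ t) ∧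
      (torusGap (a i) (b i) s t = 0 ∨
      (verSinDiff (K₁ s) (K₂ t) - linearAt (a i) (b i) (p i) (q i) s t) ^ 2 +
        (horSinDiff (K₁ s) (K₂ t) - linearAt (a i) (b i) (p' i) (q' i) s t) ^ 2 <
      linearAt (a i) (b i) (p i) (q i) s t ^ 2 + linearAt (a i) (b i) (p' i) (q' i) s t ^ 2) := by
    intro i s t h
    obtain ⟨m, n, hm, hn⟩ := exists_int_of_torusGap_le δ0 ρδ h
    obtain ⟨x, y⟩ := hD i (s - m) (t - n) (by linarith [hδ i]) (by linarith [hδ i])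
    simp only [h₁.apply_sub_int, h₂.apply_sub_int, linearAt_sub_int] at x y
    refine ⟨x, ?_⟩
    by_cases he : (s - m, t - n) = (a i, b i)
    · left
      rw [← torusGap_sub_int _ _ s t m n, (Prod.mk.inj he).1, (Prod.mk.inj he).2, torusGap_self]
    · exact .inr (y he)
  have hI : ∀ s t i j, torusGap (a i) (b i) s t < 2 * ρ → torusGap (a j) (b j) s t < 2 * ρ →
      i = j := by
    intro s t i j hi hj
    obtain ⟨m, n, hm, hn⟩ := exists_int_of_torusGap_le δ0 ρδ hi.le
    obtain ⟨m', n', hm', hn'⟩ := exists_int_of_torusGap_le δ0 ρδ hj.le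
    have d1 : |a i - (m' - m : ℤ) - a j| < D j := by
      refine lt_of_le_of_lt ?_ (hδ j)
      rw [show a i - ((m' - m : ℤ) : ℝ) - a j = (s - m' - a j) - (s - m - a i) by push_cast; ring]
      exact (abs_sub _ _).trans (by linarith)
    have d2 : |b i - (n' - n : ℤ) - b j| < D j := by
      refine lt_of_le_of_lt ?_ (hδ j)
      rw [show b i - ((n' - n : ℤ) : ℝ) - b j = (t - n' - b j) - (t - n - b i) by push_cast; ring]
      exact (abs_sub _ _).trans (by linarith)
    obtain ⟨-, y⟩ := hD j _ _ d1 d2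
    by_contra hij
    -- A second centre in the patch would be a common zero of V and U, where the strict estimate
    -- reads A² + B² < A² + B².
    have := y fun he => hij (hinj i j (m' - m) (n' - n) (by linarith [(Prod.mk.inj he).1])
      (by linarith [(Prod.mk.inj he).2]))
    rw [h₁.apply_sub_int, h₂.apply_sub_int, hV0, hU0, zero_sub, zero_sub, neg_sq, neg_sq] at this
    exact lt_irrefl _ this
  -- open conditions
  have hS : IsCompact (Set.Icc (0 : ℝ) 1 ×ˢ Set.Icc (0 : ℝ) 1) := isCompact_Icc.prod isCompact_Icc
  have hg : Continuous fun x : ℝ × ℝ => (K₁ x.1, K₂ x.2) :=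
    (h₁.cont.comp continuous_fst).prodMk (h₂.cont.comp continuous_snd)
  -- The hypotheses of `mapDegree_eq_sum_sign` are stated as alternatives between strict conditions
  -- on the parameters and the two points. They are open, and so they carry over from K₁, K₂ to
  -- nearby A, B.
  have hev : ∀ x ∈ Set.Icc (0 : ℝ) 1 ×ˢ Set.Icc (0 : ℝ) 1,
      ∀ᶠ z : (ℝ × ℝ) × (E4 × E4) in 𝓝 (x, (K₁ x.1, K₂ x.2)),
        ((∃ i, torusGap (a i) (b i) z.1.1 z.1.2 < ρ) ∨ verSinDiff z.2.1 z.2.2 ≠ 0 ∨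
          horSinDiff z.2.1 z.2.2 ≠ 0 ∨ overHeight z.2.1 z.2.2 < 0) ∧
        (∀ i, 2 * ρ < torusGap (a i) (b i) z.1.1 z.1.2 ∨ 0 < overHeight z.2.1 z.2.2) ∧
        ∀ i, 2 * ρ < torusGap (a i) (b i) z.1.1 z.1.2 ∨ torusGap (a i) (b i) z.1.1 z.1.2 < ρ ∨
          (verSinDiff z.2.1 z.2.2 - linearAt (a i) (b i) (p i) (q i) z.1.1 z.1.2) ^ 2 +
            (horSinDiff z.2.1 z.2.2 - linearAt (a i) (b i) (p' i) (q' i) z.1.1 z.1.2) ^ 2 <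
          linearAt (a i) (b i) (p i) (q i) z.1.1 z.1.2 ^ 2 +
            linearAt (a i) (b i) (p' i) (q' i) z.1.1 z.1.2 ^ 2 := by
    rintro ⟨s, t⟩ -
    have cV : ContinuousAt (fun z : (ℝ × ℝ) × (E4 × E4) => verSinDiff z.2.1 z.2.2)
        ((s, t), (K₁ s, K₂ t)) :=
      ContinuousAt.verSinDiff (by fun_prop) (by fun_prop) (h₁.ver_pos s) (h₂.ver_pos t)
    have cU : ContinuousAt (fun z : (ℝ × ℝ) × (E4 × E4) => horSinDiff z.2.1 z.2.2)
        ((s, t), (K₁ s, K₂ t)) :=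
      ContinuousAt.horSinDiff (by fun_prop) (by fun_prop) (h₁.hor_pos s) (h₂.hor_pos t)
    have cH : ContinuousAt (fun z : (ℝ × ℝ) × (E4 × E4) => overHeight z.2.1 z.2.2)
        ((s, t), (K₁ s, K₂ t)) :=
      ContinuousAt.overHeight (by fun_prop) (by fun_prop) (h₁.hor_pos s) (h₂.hor_pos t) (h₁.ver_pos s)
        (h₂.ver_pos t)
    have cg : ∀ i, ContinuousAt (fun z : (ℝ × ℝ) × (E4 × E4) =>
        torusGap (a i) (b i) z.1.1 z.1.2) ((s, t), (K₁ s, K₂ t)) := fun i =>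
      ((mixedC1_torusGap (a i) (b i)).cont.comp continuous_fst).continuousAt
    have cl : ∀ i p q, ContinuousAt (fun z : (ℝ × ℝ) × (E4 × E4) =>
        linearAt (a i) (b i) p q z.1.1 z.1.2) ((s, t), (K₁ s, K₂ t)) := fun i p q =>
      ((mixedC1_linearAt (a i) (b i) p q).cont.comp continuous_fst).continuousAt
    refine .and ?_ (.and (Filter.eventually_all.2 fun i => ?_) (Filter.eventually_all.2 fun i => ?_))
    · by_cases c0 : ∃ i, torusGap (a i) (b i) s t < ρ
      · obtain ⟨i, hi⟩ := c0
        exact ((cg i).eventually (gt_mem_nhds hi)).mono fun z hz => .inl ⟨i, hz⟩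
      by_cases c1 : verSinDiff (K₁ s) (K₂ t) ≠ 0
      · exact (cV.eventually_ne c1).mono fun z hz => .inr (.inl hz)
      by_cases c2 : horSinDiff (K₁ s) (K₂ t) ≠ 0
      · exact (cU.eventually_ne c2).mono fun z hz => .inr (.inr (.inl hz))
      by_cases c3 : overHeight (K₁ s) (K₂ t) < 0
      · exact (cH.eventually (gt_mem_nhds c3)).mono fun z hz => .inr (.inr (.inr hz))
      push Not at c1 c2 c3
      obtain ⟨i, m, n, rfl, rfl⟩ := hzero s t c1 c2 c3
      refine absurd ⟨i, ?_⟩ c0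
      rw [← torusGap_sub_int _ _ _ _ m n, add_sub_cancel_right, add_sub_cancel_right, torusGap_self]
      exact ρ0
    · by_cases c0 : 2 * ρ < torusGap (a i) (b i) s t
      · exact ((cg i).eventually (lt_mem_nhds c0)).mono fun z hz => .inl hz
      · exact (cH.eventually (lt_mem_nhds (hnear i s t (not_lt.1 c0)).1)).mono fun z hz => .inr hz
    · by_cases c0 : 2 * ρ < torusGap (a i) (b i) s t
      · exact ((cg i).eventually (lt_mem_nhds c0)).mono fun z hz => .inl hz
      rcases (hnear i s t (not_lt.1 c0)).2 with c1 | c1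
      · exact ((cg i).eventually (gt_mem_nhds (c1.trans_lt ρ0))).mono fun z hz => .inr (.inl hz)
      · have e := ((cV.sub (cl i (p i) (q i))).pow 2).add ((cU.sub (cl i (p' i) (q' i))).pow 2)
        have e' := ((cl i (p i) (q i)).pow 2).add ((cl i (p' i) (q' i)).pow 2)
        exact (e.eventually_lt e' c1).mono fun z hz => .inr (.inr hz)
  obtain ⟨ε, ε0, hε⟩ := exists_forall_dist_lt_of_eventually hg hS hev
  refine ⟨ε, ε0, fun A B hA hB pA pB hT => ?_⟩
  have hall : ∀ s t, _ := fun s t => hε (Int.fract s, Int.fract t)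
    ⟨⟨Int.fract_nonneg s, (Int.fract_lt_one s).le⟩, ⟨Int.fract_nonneg t, (Int.fract_lt_one t).le⟩⟩
    (A s, B t) (by
      have e1 : K₁ (Int.fract s) = K₁ s := h₁.apply_sub_int s _
      have e2 : K₂ (Int.fract t) = K₂ t := h₂.apply_sub_int t _
      rw [e1, e2, Prod.dist_eq]
      exact max_lt (hA s) (hB t))
  simp only [Int.fract, torusGap_sub_int, linearAt_sub_int] at hall
  refine mapDegree_eq_sum_sign hT ρ0 ρ1 hd hI (fun s t e1 e2 e3 => ?_) (fun s t i e => ?_)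
    fun s t i e1 e2 => ?_
  · rcases (hall s t).1 with h | h | h | h
    · exact h
    · exact absurd e1 h
    · exact absurd e2 h
    · exact absurd e3 (not_le.2 h)
  · exact ((hall s t).2.1 i).resolve_left (not_lt.2 e)
  · exact (((hall s t).2.2 i).resolve_left (not_lt.2 e2)).resolve_left (not_lt.2 e1)

/-! ### The knots in terms of the angle functions -/

theorem horizontalNorm_eq (p : S3) : horizontalNorm p = ‖horizontalPart p‖ := by
  rw [horizontalNorm, Complex.norm_eq_sqrt_sq_add_sq]; rfl

theorem verticalNorm_eq (p : S3) : verticalNorm p = ‖verticalPart p‖ := by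
  rw [verticalNorm, Complex.norm_eq_sqrt_sq_add_sq]
  simp [verticalPart]

theorem depth_eq (p : S3) : depth p = 2 / π * Real.arcsin (horizontalNorm p) := by
  rw [depth, horizontalNorm_eq]

theorem horizontalNorm_nonneg (x : E4) : 0 ≤ horizontalNorm x := Real.sqrt_nonneg _

theorem verticalNorm_nonneg (x : E4) : 0 ≤ verticalNorm x := Real.sqrt_nonneg _

theorem norm_coe_S3 (p : S3) : ‖(p : E4)‖ = 1 := by simp

theorem horizontalNorm_pos {p : S3} (hp : p ∉ coreFront) : 0 < horizontalNorm p := by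
  refine (horizontalNorm_nonneg _).lt_of_ne fun h => hp ?_
  have e := cubeMap_coordinates p
  rw [depth_eq, ← h, Real.arcsin_zero, mul_zero] at e
  exact ⟨_, _, e.symm⟩

theorem verticalNorm_pos {p : S3} (hp : p ∉ coreBack) : 0 < verticalNorm p := by
  refine (verticalNorm_nonneg _).lt_of_ne fun h => hp ?_
  have e := cubeMap_coordinates p
  have hs := horizontalNorm_sq_add p (norm_coe_S3 p)
  rw [← h] at hs
  have h1 : horizontalNorm p = 1 := by
    have := horizontalNorm_nonneg p
    nlinarith
  rw [depth_eq, h1, Real.arcsin_one, div_mul_div_comm, mul_comm, div_self (by positivity)] at e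
  exact ⟨_, _, e.symm⟩

theorem horCos_eq_cos_arg (p : S3) (h : 0 < horizontalNorm p) :
    horCos p = Real.cos (Complex.arg (horizontalPart p)) := by
  rw [horCos, Complex.cos_arg (by rw [← norm_pos_iff, ← horizontalNorm_eq]; exact h),
    horizontalNorm_eq]; rfl

theorem horSin_eq_sin_arg (p : S3) : horSin p = Real.sin (Complex.arg (horizontalPart p)) := by
  rw [horSin, Complex.sin_arg, horizontalNorm_eq]; rfl

theorem verCos_eq_cos_arg (p : S3) (h : 0 < verticalNorm p) :
    verCos p = Real.cos (Complex.arg (verticalPart p)) := by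
  rw [verCos, Complex.cos_arg (by rw [← norm_pos_iff, ← verticalNorm_eq]; exact h),
    verticalNorm_eq]; rfl

theorem verSin_eq_sin_arg (p : S3) : verSin p = Real.sin (Complex.arg (verticalPart p)) := by
  rw [verSin, Complex.sin_arg, verticalNorm_eq]; rfl

theorem exists_int_of_coe_eq {x y : ℝ} (h : (x : UnitAddCircle) = y) : ∃ n : ℤ, x = y + n := by
  have h0 : ((x - y : ℝ) : UnitAddCircle) = 0 := by rw [AddCircle.coe_sub, h, sub_self]
  obtain ⟨n, hn⟩ := (AddCircle.coe_eq_zero_iff 1).1 h0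
  refine ⟨n, ?_⟩
  rw [zsmul_eq_mul, mul_one] at hn
  linarith

theorem coe_add_int (x : ℝ) (n : ℤ) : ((x + n : ℝ) : UnitAddCircle) = x := by
  rw [AddCircle.coe_add, add_eq_left]
  exact (AddCircle.coe_eq_zero_iff 1).2 ⟨n, by simp⟩

theorem cos_sin_of_coe_eq {θ x : ℝ} (h : ((θ / (2 * π) : ℝ) : UnitAddCircle) = x) :
    Real.cos θ = Real.cos (2 * π * x) ∧ Real.sin θ = Real.sin (2 * π * x) := by
  obtain ⟨n, hn⟩ := exists_int_of_coe_eq h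
  have : θ = 2 * π * x + n * (2 * π) := by
    field_simp at hn; linarith
  rw [this, Real.cos_add_int_mul_two_pi, Real.sin_add_int_mul_two_pi]
  exact ⟨rfl, rfl⟩

theorem coe_eq_of_cos_sub {θ η : ℝ} (h : Real.cos (θ - η) = 1) :
    ((θ / (2 * π) : ℝ) : UnitAddCircle) = ((η / (2 * π) : ℝ) : UnitAddCircle) := by
  obtain ⟨n, hn⟩ := (Real.cos_eq_one_iff _).1 h
  have : θ / (2 * π) = η / (2 * π) + n := by field_simp; linarith
  rw [this, coe_add_int]

/-- The coordinates of a point in terms of real numbers representing its projection. -/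
theorem coords_of_torusProj {p : S3} (hh : 0 < horizontalNorm p) (hv : 0 < verticalNorm p)
    {y z : ℝ} (h : torusProj p = ((y : UnitAddCircle), (z : UnitAddCircle))) :
    (horCos p = Real.cos (2 * π * y) ∧ horSin p = Real.sin (2 * π * y)) ∧
      verCos p = Real.cos (2 * π * z) ∧ verSin p = Real.sin (2 * π * z) := by
  rw [horCos_eq_cos_arg p hh, horSin_eq_sin_arg, verCos_eq_cos_arg p hv, verSin_eq_sin_arg]
  exact ⟨cos_sin_of_coe_eq (Prod.ext_iff.1 h).1, cos_sin_of_coe_eq (Prod.ext_iff.1 h).2⟩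

/-- The argument function jumps; the cosines of angle differences express the same condition by
functions that are continuous off the core circles. -/
theorem torusProj_eq_iff {p q : S3} (hp : 0 < horizontalNorm p) (hp' : 0 < verticalNorm p)
    (hq : 0 < horizontalNorm q) (hq' : 0 < verticalNorm q) :
    torusProj p = torusProj q ↔ horCosDiff p q = 1 ∧ verCosDiff p q = 1 := by
  rw [horCosDiff, verCosDiff, horCos_eq_cos_arg p hp, horCos_eq_cos_arg q hq, horSin_eq_sin_arg,
    horSin_eq_sin_arg, verCos_eq_cos_arg p hp', verCos_eq_cos_arg q hq', verSin_eq_sin_arg,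
    verSin_eq_sin_arg, ← Real.cos_sub, ← Real.cos_sub]
  constructor
  · intro h
    have h1 := cos_sin_of_coe_eq (Prod.ext_iff.1 h).1
    have h2 := cos_sin_of_coe_eq (Prod.ext_iff.1 h).2
    have e (θ : ℝ) : 2 * π * (θ / (2 * π)) = θ := by field_simp
    rw [e] at h1 h2
    rw [Real.cos_sub, Real.cos_sub, h1.1, h1.2, h2.1, h2.2, ← sq, ← sq, ← sq, ← sq]
    simp
  · rintro ⟨h1, h2⟩
    exact Prod.ext (coe_eq_of_cos_sub h1) (coe_eq_of_cos_sub h2)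

theorem horCos_sq_add (x : E4) (h : 0 < horizontalNorm x) : horCos x ^ 2 + horSin x ^ 2 = 1 := by
  have : horizontalNorm x ^ 2 = x 0 ^ 2 + x 1 ^ 2 := Real.sq_sqrt (by positivity)
  rw [horCos, horSin]
  field_simp
  exact this.symm

theorem verCos_sq_add (x : E4) (h : 0 < verticalNorm x) : verCos x ^ 2 + verSin x ^ 2 = 1 := by
  have : verticalNorm x ^ 2 = x 2 ^ 2 + x 3 ^ 2 := Real.sq_sqrt (by positivity)
  rw [verCos, verSin]
  field_simp
  exact this.symm

theorem horCosDiff_sq_add {x y : E4} (hx : 0 < horizontalNorm x) (hy : 0 < horizontalNorm y) :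
    horCosDiff x y ^ 2 + horSinDiff x y ^ 2 = 1 := by
  have h1 := horCos_sq_add x hx
  have h2 := horCos_sq_add y hy
  rw [horCosDiff, horSinDiff]
  linear_combination (horCos y ^ 2 + horSin y ^ 2) * h1 + h2

theorem verCosDiff_sq_add {x y : E4} (hx : 0 < verticalNorm x) (hy : 0 < verticalNorm y) :
    verCosDiff x y ^ 2 + verSinDiff x y ^ 2 = 1 := by
  have h1 := verCos_sq_add x hx
  have h2 := verCos_sq_add y hy
  rw [verCosDiff, verSinDiff]
  linear_combination (verCos y ^ 2 + verSin y ^ 2) * h1 + h2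

theorem discRadius_sq {x : E4} (hx : ‖x‖ = 1) :
    discRadius x ^ 2 = (1 - horizontalNorm x) / (1 + horizontalNorm x) := by
  have h := horizontalNorm_sq_add x hx
  have h0 := horizontalNorm_nonneg x
  rw [discRadius, div_pow, div_eq_div_iff (by positivity) (by positivity)]
  linear_combination (1 + horizontalNorm x) * h

theorem discRadius_nonneg (x : E4) : 0 ≤ discRadius x :=
  div_nonneg (verticalNorm_nonneg x) (by have := horizontalNorm_nonneg x; positivity)

/-- The squared radius is (1 − h)/(1 + h), with h the horizontal norm. It decreases in h, while the
depth increases with h. -/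
theorem discRadius_lt_iff (p q : S3) : discRadius q < discRadius p ↔ depth p < depth q := by
  have a := horizontalNorm_nonneg p
  have b := horizontalNorm_nonneg q
  have hp := horizontalNorm_sq_add p (norm_coe_S3 p)
  have hq := horizontalNorm_sq_add q (norm_coe_S3 q)
  rw [depth_eq, depth_eq, mul_lt_mul_iff_right₀ (by positivity),
    Real.strictMonoOn_arcsin.lt_iff_lt ⟨by linarith, by nlinarith [sq_nonneg (verticalNorm p)]⟩
      ⟨by linarith, by nlinarith [sq_nonneg (verticalNorm q)]⟩,
    ← sq_lt_sq₀ (discRadius_nonneg _) (discRadius_nonneg _), discRadius_sq (norm_coe_S3 p),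
    discRadius_sq (norm_coe_S3 q), div_lt_div_iff₀ (by positivity) (by positivity)]
  constructor <;> intro <;> nlinarith

theorem overHeight_of_crossing {x y : E4} (h : horCosDiff x y = 1) (h' : verCosDiff x y = 1) :
    overHeight x y = discRadius x - discRadius y := by
  rw [overHeight, h, h', Real.smoothTransition.one,
    Real.smoothTransition.zero_of_nonpos (by norm_num)]
  ring

theorem discRadius_pos {x : E4} (h : 0 < verticalNorm x) : 0 < discRadius x :=
  div_pos h (by have := horizontalNorm_nonneg x; positivity)

/-- The two sines have common zeros at equal or opposite angles in each direction. Unless both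
differences vanish, the height there is negative. -/
theorem crossing_of_overHeight {x y : E4} (hx : 0 < horizontalNorm x) (hx' : 0 < verticalNorm x)
    (hy : 0 < horizontalNorm y) (hy' : 0 < verticalNorm y) (hV : verSinDiff x y = 0)
    (hU : horSinDiff x y = 0) (hH : 0 ≤ overHeight x y) :
    horCosDiff x y = 1 ∧ verCosDiff x y = 1 := by
  have r := discRadius_pos hx'
  have r' := discRadius_pos hy'
  rcases cos_eq_of_sin_eq_zero (horCosDiff_sq_add hx hy) hU with h | h
  · refine ⟨h, (cos_eq_of_sin_eq_zero (verCosDiff_sq_add hx' hy') hV).resolve_right fun h' => ?_⟩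
    rw [overHeight, h, h', Real.smoothTransition.one,
      Real.smoothTransition.zero_of_nonpos (by norm_num)] at hH
    linarith
  · rw [overHeight, h, neg_neg, Real.smoothTransition.one,
      Real.smoothTransition.zero_of_nonpos (by norm_num)] at hH
    linarith

theorem sinDiff_eq_zero_of_cosDiff {x y : E4} (hx : 0 < horizontalNorm x)
    (hx' : 0 < verticalNorm x) (hy : 0 < horizontalNorm y) (hy' : 0 < verticalNorm y)
    (h : horCosDiff x y = 1) (h' : verCosDiff x y = 1) :
    horSinDiff x y = 0 ∧ verSinDiff x y = 0 := by
  have e := horCosDiff_sq_add hx hy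
  have e' := verCosDiff_sq_add hx' hy'
  rw [h] at e
  rw [h'] at e'
  exact ⟨by nlinarith, by nlinarith⟩

/-- A closed curve in the sphere as a periodic function. -/
def unroll (K : C(UnitAddCircle, S3)) (x : ℝ) : E4 := K (x : UnitAddCircle)

theorem offCoreLoop_unroll {K : C(UnitAddCircle, S3)}
    (h : Disjoint (Set.range K) (coreFront ∪ coreBack)) : OffCoreLoop (unroll K) := by
  have hn : ∀ s, K s ∉ coreFront ∪ coreBack := fun s =>
    Set.disjoint_left.1 h ⟨s, rfl⟩
  refine ⟨?_, fun x => ?_, fun s => horizontalNorm_pos fun h => hn s (.inl h),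
    fun s => verticalNorm_pos fun h => hn s (.inr h)⟩
  · exact continuous_subtype_val.comp (K.continuous.comp (AddCircle.continuous_mk' 1))
  · have := coe_add_int x 1
    rw [Int.cast_one] at this
    rw [unroll, unroll, this]

/-- Near the parameter the angle functions are the cosine and sine of any local lift, so their
derivatives express the velocity without a choice of lift. -/
theorem HasVelocity.hasDerivAt {K : C(UnitAddCircle, S3)} (hK : OffCoreLoop (unroll K)) {a : ℝ}
    {v : ℝ × ℝ} (h : HasVelocity K a v) :
    HasDerivAt (fun x => horCos (unroll K x)) (-(2 * π * v.1 * horSin (unroll K a))) a ∧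
    HasDerivAt (fun x => horSin (unroll K x)) (2 * π * v.1 * horCos (unroll K a)) a ∧
    HasDerivAt (fun x => verCos (unroll K x)) (-(2 * π * v.2 * verSin (unroll K a))) a ∧
    HasDerivAt (fun x => verSin (unroll K x)) (2 * π * v.2 * verCos (unroll K a)) a := by
  obtain ⟨γ, hγ, hd⟩ := h
  have ht : Filter.Tendsto (fun x => x - a) (𝓝 a) (𝓝 0) := by
    have : ContinuousAt (fun x : ℝ => x - a) a := by fun_prop
    simpa [ContinuousAt] using this
  have hev : ∀ᶠ x in 𝓝 a, (horCos (unroll K x) = Real.cos (2 * π * (γ (x - a)).1) ∧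
      horSin (unroll K x) = Real.sin (2 * π * (γ (x - a)).1)) ∧
      verCos (unroll K x) = Real.cos (2 * π * (γ (x - a)).2) ∧
      verSin (unroll K x) = Real.sin (2 * π * (γ (x - a)).2) := by
    filter_upwards [ht.eventually hγ] with x hx
    rw [← AddCircle.coe_add, add_sub_cancel] at hx
    exact coords_of_torusProj (hK.hor_pos x) (hK.ver_pos x) hx
  have h0 := hev.self_of_nhds
  have hd0 : HasDerivAt (fun x => γ (x - a)) v a := by
    have hd' : HasDerivAt γ v (a - a) := by rwa [sub_self]
    exact (hd'.scomp (h := fun x => x - a) a ((hasDerivAt_id a).sub_const a)).congr_deriv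
      (one_smul _ _)
  have d1 : HasDerivAt (fun x => (γ (x - a)).1) v.1 a :=
    (ContinuousLinearMap.fst ℝ ℝ ℝ).hasFDerivAt.comp_hasDerivAt a hd0
  have d2 : HasDerivAt (fun x => (γ (x - a)).2) v.2 a :=
    (ContinuousLinearMap.snd ℝ ℝ ℝ).hasFDerivAt.comp_hasDerivAt a hd0
  refine ⟨((d1.const_mul (2 * π)).cos.congr_of_eventuallyEq (hev.mono fun x h => h.1.1)).congr_deriv
      ?_,
    ((d1.const_mul (2 * π)).sin.congr_of_eventuallyEq (hev.mono fun x h => h.1.2)).congr_deriv ?_,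
    ((d2.const_mul (2 * π)).cos.congr_of_eventuallyEq (hev.mono fun x h => h.2.1)).congr_deriv ?_,
    ((d2.const_mul (2 * π)).sin.congr_of_eventuallyEq (hev.mono fun x h => h.2.2)).congr_deriv ?_⟩
  · rw [h0.1.2]; ring
  · rw [h0.1.1]; ring
  · rw [h0.2.2]; ring
  · rw [h0.2.1]; ring

/-- The signs of crossings are defined by the existence of velocities; uniqueness makes a crossing
positive or negative but not both. -/
theorem HasVelocity.unique {K : C(UnitAddCircle, S3)} (hK : OffCoreLoop (unroll K)) {a : ℝ}
    {u v : ℝ × ℝ} (hu : HasVelocity K a u) (hv : HasVelocity K a v) : u = v := by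
  obtain ⟨a1, a2, a3, a4⟩ := hu.hasDerivAt hK
  obtain ⟨b1, b2, b3, b4⟩ := hv.hasDerivAt hK
  have e1 := a1.unique b1
  have e2 := a2.unique b2
  have e3 := a3.unique b3
  have e4 := a4.unique b4
  have hh := horCos_sq_add _ (hK.hor_pos a)
  have hv := verCos_sq_add _ (hK.ver_pos a)
  have hp : 2 * π ≠ 0 := by positivity
  refine Prod.ext (mul_left_cancel₀ hp ?_) (mul_left_cancel₀ hp ?_)
  · linear_combination horCos (unroll K a) * e2 - horSin (unroll K a) * e1 -
      2 * π * (u.1 - v.1) * hh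
  · linear_combination verCos (unroll K a) * e4 - verSin (unroll K a) * e3 -
      2 * π * (u.2 - v.2) * hv

theorem hasFDerivAt_sinDiff {c₁ s₁ c₂ s₂ : ℝ → ℝ} {a b u v : ℝ}
    (hc₁ : HasDerivAt c₁ (-(2 * π * u * s₁ a)) a) (hs₁ : HasDerivAt s₁ (2 * π * u * c₁ a) a)
    (hc₂ : HasDerivAt c₂ (-(2 * π * v * s₂ b)) b) (hs₂ : HasDerivAt s₂ (2 * π * v * c₂ b) b)
    (h : c₁ a * c₂ b + s₁ a * s₂ b = 1) :
    HasFDerivAt (fun x : ℝ × ℝ => s₁ x.1 * c₂ x.2 - c₁ x.1 * s₂ x.2) (planeForm u (-v)) (a, b) := by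
  have f1 : HasFDerivAt (𝕜 := ℝ) (Prod.fst : ℝ × ℝ → ℝ) _ (a, b) := hasFDerivAt_fst
  have f2 : HasFDerivAt (𝕜 := ℝ) (Prod.snd : ℝ × ℝ → ℝ) _ (a, b) := hasFDerivAt_snd
  have g1 := HasDerivAt.comp_hasFDerivAt (a, b) (h₂ := c₁) hc₁ f1
  have g2 := HasDerivAt.comp_hasFDerivAt (a, b) (h₂ := s₁) hs₁ f1
  have g3 := HasDerivAt.comp_hasFDerivAt (a, b) (h₂ := c₂) hc₂ f2
  have g4 := HasDerivAt.comp_hasFDerivAt (a, b) (h₂ := s₂) hs₂ f2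
  refine ((g2.mul g3).sub (g1.mul g4)).congr_fderiv ?_
  ext
  · simp [planeForm]
    linear_combination 2 * π * u * h
  · simp [planeForm]
    linear_combination - 2 * π * v * h

theorem exists_coe_eq (x : UnitAddCircle) : ∃ r : ℝ, (r : UnitAddCircle) = x :=
  QuotientAddGroup.mk_surjective x

/-! ### Crossings of two diagrams -/

section Pair

variable {K₁ K₂ : C(UnitAddCircle, S3)}

theorem isCrossing_iff (h₁ : OffCoreLoop (unroll K₁)) (h₂ : OffCoreLoop (unroll K₂)) (a b : ℝ) :
    IsCrossing K₁ K₂ a b ↔ horCosDiff (unroll K₁ a) (unroll K₂ b) = 1 ∧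
      verCosDiff (unroll K₁ a) (unroll K₂ b) = 1 :=
  torusProj_eq_iff (h₁.hor_pos a) (h₁.ver_pos a) (h₂.hor_pos b) (h₂.ver_pos b)

/-- Equal projection and equal depth would give a common point of the knots. -/
theorem depth_ne_of_isCrossing (h₁ : OffCoreLoop (unroll K₁)) (h₂ : OffCoreLoop (unroll K₂))
    (hdis : Disjoint (Set.range K₁) (Set.range K₂)) {s t : UnitAddCircle}
    (h : IsCrossing K₁ K₂ s t) : depth (K₁ s) ≠ depth (K₂ t) := by
  obtain ⟨a, rfl⟩ := exists_coe_eq s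
  obtain ⟨b, rfl⟩ := exists_coe_eq t
  intro hdep
  have hr : discRadius (K₁ a) = discRadius (K₂ b) :=
    le_antisymm (not_lt.1 fun h => ((discRadius_lt_iff _ _).1 h).ne hdep)
      (not_lt.1 fun h => ((discRadius_lt_iff _ _).1 h).ne' hdep)
  obtain ⟨hc, hv⟩ := (isCrossing_iff h₁ h₂ a b).1 h
  obtain ⟨hs, hw⟩ := sinDiff_eq_zero_of_cosDiff (h₁.hor_pos a) (h₁.ver_pos a) (h₂.hor_pos b)
    (h₂.ver_pos b) hc hv
  have hb := verCos_sq_add _ (h₂.ver_pos b)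
  rw [verCosDiff] at hv
  rw [verSinDiff] at hw
  have e1 : verCos (unroll K₁ a) = verCos (unroll K₂ b) := by
    linear_combination verCos (unroll K₂ b) * hv - verSin (unroll K₂ b) * hw -
      verCos (unroll K₁ a) * hb
  have e2 : verSin (unroll K₁ a) = verSin (unroll K₂ b) := by
    linear_combination verSin (unroll K₂ b) * hv + verCos (unroll K₂ b) * hw -
      verSin (unroll K₁ a) * hb
  have := eq_of_coords_eq (a := unroll K₁ a) (b := unroll K₂ b) (norm_coe_S3 _) (norm_coe_S3 _)
    (h₁.hor_pos a) (h₁.ver_pos a) (h₂.hor_pos b) (h₂.ver_pos b) hc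
    (congrArg₂ (· * ·) hr e1) (congrArg₂ (· * ·) hr e2)
  exact Set.disjoint_left.1 hdis ⟨a, Subtype.ext this⟩ ⟨b, rfl⟩

theorem hasFDerivAt_verSinDiff (h₁ : OffCoreLoop (unroll K₁)) (h₂ : OffCoreLoop (unroll K₂))
    {a b : ℝ} {u v : ℝ × ℝ} (hu : HasVelocity K₁ a u) (hv : HasVelocity K₂ b v)
    (h : IsCrossing K₁ K₂ a b) :
    HasFDerivAt (fun x : ℝ × ℝ => verSinDiff (unroll K₁ x.1) (unroll K₂ x.2))
      (planeForm u.2 (-v.2)) (a, b) := by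
  obtain ⟨-, -, d1, d2⟩ := hu.hasDerivAt h₁
  obtain ⟨-, -, d3, d4⟩ := hv.hasDerivAt h₂
  exact hasFDerivAt_sinDiff (c₁ := fun x => verCos (unroll K₁ x))
    (s₁ := fun x => verSin (unroll K₁ x)) (c₂ := fun x => verCos (unroll K₂ x))
    (s₂ := fun x => verSin (unroll K₂ x)) d1 d2 d3 d4 ((isCrossing_iff h₁ h₂ a b).1 h).2

theorem hasFDerivAt_horSinDiff (h₁ : OffCoreLoop (unroll K₁)) (h₂ : OffCoreLoop (unroll K₂))
    {a b : ℝ} {u v : ℝ × ℝ} (hu : HasVelocity K₁ a u) (hv : HasVelocity K₂ b v)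
    (h : IsCrossing K₁ K₂ a b) :
    HasFDerivAt (fun x : ℝ × ℝ => horSinDiff (unroll K₁ x.1) (unroll K₂ x.2))
      (planeForm u.1 (-v.1)) (a, b) := by
  obtain ⟨d1, d2, -, -⟩ := hu.hasDerivAt h₁
  obtain ⟨d3, d4, -, -⟩ := hv.hasDerivAt h₂
  exact hasFDerivAt_sinDiff (c₁ := fun x => horCos (unroll K₁ x))
    (s₁ := fun x => horSin (unroll K₁ x)) (c₂ := fun x => horCos (unroll K₂ x))
    (s₂ := fun x => horSin (unroll K₂ x)) d1 d2 d3 d4 ((isCrossing_iff h₁ h₂ a b).1 h).1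

/-- The crossings in a period square form a compact set, and transversality makes each of them
isolated: at another crossing nearby the linear estimate would read A² + B² < A² + B². -/
theorem finite_crossings (h₁ : OffCoreLoop (unroll K₁)) (h₂ : OffCoreLoop (unroll K₂))
    (hgen : InGeneralPosition K₁ K₂) :
    {st : UnitAddCircle × UnitAddCircle | IsCrossing K₁ K₂ st.1 st.2}.Finite := by
  have c1 : Continuous fun x : ℝ × ℝ => horCosDiff (unroll K₁ x.1) (unroll K₂ x.2) :=
    continuous_iff_continuousAt.2 fun x => ContinuousAt.horCosDiff
      (h₁.cont.comp continuous_fst).continuousAt (h₂.cont.comp continuous_snd).continuousAt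
      (h₁.hor_pos _) (h₂.hor_pos _)
  have c2 : Continuous fun x : ℝ × ℝ => verCosDiff (unroll K₁ x.1) (unroll K₂ x.2) :=
    continuous_iff_continuousAt.2 fun x => ContinuousAt.verCosDiff
      (h₁.cont.comp continuous_fst).continuousAt (h₂.cont.comp continuous_snd).continuousAt
      (h₁.ver_pos _) (h₂.ver_pos _)
  set C : Set (ℝ × ℝ) := Set.Icc (0 : ℝ) 1 ×ˢ Set.Icc (0 : ℝ) 1 ∩
    ({x | horCosDiff (unroll K₁ x.1) (unroll K₂ x.2) = 1} ∩
      {x | verCosDiff (unroll K₁ x.1) (unroll K₂ x.2) = 1}) with hC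
  have hcomp : IsCompact C := (isCompact_Icc.prod isCompact_Icc).inter_right
    ((isClosed_eq c1 continuous_const).inter (isClosed_eq c2 continuous_const))
  have hmem : ∀ x ∈ C, IsCrossing K₁ K₂ x.1 x.2 := fun x hx =>
    (isCrossing_iff h₁ h₂ x.1 x.2).2 hx.2
  have hzero : ∀ x ∈ C, horSinDiff (unroll K₁ x.1) (unroll K₂ x.2) = 0 ∧
      verSinDiff (unroll K₁ x.1) (unroll K₂ x.2) = 0 := fun x hx =>
    sinDiff_eq_zero_of_cosDiff (h₁.hor_pos _) (h₁.ver_pos _) (h₂.hor_pos _) (h₂.ver_pos _) hx.2.1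
      hx.2.2
  have hfin : C.Finite := by
    by_contra hinf
    obtain ⟨⟨a, b⟩, hx, hacc⟩ :=
      Set.Infinite.exists_accPt_of_subset_isCompact hinf hcomp subset_rfl
    have hcr := hmem _ hx
    obtain ⟨u, v, hu, hv, huv⟩ := hgen _ _ hcr
    have est := exists_linear_estimate
      (V := fun s t => verSinDiff (unroll K₁ s) (unroll K₂ t))
      (U := fun s t => horSinDiff (unroll K₁ s) (unroll K₂ t)) (hzero _ hx).2 (hzero _ hx).1
      (hasFDerivAt_verSinDiff h₁ h₂ hu hv hcr) (hasFDerivAt_horSinDiff h₁ h₂ hu hv hcr)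
      (by intro h; exact huv (by linarith))
    obtain ⟨y, ⟨hy, hyC⟩, hest⟩ := ((accPt_iff_frequently.1 hacc).and_eventually est).exists
    have := hest hy
    simp only [(hzero y hyC).1, (hzero y hyC).2, zero_sub, neg_sq, lt_irrefl] at this
  refine (hfin.image fun x : ℝ × ℝ => ((x.1 : UnitAddCircle), (x.2 : UnitAddCircle))).subset ?_
  rintro ⟨s, t⟩ hst
  obtain ⟨a, rfl⟩ := exists_coe_eq s
  obtain ⟨b, rfl⟩ := exists_coe_eq t
  have e : ∀ x : ℝ, ((Int.fract x : ℝ) : UnitAddCircle) = x := fun x => by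
    rw [← coe_add_int (Int.fract x) ⌊x⌋, Int.fract_add_floor]
  refine ⟨(Int.fract a, Int.fract b), ⟨⟨⟨Int.fract_nonneg a, (Int.fract_lt_one a).le⟩,
    ⟨Int.fract_nonneg b, (Int.fract_lt_one b).le⟩⟩, ?_⟩, by simp only [e]⟩
  refine (isCrossing_iff h₁ h₂ (Int.fract a) (Int.fract b)).1 ?_
  rw [e, e]
  exact hst

variable (K₁ K₂) in
/-- The positive crossings at which the first strand crosses over the second one. -/
def frontPos : Set (UnitAddCircle × UnitAddCircle) :=
  {st | IsPositiveCrossing K₁ K₂ st.1 st.2 ∧ depth (K₁ st.1) < depth (K₂ st.2)}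

variable (K₁ K₂) in
/-- The negative crossings at which the first strand crosses over the second one. -/
def frontNeg : Set (UnitAddCircle × UnitAddCircle) :=
  {st | IsNegativeCrossing K₁ K₂ st.1 st.2 ∧ depth (K₁ st.1) < depth (K₂ st.2)}

theorem sum_subtype_indicator {α : Type*} {S T : Set α} [Fintype S] (h : T ⊆ S) [DecidablePred (· ∈ T)] :
    ∑ i : S, (if (i : α) ∈ T then (1 : ℝ) else 0) = T.ncard := by
  rw [Finset.sum_boole, ← Finset.card_map (Function.Embedding.subtype _), ← Set.ncard_coe_finset]
  congr 2
  ext x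
  simp only [Finset.coe_map, Function.Embedding.subtype_apply, Set.mem_image, Finset.mem_coe,
    Finset.mem_filter, Finset.mem_univ, true_and]
  exact ⟨fun ⟨i, hi, e⟩ => e ▸ hi, fun hx => ⟨⟨x, h hx⟩, hx, rfl⟩⟩

theorem sign_eq_indicator (h₁ : OffCoreLoop (unroll K₁)) (h₂ : OffCoreLoop (unroll K₂))
    {s t : UnitAddCircle} (hc : IsCrossing K₁ K₂ s t) (hd : depth (K₁ s) < depth (K₂ t))
    {u v : ℝ × ℝ} (hu : HasVelocity K₁ s u) (hv : HasVelocity K₂ t v)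
    (huv : u.1 * v.2 - u.2 * v.1 ≠ 0) [Decidable ((s, t) ∈ frontPos K₁ K₂)]
    [Decidable ((s, t) ∈ frontNeg K₁ K₂)] :
    ((SignType.sign (u.1 * v.2 - u.2 * v.1) : ℤ) : ℝ) =
      (if (s, t) ∈ frontPos K₁ K₂ then (1 : ℝ) else 0) -
        if (s, t) ∈ frontNeg K₁ K₂ then (1 : ℝ) else 0 := by
  obtain ⟨a, rfl⟩ := exists_coe_eq s
  obtain ⟨b, rfl⟩ := exists_coe_eq t
  have hd' := sub_pos.2 hd
  rcases huv.lt_or_gt with h | h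
  · have hn : ((a : UnitAddCircle), (b : UnitAddCircle)) ∈ frontNeg K₁ K₂ :=
      ⟨⟨hc, u, v, hu, hv, mul_neg_of_pos_of_neg hd' h⟩, hd⟩
    have hp : ((a : UnitAddCircle), (b : UnitAddCircle)) ∉ frontPos K₁ K₂ := by
      rintro ⟨⟨-, u', v', hu', hv', h'⟩, -⟩
      rw [hu'.unique h₁ hu, hv'.unique h₂ hv] at h'
      exact absurd h' (mul_neg_of_pos_of_neg hd' h).le.not_gt
    rw [if_neg hp, if_pos hn, sign_neg h]
    simp
  · have hn : ((a : UnitAddCircle), (b : UnitAddCircle)) ∈ frontPos K₁ K₂ :=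
      ⟨⟨hc, u, v, hu, hv, mul_pos hd' h⟩, hd⟩
    have hp : ((a : UnitAddCircle), (b : UnitAddCircle)) ∉ frontNeg K₁ K₂ := by
      rintro ⟨⟨-, u', v', hu', hv', h'⟩, -⟩
      rw [hu'.unique h₁ hu, hv'.unique h₂ hv] at h'
      exact absurd h' (mul_pos hd' h).le.not_gt
    rw [if_pos hn, if_neg hp, sign_pos h]
    simp

theorem exists_forall_mapDegree_eq_front (h₁ : OffCoreLoop (unroll K₁))
    (h₂ : OffCoreLoop (unroll K₂)) (hdis : Disjoint (Set.range K₁) (Set.range K₂))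
    (hgen : InGeneralPosition K₁ K₂) :
    ∃ ε > 0, ∀ A B : ℝ → E4, (∀ s, dist (A s) (unroll K₁ s) < ε) →
      (∀ s, dist (B s) (unroll K₂ s) < ε) → Function.Periodic A 1 → Function.Periodic B 1 →
      TorusMap (fun s t => verSinDiff (A s) (B t)) (fun s t => horSinDiff (A s) (B t))
        (fun s t => overHeight (A s) (B t)) →
      mapDegree (fun s t => verSinDiff (A s) (B t)) (fun s t => horSinDiff (A s) (B t))
        (fun s t => overHeight (A s) (B t)) =
      (frontPos K₁ K₂).ncard - (frontNeg K₁ K₂).ncard := by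
  classical
  set S : Set (UnitAddCircle × UnitAddCircle) :=
    {st | IsCrossing K₁ K₂ st.1 st.2 ∧ depth (K₁ st.1) < depth (K₂ st.2)} with hS
  have hfin : S.Finite := (finite_crossings h₁ h₂ hgen).subset fun st h => h.1
  let _ : Fintype S := hfin.fintype
  choose rep hrep using exists_coe_eq
  choose u v hu hv huv using fun i : S => hgen _ _ i.2.1
  have hu' : ∀ i : S, HasVelocity K₁ (rep i.1.1) (u i) := fun i => by rw [hrep]; exact hu i
  have hv' : ∀ i : S, HasVelocity K₂ (rep i.1.2) (v i) := fun i => by rw [hrep]; exact hv i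
  have hcr : ∀ i : S, IsCrossing K₁ K₂ (rep i.1.1) (rep i.1.2) := fun i => by
    rw [hrep, hrep]; exact i.2.1
  have hcos := fun i : S => (isCrossing_iff h₁ h₂ _ _).1 (hcr i)
  have hsin := fun i : S => sinDiff_eq_zero_of_cosDiff (h₁.hor_pos _) (h₁.ver_pos _) (h₂.hor_pos _)
    (h₂.ver_pos _) (hcos i).1 (hcos i).2
  -- The crossing map lists the vertical coordinate before the horizontal one, which reverses the
  -- orientation, and the second strand enters with a minus sign. Together these give the
  -- determinant of the two velocities with sign plus.
  have hdet : ∀ i : S, (u i).2 * -(v i).1 - -(v i).2 * (u i).1 =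
    (u i).1 * (v i).2 - (u i).2 * (v i).1 := fun i => by ring
  obtain ⟨ε, ε0, hε⟩ := exists_forall_mapDegree_eq_sum_sign h₁ h₂ (a := fun i : S => rep i.1.1)
    (b := fun i => rep i.1.2) (p := fun i => (u i).2) (q := fun i => -(v i).2)
    (p' := fun i => (u i).1) (q' := fun i => -(v i).1) (fun i => by rw [hdet]; exact huv i)
    (fun i => (hsin i).2) (fun i => (hsin i).1)
    (fun i => by
      rw [overHeight_of_crossing (hcos i).1 (hcos i).2, sub_pos]
      refine (discRadius_lt_iff _ _).2 ?_
      rw [hrep, hrep]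
      exact i.2.2)
    (fun i => hasFDerivAt_verSinDiff h₁ h₂ (hu' i) (hv' i) (hcr i))
    (fun i => hasFDerivAt_horSinDiff h₁ h₂ (hu' i) (hv' i) (hcr i))
    (fun i j m n h h' => Subtype.ext (Prod.ext
      (by rw [← hrep i.1.1, h, coe_add_int, hrep]) (by rw [← hrep i.1.2, h', coe_add_int, hrep])))
    -- A common zero with height ≥ 0 is a crossing at which the first strand is not deeper; equal
    -- depths are excluded because the knots are disjoint.
    (fun s t hV hU hH => by
      obtain ⟨x, y⟩ := crossing_of_overHeight (h₁.hor_pos s) (h₁.ver_pos s) (h₂.hor_pos t)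
        (h₂.ver_pos t) hV hU hH
      have hc := (isCrossing_iff h₁ h₂ s t).2 ⟨x, y⟩
      rw [overHeight_of_crossing x y, sub_nonneg] at hH
      have hd : depth (K₁ s) ≤ depth (K₂ t) :=
        not_lt.1 fun h => absurd ((discRadius_lt_iff _ _).2 h) (not_lt.2 hH)
      obtain ⟨m, hm⟩ := exists_int_of_coe_eq (hrep s).symm
      obtain ⟨n, hn⟩ := exists_int_of_coe_eq (hrep t).symm
      exact ⟨⟨(s, t), hc, hd.lt_of_ne (depth_ne_of_isCrossing h₁ h₂ hdis hc)⟩, m, n, hm, hn⟩)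
  refine ⟨ε, ε0, fun A B hA hB pA pB hT => ?_⟩
  rw [hε A B hA hB pA pB hT]
  simp only [hdet]
  rw [Finset.sum_congr rfl fun i _ =>
    sign_eq_indicator h₁ h₂ i.2.1 i.2.2 (hu i) (hv i) (huv i), Finset.sum_sub_distrib]
  exact congrArg₂ (· - ·) (sum_subtype_indicator (S := S) fun st h => ⟨h.1.1, h.2⟩)
    (sum_subtype_indicator (S := S) fun st h => ⟨h.1.1, h.2⟩)

theorem isPositiveCrossing_comm {s t : UnitAddCircle} :
    IsPositiveCrossing K₂ K₁ t s ↔ IsPositiveCrossing K₁ K₂ s t := by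
  refine and_congr eq_comm ⟨fun ⟨u, v, hu, hv, h⟩ => ⟨v, u, hv, hu, ?_⟩,
    fun ⟨u, v, hu, hv, h⟩ => ⟨v, u, hv, hu, ?_⟩⟩ <;> linarith

theorem isNegativeCrossing_comm {s t : UnitAddCircle} :
    IsNegativeCrossing K₂ K₁ t s ↔ IsNegativeCrossing K₁ K₂ s t := by
  refine and_congr eq_comm ⟨fun ⟨u, v, hu, hv, h⟩ => ⟨v, u, hv, hu, ?_⟩,
    fun ⟨u, v, hu, hv, h⟩ => ⟨v, u, hv, hu, ?_⟩⟩ <;> linarith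

theorem inGeneralPosition_comm (h : InGeneralPosition K₁ K₂) : InGeneralPosition K₂ K₁ := by
  intro s t hst
  obtain ⟨u, v, hu, hv, huv⟩ := h t s (Eq.symm hst)
  exact ⟨v, u, hv, hu, fun h => huv (by linarith)⟩

/-- The crossings are sorted by which strand is over. Those with the second strand over are written
with the factors swapped, ready for the formula with the knots exchanged. -/
theorem ncard_split {P : UnitAddCircle → UnitAddCircle → Prop}
    (hfin : {st : UnitAddCircle × UnitAddCircle | P st.1 st.2}.Finite)
    (hne : ∀ s t, P s t → depth (K₁ s) ≠ depth (K₂ t)) :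
    {st : UnitAddCircle × UnitAddCircle | P st.1 st.2}.ncard =
      {st : UnitAddCircle × UnitAddCircle | P st.1 st.2 ∧
        depth (K₁ st.1) < depth (K₂ st.2)}.ncard +
      {st : UnitAddCircle × UnitAddCircle | P st.2 st.1 ∧
        depth (K₂ st.1) < depth (K₁ st.2)}.ncard := by
  have e : {st : UnitAddCircle × UnitAddCircle | P st.2 st.1 ∧
      depth (K₂ st.1) < depth (K₁ st.2)} = Prod.swap ''
      {st : UnitAddCircle × UnitAddCircle | P st.1 st.2 ∧ depth (K₂ st.2) < depth (K₁ st.1)} := by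
    rw [Set.image_swap_eq_preimage_swap]; rfl
  rw [e, Set.ncard_image_of_injective _ Prod.swap_injective, ← Set.ncard_union_eq ?_
    (hfin.subset fun _ h => h.1) (hfin.subset fun _ h => h.1)]
  · congr 1
    ext st
    constructor
    · intro h
      exact (hne _ _ h).lt_or_gt.imp (fun h' => ⟨h, h'⟩) fun h' => ⟨h, h'⟩
    · rintro (h | h) <;> exact h.1
  · exact Set.disjoint_left.2 fun st h h' => lt_asymm h.2 h'.2

theorem crossPos_eq (h₁ : OffCoreLoop (unroll K₁)) (h₂ : OffCoreLoop (unroll K₂))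
    (hdis : Disjoint (Set.range K₁) (Set.range K₂)) (hgen : InGeneralPosition K₁ K₂) :
    crossPos K₁ K₂ = (frontPos K₁ K₂).ncard + (frontPos K₂ K₁).ncard := by
  rw [crossPos, ncard_split (K₁ := K₁) (K₂ := K₂)
    ((finite_crossings h₁ h₂ hgen).subset fun _ h => h.1)
    fun s t h => depth_ne_of_isCrossing h₁ h₂ hdis h.1]
  simp only [frontPos, isPositiveCrossing_comm (K₁ := K₂) (K₂ := K₁)]

theorem crossNeg_eq (h₁ : OffCoreLoop (unroll K₁)) (h₂ : OffCoreLoop (unroll K₂))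
    (hdis : Disjoint (Set.range K₁) (Set.range K₂)) (hgen : InGeneralPosition K₁ K₂) :
    crossNeg K₁ K₂ = (frontNeg K₁ K₂).ncard + (frontNeg K₂ K₁).ncard := by
  rw [crossNeg, ncard_split (K₁ := K₁) (K₂ := K₂)
    ((finite_crossings h₁ h₂ hgen).subset fun _ h => h.1)
    fun s t h => depth_ne_of_isCrossing h₁ h₂ hdis h.1]
  simp only [frontNeg, isNegativeCrossing_comm (K₁ := K₂) (K₂ := K₁)]

end Pair

/-! ### Lifting the angles of the projections -/

/-- A self-map of the circle that is homotopic to the multiplication by `a` differs from it by a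
function that lifts to the line. -/
theorem exists_lift_of_homotopic {f : C(UnitAddCircle, UnitAddCircle)} {a : ℤ}
    {m : C(UnitAddCircle, UnitAddCircle)} (hm : ∀ s, m s = a • s) (h : f.Homotopic m) :
    ∃ g : C(UnitAddCircle, ℝ), ∀ s, f s = a • s + (g s : UnitAddCircle) := by
  -- The homotopy is run from multiplication by a to f. After subtraction of multiplication by a it
  -- starts at the constant zero, which has a global lift, and homotopy lifting does the rest.
  obtain ⟨F⟩ := h.symm
  let G : C(unitInterval × UnitAddCircle, UnitAddCircle) :=
    ⟨fun x => F x - a • x.2, by fun_prop⟩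
  have cov := AddCircle.isCoveringMap_coe (1 : ℝ)
  have h0 : ∀ s, G (0, s) = (((0 : C(UnitAddCircle, ℝ)) s : ℝ) : UnitAddCircle) := fun s => by
    simp [G, hm]
  refine ⟨(cov.liftHomotopy G 0 h0).comp (.prodMk (.const _ 1) (.id _)), fun s => ?_⟩
  have e := congr_fun (cov.liftHomotopy_lifts G 0 h0) (1, s)
  have e' : G (1, s) = f s - a • s := by simp [G]
  rw [e'] at e
  rw [← sub_eq_iff_eq_add', ← e]
  rfl

theorem HasHomotopyType.exists_lift {K : C(UnitAddCircle, S3)} {a b : ℤ}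
    (h : HasHomotopyType K a b) : ∃ g k : C(UnitAddCircle, ℝ), ∀ x : ℝ,
      torusProj (K x) = (((a * x + g x : ℝ) : UnitAddCircle), ((b * x + k x : ℝ) : UnitAddCircle)) := by
  obtain ⟨D, hD, hom⟩ := h
  obtain ⟨g, hg⟩ := exists_lift_of_homotopic (a := a)
    (m := (ContinuousMap.fst : C(Torus, UnitAddCircle)).comp (torusLoop a b)) (fun s => rfl)
    ((ContinuousMap.Homotopic.refl (ContinuousMap.fst : C(Torus, UnitAddCircle))).comp hom)
  obtain ⟨k, hk⟩ := exists_lift_of_homotopic (a := b)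
    (m := (ContinuousMap.snd : C(Torus, UnitAddCircle)).comp (torusLoop a b)) (fun s => rfl)
    ((ContinuousMap.Homotopic.refl (ContinuousMap.snd : C(Torus, UnitAddCircle))).comp hom)
  refine ⟨g, k, fun x => ?_⟩
  rw [← hD]
  have e (a : ℤ) : ((a * x : ℝ) : UnitAddCircle) = a • (x : UnitAddCircle) := by
    rw [← AddCircle.coe_zsmul, zsmul_eq_mul]
  rw [AddCircle.coe_add, AddCircle.coe_add, e, e]
  exact Prod.ext (hg x) (hk x)

/-- Near x the function φ equals φ(x) plus arcsin of the sine of the angle difference, divided by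
2π, and arcsin is smooth near zero. -/
theorem contDiff_of_cos_sin {φ c s : ℝ → ℝ} (hφ : Continuous φ) (hc : ContDiff ℝ 1 c)
    (hs : ContDiff ℝ 1 s) (ec : ∀ x, c x = Real.cos (2 * π * φ x))
    (es : ∀ x, s x = Real.sin (2 * π * φ x)) : ContDiff ℝ 1 φ := by
  rw [contDiff_iff_contDiffAt]
  intro x
  have hval : s x * c x - c x * s x = 0 := by ring
  have hd : ContDiffAt ℝ 1 (fun y => φ x + Real.arcsin (s y * c x - c y * s x) / (2 * π)) x := by
    refine contDiffAt_const.add (ContDiffAt.div_const ?_ _)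
    refine ContDiffAt.comp x (g := Real.arcsin) (f := fun y => s y * c x - c y * s x) ?_ ?_
    · rw [hval]; exact Real.contDiffAt_arcsin (by norm_num) (by norm_num)
    · exact ((hs.mul contDiff_const).sub (hc.mul contDiff_const)).contDiffAt
  refine hd.congr_of_eventuallyEq ?_
  have hcont : ContinuousAt (fun y => |2 * π * (φ y - φ x)|) x := by fun_prop
  have hlt : |2 * π * (φ x - φ x)| < π / 2 := by simp; positivity
  filter_upwards [hcont.eventually (gt_mem_nhds hlt)] with y hy
  have e : s y * c x - c y * s x = Real.sin (2 * π * (φ y - φ x)) := by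
    rw [mul_sub, Real.sin_sub, ec, ec, es, es]
  rw [e, Real.arcsin_sin (abs_lt.1 hy).1.le (abs_lt.1 hy).2.le]
  field_simp
  ring

/-- A continuously differentiable loop in the unit circle near a loop with a lift has a continuously
differentiable lift. -/
theorem exists_angle {c s g : ℝ → ℝ} {a : ℤ} (hc : ContDiff ℝ 1 c) (hs : ContDiff ℝ 1 s)
    (pc : ∀ x, c (x + 1) = c x) (ps : ∀ x, s (x + 1) = s x) (hcs : ∀ x, c x ^ 2 + s x ^ 2 = 1)
    (hg : Continuous g) (pg : ∀ x, g (x + 1) = g x)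
    (hpos : ∀ x, 0 < c x * Real.cos (2 * π * (a * x + g x)) +
      s x * Real.sin (2 * π * (a * x + g x))) :
    ∃ u : ℝ → ℝ, ContDiff ℝ 1 u ∧ (∀ x, u (x + 1) = u x) ∧
      (∀ x, c x = Real.cos (2 * π * (a * x + u x))) ∧
      ∀ x, s x = Real.sin (2 * π * (a * x + u x)) := by
  set C : ℝ → ℝ := fun x => Real.cos (2 * π * (a * x + g x)) with hC
  set S : ℝ → ℝ := fun x => Real.sin (2 * π * (a * x + g x)) with hS
  have hCS : ∀ x, C x ^ 2 + S x ^ 2 = 1 := fun x => Real.cos_sq_add_sin_sq _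
  have pC : ∀ x, C (x + 1) = C x := fun x => by
    simp only [hC, pg]
    rw [← Real.cos_add_int_mul_two_pi (2 * π * (a * x + g x)) a]
    ring_nf
  have pS : ∀ x, S (x + 1) = S x := fun x => by
    simp only [hS, pg]
    rw [← Real.sin_add_int_mul_two_pi (2 * π * (a * x + g x)) a]
    ring_nf
  have cc := hc.continuous
  have cs := hs.continuous
  set σ : ℝ → ℝ := fun x => s x * C x - c x * S x with hσ
  have hone : ∀ x, (c x * C x + s x * S x) ^ 2 + σ x ^ 2 = 1 := fun x => by
    simp only [hσ]
    linear_combination (C x ^ 2 + S x ^ 2) * hcs x + hCS x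
  have hle : ∀ x, -1 ≤ σ x ∧ σ x ≤ 1 := fun x => by
    have := hone x
    constructor <;> nlinarith [sq_nonneg (c x * C x + s x * S x)]
  have hsin : ∀ x, Real.sin (Real.arcsin (σ x)) = σ x := fun x =>
    Real.sin_arcsin (hle x).1 (hle x).2
  have hcos : ∀ x, Real.cos (Real.arcsin (σ x)) = c x * C x + s x * S x := fun x => by
    rw [Real.cos_arcsin, show 1 - σ x ^ 2 = (c x * C x + s x * S x) ^ 2 by linarith [hone x],
      Real.sqrt_sq (hpos x).le]
  -- The correction is the angle from the lifted loop to the given one. Its sine is σ and its cosine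
  -- is positive, so arcsin σ recovers it continuously and without ambiguity.
  set u : ℝ → ℝ := fun x => g x + Real.arcsin (σ x) / (2 * π) with hu
  have harg : ∀ x, 2 * π * (a * x + u x) = 2 * π * (a * x + g x) + Real.arcsin (σ x) := fun x => by
    simp only [hu]; field_simp; ring
  have ec : ∀ x, c x = Real.cos (2 * π * (a * x + u x)) := fun x => by
    rw [harg, Real.cos_add, hsin, hcos]
    change c x = C x * (c x * C x + s x * S x) - S x * (s x * C x - c x * S x)
    linear_combination -c x * hCS x
  have es : ∀ x, s x = Real.sin (2 * π * (a * x + u x)) := fun x => by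
    rw [harg, Real.sin_add, hsin, hcos]
    change s x = S x * (c x * C x + s x * S x) + C x * (s x * C x - c x * S x)
    linear_combination -s x * hCS x
  have cu : Continuous u := by
    have : Continuous σ := by simp only [hσ, hC, hS]; fun_prop
    exact hg.add ((Real.continuous_arcsin.comp this).div_const _)
  refine ⟨u, ?_, fun x => ?_, ec, es⟩
  · have := contDiff_of_cos_sin (φ := fun x => a * x + u x) (by fun_prop) hc hs ec es
    have h2 := this.sub (contDiff_const.mul contDiff_id : ContDiff ℝ 1 fun x : ℝ => (a : ℝ) * x)
    simpa using h2
  · simp only [hu, hσ, pg, pC, pS, pc, ps]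

/-! ### Approximation by continuously differentiable loops -/

theorem uniformContinuous_of_periodic {E : Type*} [PseudoMetricSpace E] {K : ℝ → E}
    (hK : Continuous K) (pK : Function.Periodic K 1) {δ : ℝ} (hδ : 0 < δ) :
    ∃ η > 0, ∀ x y, |x - y| < η → dist (K x) (K y) < δ := by
  have hu : UniformContinuousOn K (Set.Icc (-1) 2) :=
    isCompact_Icc.uniformContinuousOn_of_continuous hK.continuousOn
  obtain ⟨η, η0, hη⟩ := Metric.uniformContinuousOn_iff.1 hu δ hδ
  refine ⟨min η 1, lt_min η0 one_pos, fun x y h => ?_⟩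
  have e : ∀ z, K (z - ⌊x⌋) = K z := fun z => by simpa using pK.sub_int_mul_eq ⌊x⌋ (x := z)
  have h1 := Int.floor_le x
  have h2 := Int.lt_floor_add_one x
  have h3 := abs_lt.1 (h.trans_le (min_le_right _ _))
  rw [← e x, ← e y]
  refine hη _ ⟨by linarith, by linarith⟩ _ ⟨by linarith, by linarith⟩ ?_
  rw [Real.dist_eq, sub_sub_sub_cancel_right]
  exact h.trans_le (min_le_left _ _)

/-- Closed curves in the sphere can be approximated by continuously differentiable loops. -/
theorem exists_c1Loop_near {K : ℝ → E4} (hK : Continuous K) (pK : Function.Periodic K 1)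
    (nK : ∀ s, ‖K s‖ = 1) {ε : ℝ} (hε : 0 < ε) :
    ∃ L, IsC1Loop L ∧ ∀ s, dist (L s) (K s) < ε := by
  set δ := min (ε / 4) (1 / 2) with hδ
  have δ0 : 0 < δ := by positivity
  have δε : δ ≤ ε / 4 := min_le_left _ _
  have δ1 : δ ≤ 1 / 2 := min_le_right _ _
  obtain ⟨η, η0, hη⟩ := uniformContinuous_of_periodic hK pK δ0
  set h := η / 2 with hh
  have h0 : 0 < h := by positivity
  set F : ℝ → E4 := fun x => ∫ y in (0 : ℝ)..x, K y with hF
  have hFd : ∀ x, HasDerivAt F (K x) x := fun x =>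
    intervalIntegral.integral_hasDerivAt_right (hK.intervalIntegrable _ _)
      (hK.stronglyMeasurableAtFilter _ _) hK.continuousAt
  have cF : ContDiff ℝ 1 F := contDiff_one_iff_deriv.2
    ⟨fun x => (hFd x).differentiableAt, by rwa [funext fun x => (hFd x).deriv]⟩
  -- The mean over a window of length h is C¹, periodic and within δ of the curve. Since δ ≤ 1/2 it
  -- stays away from zero, and pushing it back to the sphere costs at most another δ.
  set M : ℝ → E4 := fun x => h⁻¹ • (F (x + h) - F x) with hM
  have cM : ContDiff ℝ 1 M :=
    ((cF.comp (contDiff_id.add contDiff_const)).sub cF).const_smul h⁻¹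
  have eM : ∀ x, M x = h⁻¹ • ∫ y in x..(x + h), K y := fun x => by
    simp only [hM, hF]
    rw [intervalIntegral.integral_interval_sub_left (hK.intervalIntegrable _ _)
      (hK.intervalIntegrable _ _)]
  have pM : ∀ x, M (x + 1) = M x := fun x => by
    rw [eM, eM, add_right_comm, ← intervalIntegral.integral_comp_add_right]
    simp only [pK _]
  have dM : ∀ x, ‖M x - K x‖ ≤ δ := fun x => by
    have e : M x - K x = h⁻¹ • ∫ y in x..(x + h), (K y - K x) := by
      rw [eM, intervalIntegral.integral_sub (hK.intervalIntegrable _ _)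
        intervalIntegrable_const, intervalIntegral.integral_const, smul_sub, add_sub_cancel_left,
        inv_smul_smul₀ h0.ne']
    rw [e, norm_smul, Real.norm_eq_abs, abs_of_pos (inv_pos.2 h0)]
    have := intervalIntegral.norm_integral_le_of_norm_le_const (a := x) (b := x + h)
      (f := fun y => K y - K x) (C := δ) fun y hy => by
        rw [Set.uIoc_of_le (by linarith)] at hy
        rw [← dist_eq_norm]
        refine (hη y x ?_).le
        rw [abs_of_pos (by linarith [hy.1])]
        linarith [hy.2]
    rw [add_sub_cancel_left, abs_of_pos h0] at this
    rw [inv_mul_le_iff₀ h0, mul_comm]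
    exact this
  have nM : ∀ x, |‖M x‖ - 1| ≤ δ := fun x => by
    rw [← nK x]
    exact (abs_norm_sub_norm_le _ _).trans (dM x)
  have M0 : ∀ x, 0 < ‖M x‖ := fun x => by
    have := (abs_le.1 (nM x)).1
    linarith
  refine ⟨fun x => ‖M x‖⁻¹ • M x, ⟨?_, fun x => ?_, fun x => ?_⟩, fun x => ?_⟩
  · exact ((cM.norm ℝ fun x => norm_pos_iff.1 (M0 x)).inv fun x => (M0 x).ne').smul cM
  · simp only [pM x]
  · rw [norm_smul, norm_inv, norm_norm, inv_mul_cancel₀ (M0 x).ne']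
  · rw [dist_eq_norm]
    have e : ‖M x‖⁻¹ • M x - K x = (‖M x‖⁻¹ - 1) • M x + (M x - K x) := by
      rw [sub_smul, one_smul]; abel
    have e2 : ‖(‖M x‖⁻¹ - 1) • M x‖ ≤ δ := by
      rw [norm_smul, Real.norm_eq_abs, ← abs_of_pos (M0 x), ← abs_mul, abs_of_pos (M0 x), sub_mul,
        inv_mul_cancel₀ (M0 x).ne', one_mul, abs_sub_comm]
      exact nM x
    rw [e]
    refine (norm_add_le _ _).trans_lt ?_
    linarith [dM x]

/-! ### Symmetry of the linking number and conclusion -/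

theorem mapDegree_flip {X Y Z : ℝ → ℝ → ℝ} (h : TorusMap X Y Z) :
    mapDegree (fun s t => X t s) (fun s t => Y t s) (fun s t => Z t s) = -mapDegree X Y Z := by
  have e : ∀ s t, degreeDensity (fun s t => X t s) (fun s t => Y t s) (fun s t => Z t s) s t =
      -degreeDensity X Y Z t s := fun s t => by
    change solidForm (X t s) (Y t s) (Z t s) (derivSnd X t s) (derivSnd Y t s) (derivSnd Z t s)
      (derivFst X t s) (derivFst Y t s) (derivFst Z t s) = _
    simp only [degreeDensity, solidForm, tripleDet]
    ring
  simp only [mapDegree, e, intervalIntegral.integral_neg, mul_neg]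
  rw [← intervalIntegral_swap_of_continuous h.continuous_degreeDensity]

/-- Exchanging the loops reverses the orientation of the torus and composes the difference map with
the antipodal map of ℝ³; each contributes a factor −1. -/
theorem linkDegree_comm {L₁ L₂ : ℝ → E4} (h₁ : IsC1Loop L₁) (h₂ : IsC1Loop L₂)
    (hne : ∀ s t, L₁ s ≠ L₂ t) {p : E4} (hp₁ : ∀ s, inner ℝ p (L₁ s) < ‖p‖)
    (hp₂ : ∀ s, inner ℝ p (L₂ s) < ‖p‖) : linkDegree p L₂ L₁ = linkDegree p L₁ L₂ := by
  have e : ∀ e, stereoDiff e p L₂ L₁ = fun s t => -stereoDiff e p L₁ L₂ t s := fun e => by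
    ext s t; simp only [stereoDiff]; ring
  rw [linkDegree, e, e, e, mapDegree_neg_first, mapDegree_neg_mid, mapDegree_neg, neg_neg,
    mapDegree_flip (torusMap_stereoDiff h₁ h₂ hne hp₁ hp₂), neg_neg, linkDegree]

/-- Positive cosines say that nearby points have angles less than a quarter turn from those of the
curve, so a close loop inherits the lifts of its angles and the homotopy type of its projection. -/
theorem OffCoreLoop.exists_forall_near {K : ℝ → E4} (h : OffCoreLoop K) :
    ∃ ε > 0, ∀ s x, dist x (K s) < ε → 0 < horizontalNorm x ∧ 0 < verticalNorm x ∧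
      0 < horCosDiff x (K s) ∧ 0 < verCosDiff x (K s) := by
  have hev : ∀ s ∈ Set.Icc (0 : ℝ) 1, ∀ᶠ z : ℝ × E4 in 𝓝 (s, K s),
      0 < horizontalNorm z.2 ∧ 0 < verticalNorm z.2 ∧
      0 < horCosDiff z.2 (K z.1) ∧ 0 < verCosDiff z.2 (K z.1) := by
    intro s _
    have cK : ContinuousAt (fun z : ℝ × E4 => K z.1) (s, K s) :=
      (h.cont.comp continuous_fst).continuousAt
    have c2 : ContinuousAt (fun z : ℝ × E4 => z.2) (s, K s) := continuousAt_snd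
    have e1 := (continuous_horizontalNorm.continuousAt.comp c2).eventually
      (lt_mem_nhds (h.hor_pos s))
    have e2 := (continuous_verticalNorm.continuousAt.comp c2).eventually
      (lt_mem_nhds (h.ver_pos s))
    have e3 := (ContinuousAt.horCosDiff c2 cK (h.hor_pos s) (h.hor_pos s)).eventually
      (lt_mem_nhds (show 0 < horCosDiff (K s) (K s) by
        rw [horCosDiff, ← sq, ← sq, horCos_sq_add _ (h.hor_pos s)]; exact one_pos))
    have e4 := (ContinuousAt.verCosDiff c2 cK (h.ver_pos s) (h.ver_pos s)).eventually
      (lt_mem_nhds (show 0 < verCosDiff (K s) (K s) by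
        rw [verCosDiff, ← sq, ← sq, verCos_sq_add _ (h.ver_pos s)]; exact one_pos))
    filter_upwards [e1, e2, e3, e4] with z h1 h2 h3 h4
    exact ⟨h1, h2, h3, h4⟩
  obtain ⟨ε, ε0, hε⟩ := exists_forall_dist_lt_of_eventually h.cont isCompact_Icc hev
  refine ⟨ε, ε0, fun s x hx => ?_⟩
  have e : K (Int.fract s) = K s := h.apply_sub_int s _
  have := hε (Int.fract s) ⟨Int.fract_nonneg s, (Int.fract_lt_one s).le⟩ x (by rwa [e])
  simpa only [e] using this

theorem exists_forall_near_ne {K₁ K₂ : ℝ → E4} (h₁ : OffCoreLoop K₁) (h₂ : OffCoreLoop K₂)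
    (hne : ∀ s t, K₁ s ≠ K₂ t) :
    ∃ ε > 0, ∀ s t x y, dist x (K₁ s) < ε → dist y (K₂ t) < ε → x ≠ y := by
  have hg : Continuous fun x : ℝ × ℝ => (K₁ x.1, K₂ x.2) :=
    (h₁.cont.comp continuous_fst).prodMk (h₂.cont.comp continuous_snd)
  have hev : ∀ x ∈ Set.Icc (0 : ℝ) 1 ×ˢ Set.Icc (0 : ℝ) 1,
      ∀ᶠ z : (ℝ × ℝ) × (E4 × E4) in 𝓝 (x, (K₁ x.1, K₂ x.2)), z.2.1 ≠ z.2.2 := fun x _ =>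
    (isOpen_ne_fun (by fun_prop) (by fun_prop)).mem_nhds (hne x.1 x.2)
  obtain ⟨ε, ε0, hε⟩ :=
    exists_forall_dist_lt_of_eventually hg (isCompact_Icc.prod isCompact_Icc) hev
  refine ⟨ε, ε0, fun s t x y hx hy => ?_⟩
  refine hε (Int.fract s, Int.fract t)
    ⟨⟨Int.fract_nonneg s, (Int.fract_lt_one s).le⟩, ⟨Int.fract_nonneg t, (Int.fract_lt_one t).le⟩⟩
    (x, y) ?_
  have e1 : K₁ (Int.fract s) = K₁ s := h₁.apply_sub_int s _
  have e2 : K₂ (Int.fract t) = K₂ t := h₂.apply_sub_int t _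
  rw [e1, e2, Prod.dist_eq]
  exact max_lt hx hy

/-- The angles of a continuously differentiable loop near a closed curve with a given homotopy type
of its projection to the torus. -/
theorem HasHomotopyType.exists_angles {K : C(UnitAddCircle, S3)} {a b : ℤ}
    (h : HasHomotopyType K a b) (hK : OffCoreLoop (unroll K)) {L : ℝ → E4} (hL : IsC1Loop L)
    (hh : ∀ s, 0 < horizontalNorm (L s)) (hv : ∀ s, 0 < verticalNorm (L s))
    (hhc : ∀ s, 0 < horCosDiff (L s) (unroll K s)) (hvc : ∀ s, 0 < verCosDiff (L s) (unroll K s)) :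
    ∃ u v : ℝ → ℝ, ContDiff ℝ 1 u ∧ ContDiff ℝ 1 v ∧ (∀ x, u (x + 1) = u x) ∧
      (∀ x, v (x + 1) = v x) ∧ (∀ x, horCos (L x) = Real.cos (2 * π * (a * x + u x))) ∧
      (∀ x, horSin (L x) = Real.sin (2 * π * (a * x + u x))) ∧
      (∀ x, verCos (L x) = Real.cos (2 * π * (b * x + v x))) ∧
      ∀ x, verSin (L x) = Real.sin (2 * π * (b * x + v x)) := by
  obtain ⟨g, k, hgk⟩ := h.exists_lift
  have hc := fun x => coords_of_torusProj (hK.hor_pos x) (hK.ver_pos x) (hgk x)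
  have t := torusCoords_of_loop hL hh hv
  have p : ∀ (f : C(UnitAddCircle, ℝ)) (x : ℝ),
      f ((x + 1 : ℝ) : UnitAddCircle) = f (x : UnitAddCircle) := fun f x => by
    have := coe_add_int x 1
    rw [Int.cast_one] at this
    rw [this]
  have cf : ∀ f : C(UnitAddCircle, ℝ), Continuous fun x : ℝ => f (x : UnitAddCircle) := fun f =>
    f.continuous.comp (AddCircle.continuous_mk' 1)
  obtain ⟨u, u1, u2, u3, u4⟩ := exists_angle (a := a) t.dc t.ds t.pc t.ps t.cs (cf g) (p g)
    fun x => by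
      have := hhc x
      rw [horCosDiff] at this
      rw [← (hc x).1.1, ← (hc x).1.2]
      exact this
  obtain ⟨v, v1, v2, v3, v4⟩ := exists_angle (a := b) t.dk t.dl t.pk t.pl t.kl (cf k) (p k)
    fun x => by
      have := hvc x
      rw [verCosDiff] at this
      rw [← (hc x).2.1, ← (hc x).2.2]
      exact this
  exact ⟨u, v, u1, v1, u2, v2, u3, u4, v3, v4⟩

/-- The formula is not symmetric: seen from the front core circle, only the crossings with the first
knot over and one of the two winding products appear. -/
theorem exists_forall_linkDegree_eq {K₁ K₂ : C(UnitAddCircle, S3)}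
    (h₁ : OffCoreLoop (unroll K₁)) (h₂ : OffCoreLoop (unroll K₂))
    (hdis : Disjoint (Set.range K₁) (Set.range K₂)) (hgen : InGeneralPosition K₁ K₂)
    {α₁ β₁ α₂ β₂ : ℤ} (htype₁ : HasHomotopyType K₁ α₁ β₁) (htype₂ : HasHomotopyType K₂ α₂ β₂) :
    ∃ ε > 0, ∀ L₁ L₂ : ℝ → E4, IsC1Loop L₁ → IsC1Loop L₂ →
      (∀ s, dist (L₁ s) (unroll K₁ s) < ε) → (∀ s, dist (L₂ s) (unroll K₂ s) < ε) →
      (∀ s t, L₁ s ≠ L₂ t) ∧ (∀ s, inner ℝ frontPole (L₁ s) < ‖frontPole‖) ∧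
      (∀ s, inner ℝ frontPole (L₂ s) < ‖frontPole‖) ∧
      linkDegree frontPole L₁ L₂ =
        ((frontPos K₁ K₂).ncard : ℝ) - (frontNeg K₁ K₂).ncard - α₁ * β₂ := by
  have hne : ∀ s t, unroll K₁ s ≠ unroll K₂ t := fun s t h =>
    Set.disjoint_left.1 hdis ⟨s, Subtype.ext h⟩ ⟨t, rfl⟩
  obtain ⟨ε₁, p₁, hε₁⟩ := h₁.exists_forall_near
  obtain ⟨ε₂, p₂, hε₂⟩ := h₂.exists_forall_near
  obtain ⟨ε₃, p₃, hε₃⟩ := exists_forall_near_ne h₁ h₂ hne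
  obtain ⟨ε₄, p₄, hε₄⟩ := exists_forall_mapDegree_eq_front h₁ h₂ hdis hgen
  refine ⟨min (min ε₁ ε₂) (min ε₃ ε₄), by positivity, fun L₁ L₂ l₁ l₂ d₁ d₂ => ?_⟩
  have m₁ := fun s => hε₁ s (L₁ s) ((d₁ s).trans_le ((min_le_left _ _).trans (min_le_left _ _)))
  have m₂ := fun s => hε₂ s (L₂ s) ((d₂ s).trans_le ((min_le_left _ _).trans (min_le_right _ _)))
  have hL : ∀ s t, L₁ s ≠ L₂ t := fun s t => hε₃ s t _ _
    ((d₁ s).trans_le ((min_le_right _ _).trans (min_le_left _ _)))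
    ((d₂ t).trans_le ((min_le_right _ _).trans (min_le_left _ _)))
  have hh₁ := fun s => (m₁ s).1
  have hv₁ := fun s => (m₁ s).2.1
  have hh₂ := fun s => (m₂ s).1
  have hv₂ := fun s => (m₂ s).2.1
  refine ⟨hL, fun s => ?_, fun s => ?_, ?_⟩
  · rw [inner_frontPole, norm_frontPole]
    exact (cayleyRe_loop (l₁.norm_eq_one s) (hh₁ s) (hv₁ s)).2.2
  · rw [inner_frontPole, norm_frontPole]
    exact (cayleyRe_loop (l₂.norm_eq_one s) (hh₂ s) (hv₂ s)).2.2
  have t₁ := torusCoords_of_loop l₁ hh₁ hv₁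
  have t₂ := torusCoords_of_loop l₂ hh₂ hv₂
  obtain ⟨u₁, v₁, du₁, dv₁, pu₁, pv₁, c₁, s₁, -, -⟩ :=
    htype₁.exists_angles h₁ l₁ hh₁ hv₁ (fun s => (m₁ s).2.2.1) fun s => (m₁ s).2.2.2
  obtain ⟨u₂, v₂, du₂, dv₂, pu₂, pv₂, c₂, s₂, k₂, q₂⟩ :=
    htype₂.exists_angles h₂ l₂ hh₂ hv₂ (fun s => (m₂ s).2.2.1) fun s => (m₂ s).2.2.2
  have hT := torusMap_crossing t₁ t₂ fun s t hC e1 e2 => hL s t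
    (eq_of_coords_eq (l₁.norm_eq_one s) (l₂.norm_eq_one t) (hh₁ s) (hv₁ s) (hh₂ t) (hv₂ t) hC e1 e2)
  rw [linkDegree_frontPole l₁ l₂ hL hh₁ hv₁ hh₂ hv₂]
  refine congrArg₂ (· - ·) ?_ (windingDegree_eq α₁ α₂ β₂ du₁ du₂ dv₂ t₂.dr pu₁ pu₂ pv₂ t₂.pr t₂.r_pos
    t₂.r_lt c₁ s₁ c₂ s₂ k₂ q₂)
  exact hε₄ L₁ L₂ (fun s => (d₁ s).trans_le ((min_le_right _ _).trans (min_le_right _ _)))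
    (fun s => (d₂ s).trans_le ((min_le_right _ _).trans (min_le_right _ _))) l₁.periodic l₂.periodic
    hT

end TorusDiagram

end

open TorusDiagram in
theorem lemma3p5 (K₁ K₂ : C(UnitAddCircle, S3))
    (hK₁ : Function.Injective K₁) (hK₂ : Function.Injective K₂)
    (hdisj : Disjoint (Set.range K₁) (Set.range K₂))
    (hcore₁ : Disjoint (Set.range K₁) (coreFront ∪ coreBack))
    (hcore₂ : Disjoint (Set.range K₂) (coreFront ∪ coreBack))
    (hgen : InGeneralPosition K₁ K₂)
    (α₁ β₁ α₂ β₂ : ℤ)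
    (htype₁ : HasHomotopyType K₁ α₁ β₁) (htype₂ : HasHomotopyType K₂ α₂ β₂) :
    ∃ lk : ℤ, HasLinkingNumber K₁ K₂ lk ∧
      (lk : ℚ) = 1 / 2 *
        ((crossPos K₁ K₂ : ℚ) - (crossNeg K₁ K₂ : ℚ) - (α₁ * β₂ : ℚ) - (α₂ * β₁ : ℚ)) := by
  have h₁ := offCoreLoop_unroll hcore₁
  have h₂ := offCoreLoop_unroll hcore₂
  obtain ⟨ε, ε0, hε⟩ := exists_forall_linkDegree_eq h₁ h₂ hdisj hgen htype₁ htype₂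
  obtain ⟨δ, δ0, hδ⟩ := exists_forall_linkDegree_eq h₂ h₁ hdisj.symm (inGeneralPosition_comm hgen)
    htype₂ htype₁
  -- A single pair of C¹ loops close enough for both asymmetric formulas is used to compare them;
  -- their equality then is a statement about the knots alone.
  obtain ⟨L₁, l₁, d₁⟩ := exists_c1Loop_near h₁.cont h₁.periodic (fun s => norm_coe_S3 (K₁ s))
    (lt_min ε0 δ0)
  obtain ⟨L₂, l₂, d₂⟩ := exists_c1Loop_near h₂.cont h₂.periodic (fun s => norm_coe_S3 (K₂ s))
    (lt_min ε0 δ0)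
  obtain ⟨ne, q₁, q₂, e⟩ := hε L₁ L₂ l₁ l₂ (fun s => (d₁ s).trans_le (min_le_left _ _))
    fun s => (d₂ s).trans_le (min_le_left _ _)
  obtain ⟨-, -, -, e'⟩ := hδ L₂ L₁ l₂ l₁ (fun s => (d₂ s).trans_le (min_le_right _ _))
    fun s => (d₁ s).trans_le (min_le_right _ _)
  rw [linkDegree_comm l₁ l₂ ne q₁ q₂, e] at e'
  have key : ((frontPos K₁ K₂).ncard : ℤ) - (frontNeg K₁ K₂).ncard - α₁ * β₂ =
      (frontPos K₂ K₁).ncard - (frontNeg K₂ K₁).ncard - α₂ * β₁ := by exact_mod_cast e'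
  refine ⟨(frontPos K₁ K₂).ncard - (frontNeg K₁ K₂).ncard - α₁ * β₂, ⟨ε, ε0, ?_⟩, ?_⟩
  · intro A B hA hB dA dB p hp pA pB
    obtain ⟨neAB, qA, qB, eAB⟩ := hε A B hA hB dA dB
    rw [gaussIntegral_eq_linkDegree hA hB hp pA pB, linkDegree_eq hA hB neAB
      (fun s => inner_lt_norm hp (hA.norm_eq_one s) (pA s))
      (fun s => inner_lt_norm hp (hB.norm_eq_one s) (pB s)) qA qB, eAB]
    push_cast
    rfl
  · have keyQ : ((frontPos K₁ K₂).ncard : ℚ) - (frontNeg K₁ K₂).ncard - α₁ * β₂ =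
        (frontPos K₂ K₁).ncard - (frontNeg K₂ K₁).ncard - α₂ * β₁ := by exact_mod_cast key
    rw [crossPos_eq h₁ h₂ hdisj hgen, crossNeg_eq h₁ h₂ hdisj hgen]
    push_cast
    -- The linking number was defined by the first formula; equality with the second makes it half
    -- of their sum, in which every mixed crossing is counted once.
    linarith
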